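/- Let $K$ be a field, $R=K[[x_1,\dots,x_s]]$ with maximal ideal $\mathfrak m$, and for $f\in R$ let $\mathrm j(f)=\langle \partial f/\partial x_1,\dots,\partial f/\partial x_s\rangle$. Let $G$ be the right group $\mathcal R=\mathrm{Aut}_K(R)$, acting by $f\mapsto\phi(f)$, or the contact group $\mathcal G_l=R^\times\rtimes\mathrm{Aut}_K(R)$, acting by $f\mapsto u\cdot\phi(f)$. The series $f$ is $G$ $k$-determined if every $g\in R$ with $g-f\in\mathfrak m^{k+1}$ lies in $Gf$, and finitely $G$-determined if this holds for some positive integer $k$. For $k\ge 0$ let $R^{(k)}=R/\mathfrak m^{k+1}$, and let $G^{(k)}$ be the algebraic group of $k$-jets of elements of $G$, acting on $R^{(k)}$ through representatives, with orbit map $o^{(k)}:G^{(k)}\to G^{(k)}\mathrm{jet}_k(f)$. Orbits, dimensions and separability are taken over an algebraically closed extension field $K'$ of $K$. Let $T_k=T_{\mathrm{jet}_k(f)}(G^{(k)}\mathrm{jet}_k(f))\subset R^{(k)}$ be the ($K$-rational) Zariski tangent space to the orbit, and $\widetilde T_k\subset T_k$ the image of the tangent map of $o^{(k)}$ at the identity.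 Put $T_f(Gf)=\varprojlim_k T_k\subset R$, $\widetilde T_f(\mathcal Rf)=\mathfrak m\cdot\mathrm j(f)$ and $\widetilde T_f(\mathcal G_lf)=\langle f\rangle+\mathfrak m\cdot\mathrm j(f)$. 1. Let $\mathrm{char}(K)=p>0$, $s\ge1$, $G=\mathcal R$ and $f=x_1^p+\dots+x_s^p$. Then $\mathrm j(f)=0$ and $\widetilde T_f(\mathcal Rf)=0$. For every $k\ge p$ one has $\widetilde T_k=0$, while the orbit of $\mathrm{jet}_k(f)$ and its tangent space $T_k$ have dimension $\ge1$; so $\widetilde T_k\subsetneq T_k$, and $o^{(k)}$ is not separable. Moreover $\widetilde T_f(\mathcal Rf)\subsetneq T_f(\mathcal Rf)$, and $f$ is not finitely $\mathcal R$-determined. 2. Let $\mathrm{char}(K)=2$, $R=K[[x,y]]$, $G=\mathcal G_l$ and $f=x^2+y^3$. Then $f$ is $\mathcal G_l$ $4$-determined; $\widetilde T_f(\mathcal G_lf)=\langle x^2,xy^2,y^3\rangle$; $\dim_K\widetilde T_4=10$; the group $\mathcal G_l^{(4)}$ has dimension $43$, the stabilizer of $\mathrm{jet}_4(f)$ in it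 has dimension $32$, and the orbit $\mathcal G_l^{(4)}\mathrm{jet}_4(f)$ has dimension $11$. Hence $\widetilde T_4\subsetneq T_4$, $o^{(4)}$ is not separable, and $\widetilde T_f(\mathcal G_lf)\subsetneq T_f(\mathcal G_lf)$. 3. Let $\mathrm{char}(K)=3$, $R=K[[x,y]]$, $G=\mathcal G_l$ and $f=x^3+y^4$. Then $\dim_K\widetilde T_5=11$ and $\dim_KT_5=12$. Hence $\widetilde T_5\subsetneq T_5$, $o^{(5)}$ is not separable, and $\widetilde T_f(\mathcal G_lf)\subsetneq T_f(\mathcal G_lf)$. 4. Let $\mathrm{char}(K)=3$, $R=K[[x,y]]$, $G=\mathcal G_l$ and $f=x^2+y^3$. Then $\widetilde T_f(\mathcal G_lf)=T_f(\mathcal G_lf)$, and for every $k\ge0$ one has $\widetilde T_k=T_k$ and $o^{(k)}$ is separable. -/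

import Mathlib

noncomputable section

namespace TangentImage

/-! ### Power series, the right group and the contact group -/

/-- The formal power series ring `R = K[[x_1, ..., x_s]]`. -/
abbrev PS (s : ℕ) (K : Type*) [Field K] : Type _ := MvPowerSeries (Fin s) K

/-- The right group: all `K`-algebra automorphisms of `R`; it acts on `R` by evaluation. -/
abbrev RightGroup (s : ℕ) (K : Type*) [Field K] : Type _ := PS s K ≃ₐ[K] PS s K

/-- The contact group `GL(1, R) ⋊ Aut(R)`, where `GL(1, R)` is the unit group of `R`. -/
abbrev ContactGroup (s : ℕ) (K : Type*) [Field K] : Type _ :=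
  (PS s K)ˣ ⋊[MulDistribMulAction.toMulAut (RightGroup s K) (PS s K)ˣ] RightGroup s K

/-- The action `(u, φ) • f = u * φ f` of the contact group on `R`. -/
instance (s : ℕ) (K : Type*) [Field K] : MulAction (ContactGroup s K) (PS s K) where
  smul g f := (g.left : PS s K) * g.right f
  one_smul f := by
    change ((1 : (PS s K)ˣ) : PS s K) * (1 : RightGroup s K) f = f
    simp
  mul_smul g h f := by
    change ((g * h).left : PS s K) * (g * h).right f =
      (g.left : PS s K) * g.right ((h.left : PS s K) * h.right f)
    rw [map_mul, ← mul_assoc]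
    rfl

/-- `f` is `G` `k`-determined: every `g` with `g - f ∈ 𝔪 ^ (k + 1)` lies in the orbit `G f`. -/
def IsDetermined {s : ℕ} {K : Type*} [Field K] (G : Type*) [Group G] [MulAction G (PS s K)]
    (k : ℕ) (f : PS s K) : Prop :=
  ∀ g : PS s K, g - f ∈ IsLocalRing.maximalIdeal (PS s K) ^ (k + 1) → g ∈ MulAction.orbit G f

/-- `f` is finitely `G`-determined. -/
def IsFinitelyDetermined {s : ℕ} {K : Type*} [Field K] (G : Type*) [Group G]
    [MulAction G (PS s K)] (f : PS s K) : Prop :=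
  ∃ k : ℕ, 0 < k ∧ IsDetermined G k f

/-! ### Jets -/

/-- Exponents of total degree at most `k`. The corresponding monomials are a `K`-basis of
`R / 𝔪 ^ (k + 1)`, so the jet space `R / 𝔪 ^ (k + 1)` is identified with the affine space
`JetIndex s k → K`. -/
abbrev JetIndex (s k : ℕ) : Type := {d : Fin s →₀ ℕ // d.degree ≤ k}

instance (s k : ℕ) : Finite (JetIndex s k) := (Finsupp.finite_of_degree_le (σ := Fin s) k).to_subtype

instance (s k : ℕ) : Fintype (JetIndex s k) := Fintype.ofFinite _

/-- The `k`-jet of a power series. -/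
def jet {s : ℕ} {K : Type*} [Field K] (k : ℕ) : PS s K →ₗ[K] (JetIndex s k → K) :=
  LinearMap.pi fun d => MvPowerSeries.coeff d.1

/-- Coordinates on the `k`-jets of the right group: the coefficients of degree `1, ..., k` of the
images of the variables. -/
abbrev RightIndex (s k : ℕ) : Type := Fin s × {d : JetIndex s k // d.1 ≠ 0}

/-- Coordinates on the `k`-jets of the contact group: the coefficients of degree `0, ..., k` of the
unit, and the coordinates of the automorphism. -/
abbrev ContactIndex (s k : ℕ) : Type := JetIndex s k ⊕ RightIndex s k

instance (s k : ℕ) : Fintype {d : JetIndex s k // d.1 ≠ 0} := Fintype.ofFinite _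

/-- The `k`-jet of an automorphism. -/
def rightJet {s : ℕ} {K : Type*} [Field K] (k : ℕ) (φ : RightGroup s K) : RightIndex s k → K :=
  fun c => MvPowerSeries.coeff c.2.1.1 (φ (MvPowerSeries.X c.1))

/-- The `k`-jet of an element of the contact group. -/
def contactJet {s : ℕ} {K : Type*} [Field K] (k : ℕ) (g : ContactGroup s K) :
    ContactIndex s k → K :=
  Sum.elim (jet k (g.left : PS s K)) (rightJet k g.right)

/-- The orbit of `jet k f` under `G`, over the extension field `K'`: here `G` is one of the groups
over `K'`, and jets are acted upon through representatives. -/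
def jetOrbit {s : ℕ} {K K' : Type*} [Field K] [Field K'] [Algebra K K'] (G : Type*) [Group G]
    [MulAction G (PS s K')] (k : ℕ) (f : PS s K) : Set (JetIndex s k → K') :=
  jet k '' MulAction.orbit G (MvPowerSeries.map (algebraMap K K') f)

/-- The `k`-jets of the contact group over `K'`. -/
def contactJetGroup (s : ℕ) (K' : Type*) [Field K'] (k : ℕ) : Set (ContactIndex s k → K') :=
  Set.range (contactJet (s := s) (K := K') k)

/-- The stabilizer of `jet k f` in the group of `k`-jets of the contact group, over `K'`. -/
def contactJetStabilizer {s : ℕ} {K : Type*} (K' : Type*) [Field K] [Field K'] [Algebra K K']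
    (k : ℕ) (f : PS s K) : Set (ContactIndex s k → K') :=
  contactJet k '' {g : ContactGroup s K' | jet k (g • MvPowerSeries.map (algebraMap K K') f) =
    jet k (MvPowerSeries.map (algebraMap K K') f)}

/-! ### The orbit map as a polynomial map -/

/-- The polynomial power series with prescribed coefficients of degree at most `k`. -/
def seriesOfJet {s k : ℕ} {A : Type*} [CommRing A] (c : JetIndex s k → A) :
    MvPowerSeries (Fin s) A :=
  ∑ d, MvPowerSeries.monomial d.1 (c d)

/-- The tuple of power series without constant term with prescribed coefficients of degree
`1, ..., k`. -/
def tupleOfJet {s k : ℕ} {A : Type*} [CommRing A] (c : RightIndex s k → A) (i : Fin s) :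
    MvPowerSeries (Fin s) A :=
  ∑ d : {d : JetIndex s k // d.1 ≠ 0}, MvPowerSeries.monomial d.1.1 (c (i, d))

/-- The orbit map `φ ↦ jet k (φ f)` on `k`-jets of the right group, as a tuple of polynomials in the
coordinates of `φ`: the coefficients of `f(φ_1, ..., φ_s)` for generic `φ_i`. -/
def rightOrbitMap {s : ℕ} {K : Type*} [Field K] (k : ℕ) (f : PS s K) :
    JetIndex s k → MvPolynomial (RightIndex s k) K :=
  fun d => MvPowerSeries.coeff d.1 (MvPowerSeries.subst (tupleOfJet MvPolynomial.X) f)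

/-- The orbit map `(u, φ) ↦ jet k (u * φ f)` on `k`-jets of the contact group, as a tuple of
polynomials in the coordinates of `(u, φ)`. -/
def contactOrbitMap {s : ℕ} {K : Type*} [Field K] (k : ℕ) (f : PS s K) :
    JetIndex s k → MvPolynomial (ContactIndex s k) K :=
  fun d => MvPowerSeries.coeff d.1
    (seriesOfJet (fun i => MvPolynomial.X (Sum.inl i)) *
      MvPowerSeries.subst (tupleOfJet fun c => MvPolynomial.X (Sum.inr c)) f)

/-! ### Tangent maps, Zariski tangent spaces, dimension, separability -/

/-- The differential at `x` of a polynomial `F`, as a linear form. -/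
def differential {ι : Type*} [Fintype ι] {K : Type*} [Field K] (x : ι → K) (F : MvPolynomial ι K) :
    (ι → K) →ₗ[K] K :=
  ∑ i, MvPolynomial.eval x (MvPolynomial.pderiv i F) • LinearMap.proj i

/-- The tangent map at `x` of the polynomial map with components `o`. -/
def tangentMap {ι κ : Type*} [Fintype ι] {K : Type*} [Field K] (x : ι → K)
    (o : κ → MvPolynomial ι K) : (ι → K) →ₗ[K] (κ → K) :=
  LinearMap.pi fun j => differential x (o j)

/-- The Zariski tangent space over `K` at the `K`-rational point `x` of a set `V` of `K'`-points of
affine space: the common kernel of the differentials at `x` of the polynomials over `K` that vanish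
on `V`. -/
def zariskiTangentSpace {ι : Type*} [Fintype ι] {K K' : Type*} [Field K] [Field K'] [Algebra K K']
    (V : Set (ι → K')) (x : ι → K) : Submodule K (ι → K) :=
  ⨅ F ∈ MvPolynomial.vanishingIdeal K V, LinearMap.ker (differential x F)

/-- The dimension of a set `V` of points of affine space over `K'`: the Krull dimension of the
coordinate ring of its Zariski closure. -/
def zariskiDim {ι : Type*} {K' : Type*} [Field K'] (V : Set (ι → K')) : WithBot ℕ∞ :=
  ringKrullDim (MvPolynomial ι K' ⧸ MvPolynomial.vanishingIdeal K' V)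

/-- A polynomial map `o`, defined over `K` and considered over `K'` on a Zariski dense open subset
of affine space, is separable onto its image: the rational function field `E` of its source is
separably generated over the function field `L` of its image, where `L` is embedded in `E` by
pulling back rational functions, that is, as the subfield generated over `K'` by the components
of `o`. -/
def IsSeparableMap (K' : Type*) {ι κ K : Type*} [Field K] [Field K'] [Algebra K K']
    (o : κ → MvPolynomial ι K) : Prop :=
  let E := FractionRing (MvPolynomial ι K')
  let L : IntermediateField K' E := IntermediateField.adjoin K'
    (Set.range fun j => algebraMap (MvPolynomial ι K') E
      (MvPolynomial.map (algebraMap K K') (o j)))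
  ∃ S : Set E, IsTranscendenceBasis L ((↑) : S → E) ∧
    Algebra.IsSeparable (IntermediateField.adjoin L S) E

/-! ### Tangent images and tangent spaces of orbits -/

/-- The tangent image of the right group on `k`-jets: the image of the tangent map, at the identity,
of the orbit map through `jet k f`. The `k`-jets of the group are open in affine space, so their
tangent space is the whole coordinate space. -/
def rightJetTangentImage {s : ℕ} {K : Type*} [Field K] (k : ℕ) (f : PS s K) :
    Submodule K (JetIndex s k → K) :=
  LinearMap.range (tangentMap (rightJet k (1 : RightGroup s K)) (rightOrbitMap k f))

/-- The tangent image of the contact group on `k`-jets. -/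
def contactJetTangentImage {s : ℕ} {K : Type*} [Field K] (k : ℕ) (f : PS s K) :
    Submodule K (JetIndex s k → K) :=
  LinearMap.range (tangentMap (contactJet k (1 : ContactGroup s K)) (contactOrbitMap k f))

/-- The tangent space at `jet k f` to the orbit of `jet k f` under `G`. -/
def jetTangentSpace {s : ℕ} {K K' : Type*} [Field K] [Field K'] [Algebra K K'] (G : Type*) [Group G]
    [MulAction G (PS s K')] (k : ℕ) (f : PS s K) : Submodule K (JetIndex s k → K) :=
  zariskiTangentSpace (jetOrbit (K' := K') G k f) (jet k f)

/-- The ideal `j(f)` generated by the partial derivatives of `f`. -/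
def jacobianIdeal {s : ℕ} {K : Type*} [Field K] (f : PS s K) : Ideal (PS s K) :=
  Ideal.span (Set.range fun i => MvPowerSeries.pderiv K i f)

/-- The tangent image `𝔪 j(f)` at `f` of the right group. -/
def rightTangentImage {s : ℕ} {K : Type*} [Field K] (f : PS s K) : Ideal (PS s K) :=
  IsLocalRing.maximalIdeal (PS s K) * jacobianIdeal f

/-- The tangent image `⟨f⟩ + 𝔪 j(f)` at `f` of the contact group. -/
def contactTangentImage {s : ℕ} {K : Type*} [Field K] (f : PS s K) : Ideal (PS s K) :=
  Ideal.span {f} + IsLocalRing.maximalIdeal (PS s K) * jacobianIdeal f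

/-- The tangent space at `f` to the orbit `G f`: the inverse limit of the tangent spaces on jets,
that is, the power series all of whose jets are tangent to the orbits of the jets of `f`. -/
def tangentSpace {s : ℕ} {K K' : Type*} [Field K] [Field K'] [Algebra K K'] (G : Type*) [Group G]
    [MulAction G (PS s K')] (f : PS s K) : Submodule K (PS s K) :=
  ⨅ k : ℕ, (jetTangentSpace (K' := K') G k f).comap (jet k)

end TangentImage

end

/-!
All four series are sums of powers `f = ∑ x_i ^ n_i`, so `u * φ f = u * ∑ φ(x_i) ^ n_i`, and the
orbit maps on jets are given by explicit polynomials. Their tangent maps at the identity have as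
images the jets of the elements of `⟨f⟩ + 𝔪 j(f)` (`contactJetTangentImage_powerSum`), which in all
cases here is a monomial ideal; the tangent image on jets is then a coordinate subspace. The tangent
image lies in the tangent space (`contactJetTangentImage_le_jetTangentSpace`), since the jets of the
group are Zariski dense in an affine space.

*Strictness.* If `p` is the characteristic, `x_i ^ p` is an invisible direction: the derivative of
`x_i ↦ x_i ^ p` vanishes. But the line `f + t x_1 ^ p` (for `∑ x_i ^ p`) or `f + t y ^ p` (for
`x ^ p + y ^ (p + 1)`) meets the orbit in infinitely many points, by a scaling of `x_1` or the
substitution `x ↦ x + t ^ (1 / p) y`, so its direction is tangent to the orbit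
(`mem_zariskiTangentSpace_of_infinite`). The cases `p = 2` and `p = 3` of `x ^ p + y ^ (p + 1)` are
treated together as far as possible.

*Separability.* If the function field `E` of the jet group is separably generated over the function
field `L` of the orbit, then a derivation of `E` that vanishes on `L` is determined by its values on a
separating transcendence basis. These derivations are the vectors in the kernel of the Jacobian
matrix at the generic point, so the transcendence degree of `L` is at most the rank of that matrix
(`IsSeparableMap.card_add_finrank_le`). That rank is bounded by exhibiting vectors in the kernel. The
transcendence degree is bounded below by solving `u * φ f = g` modulo high order for generic `g`
(`exists_charTwoValue_eq`, `exists_charThreeValue_eq`). Conversely, for `x ^ 2 + y ^ 3` in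
characteristic 3 the function field of the orbit is generated by as many coefficients as the rank of
the tangent map at the identity, and the Jacobian criterion gives separability
(`isSeparableMap_of_surjective`); the only other coefficient that does not vanish is determined by
the relation `c₁₁ ^ 2 = 4 c₂₀ c₀₂`, whose differential also bounds the tangent space.

*Dimensions.* The dimension of the orbit is the number of coefficients in such an algebraically
independent family, as the other coefficients vanish (`zariskiDim_eq_card`). The equations of the
stabilizer of `x ^ 2 + y ^ 3` in characteristic 2 can be solved explicitly: it is the product of a
punctured line and an affine space of dimension 31 (`mem_contactJetStabilizer_iff`).

*Determinacy.* In characteristic 2, the equation `(1 + v) * (x ^ 2 + (y + w) ^ 3) = g` for `g` close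
to `x ^ 2 + y ^ 3` is a fixed point problem for a contraction in the `𝔪`-adic topology
(`isDetermined_four_of_charTwo`). That `∑ x_i ^ p` is not finitely determined is seen from the partial
derivatives: they vanish on the whole orbit.
-/

noncomputable section

namespace TangentImage

open MvPowerSeries

/-! ### Monomial ideals and the order of power series -/

section MonomialIdeals

variable {σ : Type*} {A : Type*} [CommRing A]

theorem coeff_monomial_one_mul (m d : σ →₀ ℕ) (f : MvPowerSeries σ A) [Decidable (m ≤ d)] :
    coeff d (monomial m 1 * f) = if m ≤ d then coeff (d - m) f else 0 := by
  classical
  rw [coeff_monomial_mul]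
  split_ifs <;> simp

/-- A series supported on the multiples of the monomials in `M` is a combination of them. Each exponent
of `f` is assigned to a single monomial of `M`, so the nonzero coefficients of the `c m` are
coefficients of `f`, and lower bounds on the order of `f` pass to the `c m`. -/
theorem exists_eq_sum_monomial_mul (M : Finset (σ →₀ ℕ)) (f : MvPowerSeries σ A)
    (hf : ∀ d, (∀ m ∈ M, ¬ m ≤ d) → coeff d f = 0) :
    ∃ c : (σ →₀ ℕ) → MvPowerSeries σ A, f = ∑ m ∈ M, monomial m 1 * c m ∧
      ∀ m d, coeff d (c m) = coeff (d + m) f ∨ coeff d (c m) = 0 := by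
  classical
  have hch : ∀ d : σ →₀ ℕ, ∃ m, (∃ m ∈ M, m ≤ d) → m ∈ M ∧ m ≤ d := by
    intro d
    by_cases h : ∃ m ∈ M, m ≤ d
    · obtain ⟨m, hm⟩ := h
      exact ⟨m, fun _ => hm⟩
    · exact ⟨0, fun h' => absurd h' h⟩
  choose μ hμ using hch
  let c : (σ →₀ ℕ) → MvPowerSeries σ A := fun m d => if μ (d + m) = m then coeff (d + m) f else 0
  have hcc : ∀ m d, coeff d (c m) = if μ (d + m) = m then coeff (d + m) f else 0 := fun _ _ => rfl
  refine ⟨c, ?_, fun m d => ?_⟩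
  · ext d
    rw [map_sum]
    simp only [coeff_monomial_one_mul, hcc]
    by_cases h : ∃ m ∈ M, m ≤ d
    · obtain ⟨h1, h2⟩ := hμ d h
      rw [Finset.sum_eq_single (μ d)]
      · rw [if_pos h2, tsub_add_cancel_of_le h2, if_pos rfl]
      · intro m _ hne
        split_ifs with hmd h'
        · rw [tsub_add_cancel_of_le hmd] at h'
          exact absurd h'.symm hne
        · rfl
        · rfl
      · exact fun h => absurd h1 h
    · push Not at h
      rw [hf d h, Finset.sum_eq_zero]
      intro m hm
      rw [if_neg (h m hm)]
  · rw [hcc]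
    split_ifs
    · exact Or.inl rfl
    · exact Or.inr rfl

/-- Membership in a monomial ideal is read off from the coefficients. -/
theorem mem_span_monomial_iff (M : Finset (σ →₀ ℕ)) (f : MvPowerSeries σ A) :
    f ∈ Ideal.span ((fun m => monomial m (1 : A)) '' (M : Set (σ →₀ ℕ))) ↔
      ∀ d, (∀ m ∈ M, ¬ m ≤ d) → coeff d f = 0 := by
  classical
  constructor
  · intro h d hd
    induction h using Submodule.span_induction generalizing d with
    | mem x hx =>
      obtain ⟨m, hm, rfl⟩ := hx
      rw [coeff_monomial, if_neg]
      rintro rfl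
      exact hd d hm le_rfl
    | zero => simp
    | add x y _ _ hx hy => rw [map_add, hx d hd, hy d hd, add_zero]
    | smul a x _ hx =>
      rw [smul_eq_mul, coeff_mul]
      refine Finset.sum_eq_zero fun p hp => ?_
      rw [hx p.2 fun m hm hle => hd m hm (hle.trans ?_), mul_zero]
      rw [← Finset.HasAntidiagonal.mem_antidiagonal.mp hp]
      exact le_add_self
  · intro h
    obtain ⟨c, hc, -⟩ := exists_eq_sum_monomial_mul M f h
    rw [hc]
    exact Ideal.sum_mem _ fun m hm => Ideal.mul_mem_right _ _
      (Ideal.subset_span (Set.mem_image_of_mem _ hm))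

end MonomialIdeals

section Order

variable {σ : Type*} {A : Type*} [CommRing A]

theorem le_order_add {n : ℕ∞} {f g : MvPowerSeries σ A} (hf : n ≤ f.order) (hg : n ≤ g.order) :
    n ≤ (f + g).order :=
  (le_min hf hg).trans min_order_le_add

theorem le_order_sub {n : ℕ∞} {f g : MvPowerSeries σ A} (hf : n ≤ f.order) (hg : n ≤ g.order) :
    n ≤ (f - g).order := by
  rw [sub_eq_add_neg]
  exact le_order_add hf (by rwa [order_neg])

theorem le_order_mul_of_le {m n k : ℕ} {f g : MvPowerSeries σ A} (hf : (m : ℕ∞) ≤ f.order)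
    (hg : (n : ℕ∞) ≤ g.order) (h : k ≤ m + n) : (k : ℕ∞) ≤ (f * g).order :=
  le_trans (by exact_mod_cast h) ((add_le_add hf hg).trans le_order_mul)

theorem le_order_sum {ι : Type*} {n : ℕ∞} (s : Finset ι) (f : ι → MvPowerSeries σ A)
    (hf : ∀ i ∈ s, n ≤ (f i).order) : n ≤ (∑ i ∈ s, f i).order := by
  classical
  induction s using Finset.induction_on with
  | empty => simp
  | insert a s ha ih =>
    rw [Finset.sum_insert ha]
    exact le_order_add (hf a (by simp)) (ih fun i hi => hf i (by simp [hi]))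

theorem one_le_order_X (i : σ) : ((1 : ℕ) : ℕ∞) ≤ (X i : MvPowerSeries σ A).order := by
  rw [Nat.cast_one, one_le_order_iff_constCoeff_eq_zero]
  simp

theorem eq_of_forall_le_order_sub {f g : MvPowerSeries σ A}
    (h : ∀ n : ℕ, (n : ℕ∞) ≤ (f - g).order) : f = g := by
  rw [← sub_eq_zero, ← order_eq_top_iff]
  exact ENat.eq_top_iff_forall_ge.mpr h

theorem coeff_eq_of_le_order_sub {n : ℕ} {f g : MvPowerSeries σ A}
    (h : (n : ℕ∞) ≤ (f - g).order) {d : σ →₀ ℕ} (hd : d.degree < n) : coeff d f = coeff d g := by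
  rw [← sub_eq_zero, ← map_sub]
  exact coeff_of_lt_order (lt_of_lt_of_le (by exact_mod_cast hd) h)

/-- A map on tuples of power series of order at least `c` that improves agreement of two tuples by
one order has a fixed point. -/
theorem exists_fixedPoint_of_order_contracting {ι : Type*} (c : ℕ)
    (T : (ι → MvPowerSeries σ A) → (ι → MvPowerSeries σ A))
    (hc : ∀ z, (∀ i, (c : ℕ∞) ≤ (z i).order) → ∀ i, (c : ℕ∞) ≤ (T z i).order)
    (hT : ∀ n, c ≤ n → ∀ z z', (∀ i, (c : ℕ∞) ≤ (z i).order) → (∀ i, (c : ℕ∞) ≤ (z' i).order) →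
      (∀ i, (n : ℕ∞) ≤ (z i - z' i).order) → ∀ i, ((n + 1 : ℕ) : ℕ∞) ≤ (T z i - T z' i).order) :
    ∃ z, (∀ i, (c : ℕ∞) ≤ (z i).order) ∧ T z = z := by
  let z : ℕ → ι → MvPowerSeries σ A := fun n => T^[n] 0
  have hz : ∀ n, z (n + 1) = T (z n) := fun n => Function.iterate_succ_apply' T n 0
  have hzc : ∀ n i, (c : ℕ∞) ≤ (z n i).order := by
    intro n
    induction n with
    | zero => intro i; simp [z]
    | succ n ih => rw [hz]; exact hc _ ih
  have hstep : ∀ n i, ((c + n : ℕ) : ℕ∞) ≤ (z (n + 1) i - z n i).order := by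
    intro n
    induction n with
    | zero => exact fun i => le_order_sub (hzc _ i) (hzc _ i)
    | succ n ih =>
      intro i
      rw [hz (n + 1), hz n]
      exact hT (c + n) (by omega) _ _ (by rw [← hz]; exact hzc _) (hzc n)
        (by rw [← hz]; exact ih) i
  have hcauchy : ∀ n k i, ((c + n : ℕ) : ℕ∞) ≤ (z (n + k) i - z n i).order := by
    intro n k i
    induction k with
    | zero => simp
    | succ k ih =>
      have h2 := le_order_add ((Nat.cast_le.mpr (by omega)).trans (hstep (n + k) i)) ih
      rwa [sub_add_sub_cancel] at h2
  let l : ι → MvPowerSeries σ A := fun i d => coeff d (z (d.degree + 1) i)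
  have hl : ∀ (n : ℕ) i, (n : ℕ∞) ≤ (l i - z n i).order := by
    intro n i
    refine nat_le_order fun d hd => ?_
    obtain ⟨k, rfl⟩ : ∃ k, n = d.degree + 1 + k := ⟨n - (d.degree + 1), by omega⟩
    rw [map_sub, sub_eq_zero]
    exact (coeff_eq_of_le_order_sub (hcauchy (d.degree + 1) k i) (by omega)).symm
  have hlc : ∀ i, (c : ℕ∞) ≤ (l i).order := by
    intro i
    have := le_order_add (hl c i) (hzc c i)
    rwa [sub_add_cancel] at this
  refine ⟨l, hlc, funext fun i => eq_of_forall_le_order_sub fun n => ?_⟩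
  have h1 := hT (c + n) (by omega) l (z (c + n)) hlc (hzc _) (hl _) i
  rw [← hz] at h1
  have h2 := le_order_sub h1 (hl (c + n + 1) i)
  rw [sub_sub_sub_cancel_right] at h2
  exact (Nat.cast_le.mpr (by omega)).trans h2

end Order

/-! ### Automorphisms of the power series ring -/

section Automorphisms

variable {σ : Type*} {K : Type*} [Field K]

theorem exists_eq_sum_X_mul [Fintype σ] {n : ℕ} {f : MvPowerSeries σ K}
    (hf : ((n + 1 : ℕ) : ℕ∞) ≤ f.order) :
    ∃ c : σ → MvPowerSeries σ K, f = ∑ i, X i * c i ∧ ∀ i, (n : ℕ∞) ≤ (c i).order := by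
  classical
  obtain ⟨c, hc, hcoeff⟩ := exists_eq_sum_monomial_mul
    (Finset.univ.image fun i : σ => Finsupp.single i 1) f (by
      intro d hd
      have : d = 0 := by
        ext i
        by_contra h
        refine hd (Finsupp.single i 1) (by simp) ?_
        rw [Finsupp.single_le_iff]
        exact Nat.one_le_iff_ne_zero.mpr h
      subst this
      exact coeff_of_lt_order (lt_of_lt_of_le (by simp) hf))
  refine ⟨fun i => c (Finsupp.single i 1), ?_, fun i => nat_le_order fun d hd => ?_⟩
  · rw [Finset.sum_image (fun i _ j _ h => Finsupp.single_left_injective one_ne_zero h)] at hc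
    exact hc
  · rcases hcoeff (Finsupp.single i 1) d with h | h
    · rw [h]
      refine coeff_of_lt_order (lt_of_lt_of_le ?_ hf)
      rw [map_add, Finsupp.degree_single]
      exact_mod_cast Nat.add_lt_add_right hd 1
    · exact h

/-- A substitution that is the identity to first order raises the order of `Φ f - f` by one. No
continuity of `Φ` is assumed: the claim follows by induction on the order, writing `f` as
`∑ i, X i * c i` with series `c i` of order one less. -/
theorem le_order_algHom_sub_self [Finite σ] (Φ : MvPowerSeries σ K →ₐ[K] MvPowerSeries σ K)
    (hΦ : ∀ i, ((2 : ℕ) : ℕ∞) ≤ (Φ (X i) - X i).order) (n : ℕ) (f : MvPowerSeries σ K)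
    (hf : (n : ℕ∞) ≤ f.order) : ((n + 1 : ℕ) : ℕ∞) ≤ (Φ f - f).order := by
  have := Fintype.ofFinite σ
  have h1 : ∀ i, ((1 : ℕ) : ℕ∞) ≤ (Φ (X i)).order := fun i => by
    have := le_order_add ((Nat.cast_le.mpr one_le_two).trans (hΦ i)) (one_le_order_X (A := K) i)
    rwa [sub_add_cancel] at this
  induction n generalizing f with
  | zero =>
    have h0 : ((0 + 1 : ℕ) : ℕ∞) ≤ (f - C (constantCoeff f)).order := by
      rw [zero_add, Nat.cast_one, one_le_order_iff_constCoeff_eq_zero]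
      simp
    obtain ⟨c, hc, -⟩ := exists_eq_sum_X_mul h0
    have hΦC : Φ (C (constantCoeff f)) = C (constantCoeff f) := by
      rw [c_eq_algebraMap]; exact Φ.commutes _
    have : Φ f - f = Φ (f - C (constantCoeff f)) - (f - C (constantCoeff f)) := by
      rw [map_sub, hΦC]; ring
    rw [this]
    refine le_order_sub ?_ h0
    rw [hc, map_sum]
    refine le_order_sum _ _ fun i _ => ?_
    rw [map_mul]
    exact le_order_mul_of_le (n := 0) (h1 i) (by simp) le_rfl
  | succ n ih =>
    obtain ⟨c, hc, hcn⟩ := exists_eq_sum_X_mul hf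
    have : Φ f - f = ∑ i, ((Φ (X i) - X i) * Φ (c i) + X i * (Φ (c i) - c i)) := by
      rw [hc, map_sum, ← Finset.sum_sub_distrib]
      exact Finset.sum_congr rfl fun i _ => by rw [map_mul]; ring
    rw [this]
    refine le_order_sum _ _ fun i _ => le_order_add ?_ ?_
    · refine le_order_mul_of_le (hΦ i) (n := n) ?_ (by omega)
      have := le_order_add ((Nat.cast_le.mpr (Nat.le_succ n)).trans (ih _ (hcn i))) (hcn i)
      rwa [sub_add_cancel] at this
    · exact le_order_mul_of_le (one_le_order_X i) (ih _ (hcn i)) (by omega)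

/-- An endomorphism of the power series ring that is the identity modulo terms of order two is
bijective: it is a contraction away from the identity. -/
theorem bijective_of_two_le_order [Finite σ] (Φ : MvPowerSeries σ K →ₐ[K] MvPowerSeries σ K)
    (hΦ : ∀ i, ((2 : ℕ) : ℕ∞) ≤ (Φ (X i) - X i).order) : Function.Bijective Φ := by
  have key := le_order_algHom_sub_self Φ hΦ
  constructor
  · rw [injective_iff_map_eq_zero]
    intro f hf
    refine eq_of_forall_le_order_sub fun n => ?_
    rw [sub_zero]
    induction n with
    | zero => simp
    | succ n ih => simpa [hf] using key n f ih
  · intro g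
    obtain ⟨z, -, hz⟩ := exists_fixedPoint_of_order_contracting (ι := Unit) 0
      (fun z i => g - (Φ (z i) - z i)) (by simp) (by
        intro n _ z z' _ _ h i
        have := key n _ (h i)
        rw [← order_neg] at this
        have e : g - (Φ (z i) - z i) - (g - (Φ (z' i) - z' i)) =
            -(Φ (z i - z' i) - (z i - z' i)) := by rw [map_sub]; ring
        rwa [e])
    refine ⟨z (), ?_⟩
    have := congrFun hz ()
    linear_combination -this

/-- The linear substitution with matrix `B`. -/
def linearTuple [Fintype σ] (B : Matrix σ σ K) (i : σ) : MvPowerSeries σ K := ∑ j, C (B i j) * X j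

/-- The formal inverse function theorem, in the form of an existence statement for automorphisms. -/
theorem exists_algEquiv_of_linearPart [Fintype σ] [DecidableEq σ] (a : σ → MvPowerSeries σ K)
    (ha : ∀ i, constantCoeff (a i) = 0)
    (hdet : (Matrix.of fun i j => coeff (Finsupp.single j 1) (a i)).det ≠ 0) :
    ∃ φ : MvPowerSeries σ K ≃ₐ[K] MvPowerSeries σ K, ∀ i, φ (X i) = a i := by
  set A : Matrix σ σ K := Matrix.of fun i j => coeff (Finsupp.single j 1) (a i) with hA
  have hlin0 : ∀ (B : Matrix σ σ K) i, constantCoeff (linearTuple B i) = 0 := by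
    intro B i
    simp [linearTuple]
  have hs := hasSubst_of_constantCoeff_zero (S := K) ha
  have hl := fun B : Matrix σ σ K => hasSubst_of_constantCoeff_zero (S := K) (hlin0 B)
  let Λ : Matrix σ σ K → MvPowerSeries σ K →ₐ[K] MvPowerSeries σ K :=
    fun B => substAlgHom (hl B)
  have hΛX : ∀ B i, Λ B (X i) = linearTuple B i := fun B i => substAlgHom_X _ _
  have hΛC : ∀ B c, Λ B (C c) = C c := fun B c => by
    rw [c_eq_algebraMap]; exact (Λ B).commutes _
  have hΛlin : ∀ B D i, Λ B (linearTuple D i) = linearTuple (D * B) i := by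
    intro B D i
    simp only [linearTuple, map_sum, map_mul, hΛX, hΛC, Matrix.mul_apply, Finset.sum_mul,
      Finset.mul_sum]
    rw [Finset.sum_comm]
    simp [mul_assoc]
  have hone : ∀ i, linearTuple (1 : Matrix σ σ K) i = X i := by
    intro i
    simp [linearTuple, Matrix.one_apply]
  have hunit : IsUnit A.det := isUnit_iff_ne_zero.mpr hdet
  have hbij : ∀ B D : Matrix σ σ K, D * B = 1 →
      Function.Bijective ((Λ B).comp (Λ D)) := by
    intro B D h
    refine bijective_of_two_le_order _ fun i => ?_
    rw [AlgHom.comp_apply, hΛX, hΛlin, h, hone, sub_self]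
    simp
  have hΛ : Function.Bijective (Λ A⁻¹) := by
    have h1 := hbij A⁻¹ A (Matrix.mul_nonsing_inv A hunit)
    have h2 := hbij A A⁻¹ (Matrix.nonsing_inv_mul A hunit)
    rw [AlgHom.coe_comp] at h1 h2
    exact ⟨h2.1.of_comp, h1.2.of_comp⟩
  have hΦ : Function.Bijective ((Λ A⁻¹).comp (substAlgHom hs)) := by
    refine bijective_of_two_le_order _ fun i => ?_
    have hai : ((1 + 1 : ℕ) : ℕ∞) ≤ (a i - linearTuple A i).order := by
      refine nat_le_order fun d hd => ?_
      rw [map_sub, sub_eq_zero]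
      rcases Nat.lt_or_ge d.degree 1 with h0 | h1
      · obtain rfl : d = 0 := by rw [← Finsupp.degree_eq_zero_iff]; omega
        rw [coeff_zero_eq_constantCoeff_apply, coeff_zero_eq_constantCoeff_apply, ha, hlin0]
      · obtain ⟨j, rfl⟩ : ∃ j, d = Finsupp.single j 1 := by
          have hd1 : d ∈ {d : σ →₀ ℕ | d.degree = 1} := by
            rw [Set.mem_ofPred_eq]; omega
          rw [← Finsupp.range_single_one] at hd1
          exact hd1.imp fun _ h => h.symm
        simp [linearTuple, coeff_index_single_X, hA]
    have : ((Λ A⁻¹).comp (substAlgHom hs)) (X i) - X i = Λ A⁻¹ (a i - linearTuple A i) := by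
      rw [AlgHom.comp_apply, substAlgHom_X, map_sub, hΛlin, Matrix.mul_nonsing_inv A hunit, hone]
    rw [this]
    obtain ⟨c, hc, hc1⟩ := exists_eq_sum_X_mul hai
    rw [hc, map_sum]
    refine le_order_sum _ _ fun j _ => ?_
    rw [map_mul, hΛX]
    have hord : ∀ f : MvPowerSeries σ K, ((1 : ℕ) : ℕ∞) ≤ f.order →
        ((1 : ℕ) : ℕ∞) ≤ (Λ A⁻¹ f).order := by
      intro f hf
      obtain ⟨c, rfl, -⟩ := exists_eq_sum_X_mul (n := 0) hf
      rw [map_sum]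
      refine le_order_sum _ _ fun j _ => ?_
      rw [map_mul, hΛX]
      refine le_order_mul_of_le (m := 1) (n := 0) ?_ (by simp) le_rfl
      rw [Nat.cast_one, one_le_order_iff_constCoeff_eq_zero, hlin0]
    refine le_order_mul_of_le (m := 1) (n := 1) ?_ (hord _ (hc1 j)) le_rfl
    rw [Nat.cast_one, one_le_order_iff_constCoeff_eq_zero, hlin0]
  rw [AlgHom.coe_comp] at hΦ
  have : Function.Bijective (substAlgHom hs : MvPowerSeries σ K →ₐ[K] MvPowerSeries σ K) :=
    (Function.Bijective.of_comp_iff' hΛ _).mp hΦ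
  exact ⟨AlgEquiv.ofBijective _ this, fun i => substAlgHom_X hs i⟩

/-- Automorphisms of the power series ring preserve the maximal ideal. -/
theorem constantCoeff_algEquiv_X (φ : MvPowerSeries σ K ≃ₐ[K] MvPowerSeries σ K) (i : σ) :
    constantCoeff (φ (X i)) = 0 := by
  by_contra h
  have h1 : IsUnit (φ (X i)) := isUnit_iff_constantCoeff.mpr (isUnit_iff_ne_zero.mpr h)
  have h2 : IsUnit (X i : MvPowerSeries σ K) := by
    simpa using h1.map φ.symm
  rw [isUnit_iff_constantCoeff, constantCoeff_X] at h2
  exact not_isUnit_zero h2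

end Automorphisms

end TangentImage

end

noncomputable section

namespace TangentImage

open MvPolynomial

/-! ### Zariski tangent spaces of parametrized sets -/

section Dense

theorem eq_zero_of_eval_eq_zero_of_ne {ι F : Type*} [Field F] [Infinite F] {h P : MvPolynomial ι F}
    (hh : h ≠ 0) (H : ∀ x, eval x h ≠ 0 → eval x P = 0) : P = 0 := by
  have : P * h = 0 := by
    refine MvPolynomial.funext fun x => ?_
    rw [map_mul, map_zero]
    by_cases hx : eval x h = 0
    · rw [hx, mul_zero]
    · rw [H x hx, zero_mul]
  exact (mul_eq_zero.mp this).resolve_right hh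

theorem aeval_algebraMap_eq_eval_map {ι K K' : Type*} [Field K] [Field K'] [Algebra K K']
    (F : MvPolynomial ι K) (x : ι → K') :
    aeval x F = eval x (map (algebraMap K K') F) := by
  rw [eval_map]; rfl

/-- Polynomials whose values on a dense open set trace out points of `V` satisfy all equations
of `V`. -/
theorem aeval_eq_zero_of_mem_vanishingIdeal {ι κ K K' : Type*} [Field K] [Field K'] [Algebra K K']
    [Infinite K'] (o : κ → MvPolynomial ι K) (V : Set (κ → K')) (h : MvPolynomial ι K')
    (hh : h ≠ 0) (hV : ∀ y, eval y h ≠ 0 → (fun j => aeval y (o j)) ∈ V) {F : MvPolynomial κ K}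
    (hF : F ∈ vanishingIdeal K V) : aeval o F = 0 := by
  apply map_injective (algebraMap K K') (algebraMap K K').injective
  rw [map_zero]
  refine eq_zero_of_eval_eq_zero_of_ne hh fun y hy => ?_
  rw [← aeval_algebraMap_eq_eval_map]
  have h1 := mem_vanishingIdeal_iff.mp hF _ (hV y hy)
  rw [← h1]
  have : ((aeval y : MvPolynomial ι K →ₐ[K] K').comp (aeval o)) F =
      aeval (fun j => aeval y (o j)) F := by rw [comp_aeval]
  exact this

end Dense

section Differentials

variable {ι κ : Type*} {K : Type*} [Field K]

/-- The chain rule for derivations of polynomial expressions. -/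
theorem derivation_aeval [Fintype ι] {A M : Type*} [CommRing A] [Algebra K A] [AddCommGroup M]
    [Module A M] [Module K M] [IsScalarTower K A M] (D : Derivation K A M) (a : ι → A)
    (F : MvPolynomial ι K) : D (aeval a F) = ∑ i, aeval a (pderiv i F) • D (a i) := by
  classical
  induction F using MvPolynomial.induction_on with
  | C r => simp
  | add p q hp hq => simp [hp, hq, add_smul, Finset.sum_add_distrib]
  | mul_X p j hp =>
    rw [map_mul, aeval_X, D.leibniz, hp]
    simp only [pderiv_mul, map_add, map_mul, aeval_X, add_smul, Finset.sum_add_distrib]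
    rw [add_comm, Finset.smul_sum]
    congr 1
    · exact Finset.sum_congr rfl fun i _ => by rw [mul_comm, mul_smul]
    · rw [Finset.sum_eq_single j]
      · simp
      · intro i _ hij
        rw [pderiv_X_of_ne (Ne.symm hij)]
        simp
      · simp

theorem differential_apply [Fintype ι] (x w : ι → K) (F : MvPolynomial ι K) :
    differential x F w = ∑ i, eval x (pderiv i F) * w i := by
  simp [differential, LinearMap.sum_apply]

theorem tangentMap_apply [Fintype ι] (x w : ι → K) (o : κ → MvPolynomial ι K) (j : κ) :
    tangentMap x o w j = ∑ i, eval x (pderiv i (o j)) * w i := by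
  rw [tangentMap, LinearMap.pi_apply, differential_apply]

/-- The constant vector field with value `w`. -/
def constDerivation [Fintype ι] (w : ι → K) :
    Derivation K (MvPolynomial ι K) (MvPolynomial ι K) :=
  ∑ i, (C (w i) : MvPolynomial ι K) • pderiv i

theorem constDerivation_apply [Fintype ι] (w : ι → K) (F : MvPolynomial ι K) :
    constDerivation w F = ∑ i, C (w i) * pderiv i F := by
  rw [constDerivation, ← Derivation.coeFnAddMonoidHom_apply, map_sum, Finset.sum_apply]
  rfl

@[simp]
theorem constDerivation_X [Fintype ι] (w : ι → K) (i : ι) : constDerivation w (X i) = C (w i) := by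
  classical
  simp [constDerivation_apply, pderiv_X, Pi.single_apply]

theorem eval_constDerivation [Fintype ι] (x w : ι → K) (F : MvPolynomial ι K) :
    eval x (constDerivation w F) = differential x F w := by
  simp [constDerivation_apply, differential_apply, mul_comm]

variable {K' : Type*} [Field K'] [Algebra K K']

theorem mem_zariskiTangentSpace_iff [Fintype κ] {V : Set (κ → K')} {x v : κ → K} :
    v ∈ zariskiTangentSpace V x ↔ ∀ F ∈ vanishingIdeal K V, differential x F v = 0 := by
  simp [zariskiTangentSpace, Submodule.mem_iInf]

/-- The image of the tangent map of a parametrization is tangent. -/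
theorem range_tangentMap_le_zariskiTangentSpace [Fintype ι] [Fintype κ] [Infinite K']
    (o : κ → MvPolynomial ι K) (e : ι → K) (V : Set (κ → K')) (x : κ → K)
    (hx : ∀ j, eval e (o j) = x j) (h : MvPolynomial ι K') (hh : h ≠ 0)
    (hV : ∀ y, eval y h ≠ 0 → (fun j => aeval y (o j)) ∈ V) :
    LinearMap.range (tangentMap e o) ≤ zariskiTangentSpace V x := by
  rintro _ ⟨w, rfl⟩
  rw [mem_zariskiTangentSpace_iff]
  intro F hF
  have h0 := aeval_eq_zero_of_mem_vanishingIdeal o V h hh hV hF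
  have h1 := derivation_aeval (constDerivation w) o F
  rw [h0, map_zero] at h1
  have h2 := congrArg (eval e) h1
  rw [map_zero, map_sum] at h2
  rw [differential_apply, h2]
  refine Finset.sum_congr rfl fun j _ => ?_
  have h3 : eval e (aeval o (pderiv j F)) = eval x (pderiv j F) := by
    have h4 := eval₂_comp_left (eval e) C o (pderiv j F)
    rw [aeval_def, algebraMap_eq, h4]
    have : (eval e).comp C = RingHom.id K := by ext; simp
    rw [this]
    have : (eval e : MvPolynomial ι K → K) ∘ o = x := _root_.funext hx
    rw [this]
    rfl
  rw [smul_eq_mul, map_mul, h3, eval_constDerivation]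
  rfl

/-- A vector is tangent if the line through it meets the set in infinitely many points. -/
theorem mem_zariskiTangentSpace_of_infinite [Fintype κ] (V : Set (κ → K')) (x v : κ → K)
    (H : {t : K' | (fun j => algebraMap K K' (x j) + t * algebraMap K K' (v j)) ∈ V}.Infinite) :
    v ∈ zariskiTangentSpace V x := by
  rw [mem_zariskiTangentSpace_iff]
  intro F hF
  let a : κ → Polynomial K := fun j => Polynomial.C (x j) + Polynomial.X * Polynomial.C (v j)
  have hq : aeval a F = 0 := by
    refine (Polynomial.map_injective (algebraMap K K') (algebraMap K K').injective) ?_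
    rw [Polynomial.map_zero]
    refine Polynomial.eq_zero_of_infinite_isRoot _ (H.mono fun t ht => ?_)
    change Polynomial.IsRoot _ t
    rw [Polynomial.IsRoot.def, Polynomial.eval_map_algebraMap]
    have h1 := mem_vanishingIdeal_iff.mp hF _ ht
    have h2 : ((Polynomial.aeval t : Polynomial K →ₐ[K] K').comp (aeval a)) F =
      aeval (fun j => Polynomial.aeval t (a j)) F := by rw [comp_aeval]
    rw [AlgHom.comp_apply] at h2
    rw [h2, ← h1]
    congr 2
    ext j
    simp only [a, map_add, map_mul, Polynomial.aeval_C, Polynomial.aeval_X]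
  have h1 := derivation_aeval (Polynomial.derivative' (R := K)) a F
  rw [hq, map_zero] at h1
  have h2 := congrArg (Polynomial.eval 0) h1
  rw [Polynomial.eval_zero, Polynomial.eval_finsetSum] at h2
  rw [differential_apply, h2]
  refine Finset.sum_congr rfl fun j _ => ?_
  have h3 : Polynomial.eval 0 (aeval a (pderiv j F)) = eval x (pderiv j F) := by
    have h2 : ((Polynomial.aeval (0 : K)).comp (aeval a)) (pderiv j F) =
      aeval (fun j => Polynomial.aeval (0 : K) (a j)) (pderiv j F) := by rw [comp_aeval]
    rw [AlgHom.comp_apply, Polynomial.coe_aeval_eq_eval] at h2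
    rw [h2, ← coe_aeval_eq_eval x]
    change aeval _ _ = aeval _ _
    congr 2
    ext j
    simp [a]
  rw [smul_eq_mul, Polynomial.eval_mul, h3]
  simp [a]

end Differentials

/-! ### Separability and the Jacobian matrix -/

section FunctionFields

variable {ι : Type} {F : Type*} [Field F]

/-- The vector field with given components, as a derivation of the field of rational functions. It is
the second component of the substitution `X i ↦ X i + ε w i` into dual numbers, which is defined on
fractions because an element with nonzero first component is a unit. -/
theorem exists_derivation_fractionRing (w : ι → FractionRing (MvPolynomial ι F)) :
    ∃ D : Derivation F (FractionRing (MvPolynomial ι F)) (FractionRing (MvPolynomial ι F)),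
      ∀ i, D (algebraMap _ _ (X i : MvPolynomial ι F)) = w i := by
  let E := FractionRing (MvPolynomial ι F)
  let ψ : MvPolynomial ι F →ₐ[F] TrivSqZeroExt E E :=
    aeval fun i => TrivSqZeroExt.inl (algebraMap (MvPolynomial ι F) E (X i)) +
      TrivSqZeroExt.inr (w i)
  have hfst : ∀ p, (ψ p).fst = algebraMap (MvPolynomial ι F) E p := by
    intro p
    have : (TrivSqZeroExt.fstHom F E E).comp ψ = IsScalarTower.toAlgHom F (MvPolynomial ι F) E := by
      ext i
      simp [ψ]
    exact DFunLike.congr_fun this p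
  have hunit : ∀ y : nonZeroDivisors (MvPolynomial ι F), IsUnit (ψ y) := by
    intro y
    rw [TrivSqZeroExt.isUnit_iff_isUnit_fst, hfst]
    exact IsLocalization.map_units E y
  let Φ : E →ₐ[F] TrivSqZeroExt E E := IsLocalization.liftAlgHom (f := ψ) hunit
  have hΦ : ∀ p, Φ (algebraMap _ E p) = ψ p := fun p => IsLocalization.lift_eq hunit p
  have hΦfst : ∀ e, (Φ e).fst = e := by
    intro e
    have : ((TrivSqZeroExt.fstHom F E E).comp Φ : E →+* E) = RingHom.id E := by
      refine IsLocalization.ringHom_ext (nonZeroDivisors (MvPolynomial ι F)) ?_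
      ext p
      · change (Φ (algebraMap (MvPolynomial ι F) E _)).fst = _
        rw [hΦ, hfst]
        rfl
      · change (Φ (algebraMap (MvPolynomial ι F) E _)).fst = _
        rw [hΦ, hfst]
        rfl
    exact DFunLike.congr_fun this e
  refine ⟨Derivation.mk' ((TrivSqZeroExt.sndHom E E).restrictScalars F ∘ₗ Φ.toLinearMap) ?_, ?_⟩
  · intro a b
    simp [hΦfst, mul_comm]
  · intro i
    change (Φ (algebraMap (MvPolynomial ι F) E _)).snd = _
    rw [hΦ]
    simp [ψ]

theorem aeval_algebraMap_X (p : MvPolynomial ι F) :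
    aeval (fun i => algebraMap _ (FractionRing (MvPolynomial ι F)) (X i : MvPolynomial ι F)) p =
      algebraMap _ _ p :=
  (DFunLike.congr_fun (aeval_unique (IsScalarTower.toAlgHom F (MvPolynomial ι F)
    (FractionRing (MvPolynomial ι F)))) p).symm

theorem derivation_algebraMap [Fintype ι] {M : Type*} [AddCommGroup M]
    [Module (FractionRing (MvPolynomial ι F)) M] [Module F M]
    [IsScalarTower F (FractionRing (MvPolynomial ι F)) M]
    (D : Derivation F (FractionRing (MvPolynomial ι F)) M) (p : MvPolynomial ι F) :
    D (algebraMap _ _ p) = ∑ i, algebraMap _ (FractionRing (MvPolynomial ι F)) (pderiv i p) •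
      D (algebraMap _ _ (X i : MvPolynomial ι F)) := by
  have := derivation_aeval D
      (fun i => algebraMap _ (FractionRing (MvPolynomial ι F)) (X i : MvPolynomial ι F)) p
  simp only [aeval_algebraMap_X] at this
  exact this

theorem derivation_eq_zero_of_X [Fintype ι] {M : Type*} [AddCommGroup M]
    [Module (FractionRing (MvPolynomial ι F)) M] [Module F M]
    [IsScalarTower F (FractionRing (MvPolynomial ι F)) M]
    (D : Derivation F (FractionRing (MvPolynomial ι F)) M)
    (h : ∀ i, D (algebraMap _ _ (X i : MvPolynomial ι F)) = 0) : D = 0 := by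
  have h1 : ∀ p : MvPolynomial ι F, D (algebraMap _ _ p) = 0 := by
    intro p
    rw [derivation_algebraMap D p]
    simp [h]
  ext e
  obtain ⟨a, b, hb, rfl⟩ := IsFractionRing.div_surjective (A := MvPolynomial ι F) e
  have hb0 : algebraMap (MvPolynomial ι F) (FractionRing (MvPolynomial ι F)) b ≠ 0 :=
    IsFractionRing.to_map_ne_zero_of_mem_nonZeroDivisors hb
  have h2 := D.leibniz (algebraMap (MvPolynomial ι F) (FractionRing (MvPolynomial ι F)) a /
    algebraMap _ _ b) (algebraMap _ _ b)
  rw [div_mul_cancel₀ _ hb0, h1, h1, smul_zero, zero_add] at h2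
  simpa using (smul_eq_zero.mp h2.symm).resolve_left hb0

end FunctionFields

end TangentImage

end

noncomputable section

namespace TangentImage

open MvPolynomial

section Separability

variable {ι : Type} [Fintype ι] {F : Type*} [Field F]

theorem trdeg_fractionRing :
    Algebra.trdeg F (FractionRing (MvPolynomial ι F)) = Fintype.card ι := by
  have : Algebra.IsAlgebraic (MvPolynomial ι F) (FractionRing (MvPolynomial ι F)) :=
    IsLocalization.isAlgebraic _ (nonZeroDivisors (MvPolynomial ι F))
  have h := (IsTranscendenceBasis.mvPolynomial ι F).algebraMap_comp
    (A := FractionRing (MvPolynomial ι F))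
  rw [← Cardinal.lift_inj.{_, 0}, ← h.lift_cardinalMk_eq_trdeg]
  simp

/-- The extension of a vector field on affine space to the field of rational functions. -/
def derivationEquiv : Derivation F (FractionRing (MvPolynomial ι F))
      (FractionRing (MvPolynomial ι F)) ≃ₗ[FractionRing (MvPolynomial ι F)]
    (ι → FractionRing (MvPolynomial ι F)) :=
  LinearEquiv.ofBijective
    { toFun := fun D i => D (algebraMap _ _ (X i : MvPolynomial ι F))
      map_add' := fun _ _ => rfl
      map_smul' := fun _ _ => rfl }
    ⟨(injective_iff_map_eq_zero _).mpr fun D hD =>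
        derivation_eq_zero_of_X D fun i => congrFun hD i,
      fun w => (exists_derivation_fractionRing w).imp fun _ h => funext h⟩

theorem derivationEquiv_apply (D : Derivation F (FractionRing (MvPolynomial ι F))
      (FractionRing (MvPolynomial ι F))) (i : ι) :
    derivationEquiv D i = D (algebraMap _ _ (X i : MvPolynomial ι F)) := rfl

theorem derivation_eq_zero_of_isSeparable {k E : Type*} [Field k] [Field E] [Algebra k E]
    (L : IntermediateField k E) [Algebra.IsSeparable L E] (D : Derivation k E E)
    (h : ∀ x ∈ L, D x = 0) : D = 0 := by
  have : Algebra.FormallyUnramified L E := Algebra.FormallyUnramified.of_isSeparable L E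
  let D' : Derivation L E E :=
    { toFun := D
      map_add' := map_add D
      map_smul' := fun x y => by
        rw [Algebra.smul_def, D.leibniz]
        have : D (algebraMap L E x) = 0 := h x x.2
        rw [this, smul_zero, add_zero, RingHom.id_apply]
        rfl
      map_one_eq_zero' := D.map_one_eq_zero
      leibniz' := D.leibniz }
  ext x
  have h1 : D' = D'.liftKaehlerDifferential.compDer (KaehlerDifferential.D L E) := by
    ext; simp
  change D' x = 0
  rw [h1]
  change D'.liftKaehlerDifferential (KaehlerDifferential.D L E x) = 0
  rw [Subsingleton.elim (KaehlerDifferential.D L E x) 0, map_zero]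

/-- A finitely generated field extension without derivations is separable algebraic. -/
theorem isSeparable_of_derivation_eq_zero {k E : Type*} [Field k] [Field E] [Algebra k E]
    [Algebra.EssFiniteType k E] (N : IntermediateField k E)
    (h : ∀ D : Derivation k E E, (∀ x ∈ N, D x = 0) → D = 0) : Algebra.IsSeparable N E := by
  have : Algebra.EssFiniteType N E := Algebra.EssFiniteType.of_comp k N E
  rw [← Algebra.FormallyUnramified.iff_isSeparable]
  refine ⟨subsingleton_of_forall_eq 0 fun m => ?_⟩
  rw [← Module.forall_dual_apply_eq_zero_iff E]
  intro f
  have hD : (f.compDer (KaehlerDifferential.D N E)) = 0 := by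
    have h1 := h ((f.compDer (KaehlerDifferential.D N E)).restrictScalars k) fun x hx =>
      (f.compDer (KaehlerDifferential.D N E)).map_algebraMap ⟨x, hx⟩
    ext x
    exact DFunLike.congr_fun h1 x
  have hf : f = 0 := by
    refine (KaehlerDifferential.linearMapEquivDerivation N E).injective ?_
    rw [map_zero]
    exact hD
  rw [hf, LinearMap.zero_apply]

theorem derivation_eq_zero_of_mem_adjoin {k E : Type*} [Field k] [Field E] [Algebra k E]
    {M : Type*} [AddCommGroup M] [Module E M] [Module k M] [IsScalarTower k E M]
    (D : Derivation k E M) (s : Set E) (h : ∀ x ∈ s, D x = 0) :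
    ∀ x ∈ IntermediateField.adjoin k s, D x = 0 := by
  intro x hx
  induction hx using IntermediateField.adjoin_induction with
  | mem x hx => exact h x hx
  | algebraMap x => exact D.map_algebraMap x
  | add x y _ _ hx hy => rw [map_add, hx, hy, add_zero]
  | inv x _ hx =>
    by_cases h0 : x = 0
    · rw [h0, inv_zero, map_zero]
    · have h2 := D.leibniz x x⁻¹
      rw [mul_inv_cancel₀ h0, D.map_one_eq_zero, hx, smul_zero, add_zero] at h2
      exact (smul_eq_zero.mp h2.symm).resolve_left h0
  | mul x y _ _ hx hy => rw [D.leibniz, hx, hy, smul_zero, smul_zero, add_zero]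

variable {κ K K' : Type*} [Field K] [Field K'] [Algebra K K']

/-- For a separable map, the transcendence degree of the function field of the image is at most
the generic rank of the Jacobian matrix. -/
theorem IsSeparableMap.card_add_finrank_le {o : κ → MvPolynomial ι K} (h : IsSeparableMap K' o)
    {J : Type} [Fintype J] (j : J → κ)
    (hj : AlgebraicIndependent K' fun i => map (algebraMap K K') (o (j i)))
    (W : Submodule (FractionRing (MvPolynomial ι K')) (ι → FractionRing (MvPolynomial ι K')))
    (hW : ∀ w ∈ W, ∀ j, ∑ i, algebraMap _ (FractionRing (MvPolynomial ι K'))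
      (pderiv i (map (algebraMap K K') (o j))) * w i = 0) :
    Fintype.card J + Module.finrank (FractionRing (MvPolynomial ι K')) W ≤ Fintype.card ι := by
  let E := FractionRing (MvPolynomial ι K')
  obtain ⟨S, hS, hsep⟩ := h
  set oE : κ → E := fun j => algebraMap (MvPolynomial ι K') E (map (algebraMap K K') (o j))
  set L : IntermediateField K' E := IntermediateField.adjoin K' (Set.range oE) with hL
  have htr : Algebra.trdeg K' L + Algebra.trdeg L E = Fintype.card ι := by
    rw [trdeg_add_eq, trdeg_fractionRing]
  have hcardS : Algebra.trdeg L E = Cardinal.mk S := hS.cardinalMk_eq_trdeg.symm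
  have hSfin : Finite S := by
    rw [← Cardinal.lt_aleph0_iff_finite, ← hcardS]
    exact lt_of_le_of_lt (htr ▸ self_le_add_left _ _) (Cardinal.natCast_lt_aleph0)
  have := Fintype.ofFinite S
  -- the transcendence degree of `L`
  have hJ : (Fintype.card J : Cardinal) ≤ Algebra.trdeg K' L := by
    have h1 : AlgebraicIndependent K' fun i : J =>
        (⟨oE (j i), IntermediateField.subset_adjoin _ _ ⟨_, rfl⟩⟩ : L) := by
      refine AlgebraicIndependent.of_comp L.val ?_
      exact hj.map' (f := IsScalarTower.toAlgHom K' (MvPolynomial ι K') E)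
        (IsFractionRing.injective _ _)
    have := h1.lift_cardinalMk_le_trdeg
    simpa using this
  -- vector fields in `W` are determined by their values on `S`
  have hWS : Module.finrank E W ≤ Fintype.card S := by
    let ev : W →ₗ[E] (S → E) :=
      { toFun := fun w s => (derivationEquiv (ι := ι) (F := K')).symm w.1 s.1
        map_add' := fun v w => by ext; simp
        map_smul' := fun c w => by ext; simp }
    have hev : Function.Injective ev := by
      rw [injective_iff_map_eq_zero]
      intro w hw
      set D := (derivationEquiv (ι := ι) (F := K')).symm w.1 with hD
      have hDX : ∀ i, D (algebraMap _ _ (X i : MvPolynomial ι K')) = w.1 i := by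
        intro i
        rw [← derivationEquiv_apply, hD, LinearEquiv.apply_symm_apply]
      have hDL : ∀ x ∈ L, D x = 0 := by
        refine derivation_eq_zero_of_mem_adjoin D _ ?_
        rintro _ ⟨j, rfl⟩
        rw [derivation_algebraMap]
        simp only [hDX]
        exact hW w.1 w.2 j
      let M := (IntermediateField.adjoin L S).restrictScalars K'
      have : Algebra.IsSeparable M E := hsep
      have hDM : ∀ x ∈ M, D x = 0 := by
        intro x hx
        have hx' : x ∈ (IntermediateField.adjoin L S).restrictScalars K' := hx
        rw [hL, IntermediateField.adjoin_adjoin_left] at hx'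
        refine derivation_eq_zero_of_mem_adjoin D _ ?_ x hx'
        rintro y (hy | hy)
        · exact hDL y (IntermediateField.subset_adjoin _ _ hy)
        · exact congrFun hw ⟨y, hy⟩
      have hD0 := derivation_eq_zero_of_isSeparable M D hDM
      ext i
      rw [← hDX, hD0]
      rfl
    simpa using LinearMap.finrank_le_finrank_of_injective hev
  have h2 : ((Fintype.card J + Fintype.card S : ℕ) : Cardinal) ≤ Fintype.card ι := by
    rw [← htr, hcardS]
    push_cast
    rw [Cardinal.mk_fintype S]
    gcongr
  have h3 : Fintype.card J + Fintype.card S ≤ Fintype.card ι := by exact_mod_cast h2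
  have h4 : Module.finrank (FractionRing (MvPolynomial ι K')) W ≤ Fintype.card S := hWS
  omega

theorem exists_submatrix_det_ne_zero {J : Type} [Fintype J] [DecidableEq J] (M : Matrix J ι K)
    (hM : Function.Surjective M.mulVec) :
    ∃ a : J → ι, Function.Injective a ∧ (M.submatrix id a).det ≠ 0 := by
  obtain ⟨T, a, ha, hspan, hli⟩ := exists_linearIndependent' K fun i => M.col i
  have htop : Submodule.span K (Set.range fun i => M.col i) = ⊤ := by
    rw [eq_top_iff]
    intro c _
    obtain ⟨w, rfl⟩ := hM c
    rw [Matrix.mulVec_eq_sum]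
    refine Submodule.sum_mem _ fun i _ => ?_
    rw [op_smul_eq_smul]
    exact Submodule.smul_mem _ _ (Submodule.subset_span ⟨i, rfl⟩)
  rw [htop] at hspan
  let b := Module.Basis.mk hli hspan.ge
  have : Fintype T := Fintype.ofInjective a ha
  have hcard : Fintype.card J = Fintype.card T := by
    rw [← Module.finrank_eq_card_basis b, Module.finrank_fintype_fun_eq_card]
  let eq := Fintype.equivOfCardEq hcard
  refine ⟨a ∘ eq, ha.comp eq.injective, ?_⟩
  have h1 : LinearIndependent K (fun i => ((M.submatrix id (a ∘ eq))).col i) :=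
    hli.comp eq eq.injective
  rw [Matrix.linearIndependent_cols_iff_isUnit] at h1
  exact ((Matrix.isUnit_iff_isUnit_det _).mp h1).ne_zero

theorem eq_zero_of_sum_smul_eq_zero {E M J : Type*} [Field E] [AddCommGroup M] [Module E M]
    [Fintype J] [DecidableEq J] (B : Matrix J J E) (hB : B.det ≠ 0) (m : J → M)
    (h : ∀ j, ∑ t, B j t • m t = 0) : m = 0 := by
  ext s
  have h1 : ∑ j, B⁻¹ s j • ∑ t, B j t • m t = 0 := by simp [h]
  simp only [Finset.smul_sum, smul_smul] at h1
  rw [Finset.sum_comm] at h1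
  simp only [← Finset.sum_smul, ← Matrix.mul_apply] at h1
  rw [Matrix.nonsing_inv_mul _ (isUnit_iff_ne_zero.mpr hB)] at h1
  simpa [Matrix.one_apply] using h1

/-- If the tangent map at some point is onto the coordinates of a family of components that
generates the function field of the image, the map is separable. -/
theorem isSeparableMap_of_surjective (o : κ → MvPolynomial ι K) (e : ι → K) {J : Type} [Fintype J]
    (j : J → κ) (hsurj : ∀ c : J → K, ∃ w, ∀ i, tangentMap e o w (j i) = c i)
    (hgen : ∀ i, algebraMap _ (FractionRing (MvPolynomial ι K')) (map (algebraMap K K') (o i)) ∈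
      IntermediateField.adjoin K' (Set.range fun i => algebraMap _
        (FractionRing (MvPolynomial ι K')) (map (algebraMap K K') (o (j i))))) :
    IsSeparableMap K' o := by
  classical
  let E := FractionRing (MvPolynomial ι K')
  let oJ : J → E := fun i => algebraMap (MvPolynomial ι K') E (map (algebraMap K K') (o (j i)))
  have hL : IntermediateField.adjoin K' (Set.range fun i => algebraMap (MvPolynomial ι K') E
      (map (algebraMap K K') (o i))) = IntermediateField.adjoin K' (Set.range oJ) := by
    apply le_antisymm
    · rw [IntermediateField.adjoin_le_iff]
      rintro _ ⟨i, rfl⟩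
      exact hgen i
    · refine IntermediateField.adjoin.mono _ _ _ ?_
      rintro _ ⟨i, rfl⟩
      exact ⟨j i, rfl⟩
  change ∃ S : Set E, IsTranscendenceBasis (IntermediateField.adjoin K' (Set.range fun i =>
    algebraMap (MvPolynomial ι K') E (map (algebraMap K K') (o i)))) ((↑) : S → E) ∧
      Algebra.IsSeparable (IntermediateField.adjoin (IntermediateField.adjoin K'
        (Set.range fun i => algebraMap (MvPolynomial ι K') E (map (algebraMap K K') (o i)))) S) E
  rw [hL]
  set L := IntermediateField.adjoin K' (Set.range oJ) with hLdef
  -- a nonvanishing maximal minor at `e`, hence generically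
  let M : Matrix J ι K := Matrix.of fun i t => eval e (pderiv t (o (j i)))
  obtain ⟨a, ha, hdet⟩ := exists_submatrix_det_ne_zero M (fun c => by
    obtain ⟨w, hw⟩ := hsurj c
    refine ⟨w, funext fun i => ?_⟩
    rw [← hw, tangentMap_apply]
    rfl)
  let ME : Matrix J J E := Matrix.of fun i t =>
    algebraMap (MvPolynomial ι K') E (pderiv (a t) (map (algebraMap K K') (o (j i))))
  have hME : ME.det ≠ 0 := by
    let MP : Matrix J J (MvPolynomial ι K) := Matrix.of fun i t => pderiv (a t) (o (j i))
    have h1 : eval e MP.det ≠ 0 := by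
      rw [RingHom.map_det]
      exact hdet
    have h2 : MP.det ≠ 0 := fun h => h1 (by rw [h, map_zero])
    have h3 : ME = (((algebraMap (MvPolynomial ι K') E).comp (map (algebraMap K K'))).mapMatrix
        MP) := by
      ext i t
      simp [ME, MP, pderiv_map]
    rw [h3, ← RingHom.map_det]
    rw [← map_zero ((algebraMap (MvPolynomial ι K') E).comp (map (algebraMap K K')))]
    refine fun h => h2 ?_
    exact ((IsFractionRing.injective (MvPolynomial ι K') E).comp
      (map_injective _ (algebraMap K K').injective)) h
  let xS : {t // t ∉ Set.range a} → E := fun t => algebraMap (MvPolynomial ι K') E (X t.1)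
  refine ⟨Set.range xS, ?_⟩
  have hmem : ∀ t, xS t ∈ IntermediateField.adjoin L (Set.range xS) := fun t =>
    IntermediateField.subset_adjoin L (Set.range xS) (Set.mem_range_self t)
  have hmemL : ∀ i, oJ i ∈ L := fun i =>
    IntermediateField.subset_adjoin K' (Set.range oJ) (Set.mem_range_self i)
  have hsep : Algebra.IsSeparable (IntermediateField.adjoin L (Set.range xS)) E := by
    have hess : Algebra.EssFiniteType K' E := Algebra.EssFiniteType.comp K' (MvPolynomial ι K') E
    refine isSeparable_of_derivation_eq_zero
      ((IntermediateField.adjoin L (Set.range xS)).restrictScalars K') fun D hDN' => ?_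
    have hDN : ∀ x ∈ IntermediateField.adjoin L (Set.range xS), D x = 0 := hDN'
    have hDS : ∀ t, t ∉ Set.range a → D (algebraMap (MvPolynomial ι K') E (X t)) = 0 :=
      fun t ht => hDN (xS ⟨t, ht⟩) (hmem ⟨t, ht⟩)
    have hDT : (fun t => D (algebraMap (MvPolynomial ι K') E (X (a t)))) = 0 := by
      refine eq_zero_of_sum_smul_eq_zero ME hME _ fun i => ?_
      have h1 : D (oJ i) = 0 := hDN (oJ i)
        ((IntermediateField.adjoin L (Set.range xS)).algebraMap_mem ⟨oJ i, hmemL i⟩)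
      rw [derivation_algebraMap] at h1
      rw [← h1]
      refine Finset.sum_of_injOn a ha.injOn (by simp) ?_ fun t _ => rfl
      intro t _ ht
      rw [hDS t (by simpa using ht), smul_zero]
    refine derivation_eq_zero_of_X D fun t => ?_
    by_cases ht : t ∈ Set.range a
    · obtain ⟨s, rfl⟩ := ht
      exact congrFun hDT s
    · exact hDS t ht
  refine ⟨?_, hsep⟩
  -- `E` is algebraic over the field generated by `#ι` elements
  have halg : Algebra.IsAlgebraic (Algebra.adjoin K' (Set.range (Sum.elim xS oJ))) E := by
    rw [← IntermediateField.isAlgebraic_adjoin_iff_top]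
    have h1 : (IntermediateField.adjoin L (Set.range xS)).restrictScalars K' =
        IntermediateField.adjoin K' (Set.range (Sum.elim xS oJ)) := by
      rw [hLdef, IntermediateField.adjoin_adjoin_left, Set.Sum.elim_range, Set.union_comm]
    rw [← h1]
    exact hsep.isAlgebraic
  have hcard : Fintype.card {t // t ∉ Set.range a} + Fintype.card J = Fintype.card ι := by
    rw [Fintype.card_subtype_compl, ← Set.card_range_of_injective ha]
    exact Nat.sub_add_cancel (Fintype.card_subtype_le _)
  have htb : IsTranscendenceBasis K' (Sum.elim xS oJ) := by
    refine Algebra.IsAlgebraic.isTranscendenceBasis_of_lift_le_trdeg_of_finite K' _ ?_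
    rw [trdeg_fractionRing, ← hcard]
    simp
  have hind := (AlgebraicIndependent.sumElim_iff.mp htb.1).2
  rw [← IntermediateField.algebraicIndependent_adjoin_iff] at hind
  have : IsTranscendenceBasis L xS := by
    rw [hind.isTranscendenceBasis_iff_isAlgebraic, ← IntermediateField.isAlgebraic_adjoin_iff_top]
    exact hsep.isAlgebraic
  exact this.to_subtype_range

end Separability

end TangentImage

end

noncomputable section

namespace TangentImage

open MvPolynomial

/-! ### Dimensions of parametrized sets -/

section Dimension

variable {ι κ : Type*} {F : Type*} [Field F]

/-- The vectors whose coordinates in `B` vanish. -/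
def coordinateSubmodule (F : Type*) [Field F] (B : Set ι) : Submodule F (ι → F) :=
  ⨅ i ∈ B, LinearMap.ker (LinearMap.proj i : (ι → F) →ₗ[F] F)

theorem mem_coordinateSubmodule {B : Set ι} {w : ι → F} :
    w ∈ coordinateSubmodule F B ↔ ∀ i ∈ B, w i = 0 := by
  simp [coordinateSubmodule, Submodule.mem_iInf]

theorem finrank_coordinateSubmodule [Finite ι] (B : Set ι) :
    Module.finrank F (coordinateSubmodule F B) = Nat.card {i // i ∉ B} := by
  classical
  have := Fintype.ofFinite ι
  let e := LinearMap.iInfKerProjEquiv F (fun _ : ι => F) (I := Bᶜ) (J := B)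
    disjoint_compl_left (by simp)
  rw [coordinateSubmodule, LinearEquiv.finrank_eq e, Module.finrank_fintype_fun_eq_card,
    ← Nat.card_eq_fintype_card]
  rfl

/-- Polynomials that take all values outside a hypersurface are algebraically independent. -/
theorem algebraicIndependent_of_dominant [Infinite F] {J : Type*} (o : J → MvPolynomial ι F)
    (h : MvPolynomial J F) (hh : h ≠ 0)
    (H : ∀ c, eval c h ≠ 0 → ∃ x, ∀ j, eval x (o j) = c j) : AlgebraicIndependent F o := by
  rw [algebraicIndependent_iff]
  intro P hP
  refine eq_zero_of_eval_eq_zero_of_ne hh fun c hc => ?_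
  obtain ⟨x, hx⟩ := H c hc
  have h1 := congrArg (aeval x : MvPolynomial ι F →ₐ[F] F) hP
  rw [map_zero, ← AlgHom.comp_apply, comp_aeval] at h1
  rw [← h1, ← coe_aeval_eq_eval]
  change aeval c P = _
  congr 2
  ext j
  rw [← hx j, ← coe_aeval_eq_eval]
  rfl

theorem ringKrullDim_mvPolynomial_field [Finite ι] :
    ringKrullDim (MvPolynomial ι F) = Nat.card ι := by
  rw [MvPolynomial.ringKrullDim_of_isNoetherianRing, ringKrullDim_eq_zero_of_field, zero_add]

/-- The closure of the image of a dominant family, padded by zeros, is an affine space. -/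
theorem zariskiDim_eq_card [Infinite F] (o : κ → MvPolynomial ι F) (V : Set (κ → F))
    (h : MvPolynomial ι F) (hh : h ≠ 0)
    (hV : ∀ y, eval y h ≠ 0 → (fun j => eval y (o j)) ∈ V)
    (hV' : ∀ v ∈ V, ∃ y, v = fun j => eval y (o j))
    {J : Type*} [Finite J] (j : J → κ) (hj : AlgebraicIndependent F (o ∘ j))
    (h0 : ∀ i, i ∉ Set.range j → o i = 0) : zariskiDim V = Nat.card J := by
  have hI : vanishingIdeal F V = RingHom.ker (aeval o : MvPolynomial κ F →ₐ[F] _) := by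
    ext P
    rw [RingHom.mem_ker]
    refine ⟨fun hP => aeval_eq_zero_of_mem_vanishingIdeal o V h hh hV hP, fun hP => ?_⟩
    rw [mem_vanishingIdeal_iff]
    intro v hv
    obtain ⟨y, rfl⟩ := hV' v hv
    have h1 := congrArg (aeval y : MvPolynomial ι F →ₐ[F] F) hP
    rw [map_zero, ← AlgHom.comp_apply, comp_aeval] at h1
    exact h1
  have hrange : (aeval o : MvPolynomial κ F →ₐ[F] _).range =
      (aeval (o ∘ j) : MvPolynomial J F →ₐ[F] _).range := by
    rw [← Algebra.adjoin_range_eq_range_aeval, ← Algebra.adjoin_range_eq_range_aeval]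
    apply le_antisymm
    · rw [Algebra.adjoin_le_iff]
      rintro _ ⟨i, rfl⟩
      by_cases hi : i ∈ Set.range j
      · obtain ⟨i, rfl⟩ := hi
        exact Algebra.subset_adjoin ⟨i, rfl⟩
      · rw [h0 i hi]
        exact zero_mem _
    · refine Algebra.adjoin_mono ?_
      rintro _ ⟨i, rfl⟩
      exact ⟨j i, rfl⟩
  rw [zariskiDim, hI, ← ringKrullDim_mvPolynomial_field (F := F)]
  have e1 : (MvPolynomial κ F ⧸ RingHom.ker (aeval o : MvPolynomial κ F →ₐ[F] _)) ≃ₐ[F]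
      (aeval o : MvPolynomial κ F →ₐ[F] _).range := Ideal.quotientKerEquivRange _
  have e2 : MvPolynomial J F ≃ₐ[F] (aeval (o ∘ j) : MvPolynomial J F →ₐ[F] _).range :=
    AlgEquiv.ofInjective _ hj
  exact ringKrullDim_eq_of_ringEquiv
    ((e1.trans (Subalgebra.equivOfEq _ _ hrange)).trans e2.symm).toRingEquiv

theorem isPrincipalIdealRing_laurentPolynomial : IsPrincipalIdealRing (LaurentPolynomial F) := by
  refine ⟨fun I => ?_⟩
  rw [← IsLocalization.map_under (Submonoid.powers (Polynomial.X : Polynomial F)) _ I]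
  obtain ⟨g, hg⟩ := (IsPrincipalIdealRing.principal (I.under (Polynomial F)))
  rw [hg]
  refine ⟨algebraMap _ _ g, ?_⟩
  simp [Ideal.submodule_span_eq, Ideal.map_span]

theorem ringKrullDim_laurentPolynomial : ringKrullDim (LaurentPolynomial F) = 1 := by
  have := isPrincipalIdealRing_laurentPolynomial (F := F)
  refine IsPrincipalIdealRing.ringKrullDim_eq_one _ fun h => ?_
  -- `1 + T` has a zero on the punctured line
  have h0 : (1 + LaurentPolynomial.T 1 : LaurentPolynomial F) ≠ 0 := by
    have h1 : (1 + LaurentPolynomial.T 1 : LaurentPolynomial F) =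
        Polynomial.toLaurent (Polynomial.X + Polynomial.C 1) := by
      simp [add_comm]
    rw [h1, Ne, Polynomial.toLaurent_eq_zero]
    exact Polynomial.X_add_C_ne_zero 1
  obtain ⟨b, hb⟩ := h.mul_inv_cancel h0
  have h2 := congrArg (LaurentPolynomial.eval₂ (RingHom.id F) (-1)) hb
  simp at h2

/-- Evaluation of a polynomial over the Laurent polynomials at a point of the product of the
punctured line and an affine space. -/
def evalLaurent (t : Fˣ) (z : ι → F) : MvPolynomial ι (LaurentPolynomial F) →+* F :=
  eval₂Hom (LaurentPolynomial.eval₂ (RingHom.id F) t) z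

theorem eq_zero_of_evalLaurent_eq_zero [Infinite F] (P : MvPolynomial ι (LaurentPolynomial F))
    (hP : ∀ t z, evalLaurent t z P = 0) : P = 0 := by
  refine MvPolynomial.ext _ _ fun m => ?_
  rw [coeff_zero]
  have h1 : ∀ t : Fˣ, LaurentPolynomial.eval₂ (RingHom.id F) t (coeff m P) = 0 := by
    intro t
    have h2 : map (LaurentPolynomial.eval₂ (RingHom.id F) t) P = 0 := by
      refine MvPolynomial.funext fun z => ?_
      rw [eval_map, map_zero]
      exact hP t z
    rw [← coeff_map, h2, coeff_zero]
  obtain ⟨n, q, hq⟩ := LaurentPolynomial.exists_T_pow (coeff m P)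
  have hq0 : q = 0 := by
    have h3 : q * Polynomial.X = 0 := by
      refine Polynomial.funext fun t => ?_
      by_cases ht : t = 0
      · simp [ht]
      · have h4 := congrArg (LaurentPolynomial.eval₂ (RingHom.id F) (Units.mk0 t ht)) hq
        rw [LaurentPolynomial.eval₂_toLaurent, map_mul, h1, zero_mul] at h4
        rw [Polynomial.eval_mul, Polynomial.eval_zero]
        exact mul_eq_zero_of_left h4 _
    exact (mul_eq_zero.mp h3).resolve_right Polynomial.X_ne_zero
  rw [hq0, map_zero] at hq
  exact (IsUnit.mul_left_eq_zero (LaurentPolynomial.isUnit_T n)).mp hq.symm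

theorem eq_top_of_laurent_generators (S : Subalgebra F (MvPolynomial ι (LaurentPolynomial F)))
    (hT : C (LaurentPolynomial.T 1) ∈ S) (hT' : C (LaurentPolynomial.T (-1)) ∈ S)
    (hX : ∀ i, X i ∈ S) : S = ⊤ := by
  have hTn : ∀ n : ℕ, C (LaurentPolynomial.T n) ∈ S := fun n => by
    have := pow_mem hT n
    rwa [← C_pow, LaurentPolynomial.T_pow, mul_one] at this
  have hTn' : ∀ n : ℕ, C (LaurentPolynomial.T (-n : ℤ)) ∈ S := fun n => by
    have := pow_mem hT' n
    rwa [← C_pow, LaurentPolynomial.T_pow, mul_neg_one] at this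
  have hC : ∀ q : LaurentPolynomial F, C q ∈ S := by
    intro q
    induction q using LaurentPolynomial.induction_on' with
    | add p q hp hq => rw [C_add]; exact add_mem hp hq
    | C_mul_T n a =>
      rw [C_mul]
      refine mul_mem (S.algebraMap_mem a) ?_
      rcases Int.eq_nat_or_neg n with ⟨k, rfl | rfl⟩
      · exact hTn k
      · exact hTn' k
  rw [eq_top_iff]
  intro p _
  induction p using MvPolynomial.induction_on with
  | C q => exact hC q
  | add p q hp hq => exact add_mem (hp trivial) (hq trivial)
  | mul_X p i hp => exact mul_mem (hp trivial) (hX i)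

/-- The closure of a set parametrized by the product of the punctured line and an affine space,
with the whole coordinate ring of that product generated by the parametrization. -/
theorem zariskiDim_eq_of_laurent [Infinite F] [Finite ι] (V : Set (κ → F))
    (ψ : κ → MvPolynomial ι (LaurentPolynomial F))
    (hV : ∀ v, v ∈ V ↔ ∃ t z, v = fun j => evalLaurent t z (ψ j))
    (hψ : Algebra.adjoin F (Set.range ψ) = ⊤) : zariskiDim V = 1 + Nat.card ι := by
  have hev : ∀ (t : Fˣ) (z : ι → F) (P : MvPolynomial κ F),
      evalLaurent t z (aeval ψ P) = aeval (fun j => evalLaurent t z (ψ j)) P := by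
    intro t z P
    induction P using MvPolynomial.induction_on with
    | C r =>
      rw [aeval_C, aeval_C, IsScalarTower.algebraMap_apply F (LaurentPolynomial F), algebraMap_eq]
      change eval₂ _ _ (C _) = _
      rw [eval₂_C, LaurentPolynomial.algebraMap_apply, Algebra.algebraMap_self_apply,
        LaurentPolynomial.eval₂_C]
      rfl
    | add p q hp hq => simp only [map_add, hp, hq]
    | mul_X p j hp => simp only [map_mul, hp, aeval_X]
  have hI : vanishingIdeal F V = RingHom.ker (aeval ψ : MvPolynomial κ F →ₐ[F] _) := by
    ext P
    rw [RingHom.mem_ker, mem_vanishingIdeal_iff]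
    constructor
    · intro hP
      refine eq_zero_of_evalLaurent_eq_zero _ fun t z => ?_
      rw [hev]
      exact hP _ ((hV _).mpr ⟨t, z, rfl⟩)
    · intro hP v hv
      obtain ⟨t, z, rfl⟩ := (hV v).mp hv
      rw [← hev, hP, map_zero]
  have hsurj : Function.Surjective (aeval ψ : MvPolynomial κ F →ₐ[F] _) := by
    rw [← AlgHom.range_eq_top, ← Algebra.adjoin_range_eq_range_aeval, hψ]
  have : IsNoetherianRing (LaurentPolynomial F) := by
    have := isPrincipalIdealRing_laurentPolynomial (F := F)
    infer_instance
  rw [zariskiDim, hI, ringKrullDim_eq_of_ringEquiv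
    (Ideal.quotientKerAlgEquivOfSurjective hsurj).toRingEquiv,
    MvPolynomial.ringKrullDim_of_isNoetherianRing, ringKrullDim_laurentPolynomial]

end Dimension

end TangentImage

end

noncomputable section

namespace TangentImage

open MvPowerSeries

/-! ### Orbit maps of sums of powers of the variables -/

section Jets

variable {s k : ℕ} {A B : Type*} [CommRing A] [CommRing B]

@[simp]
theorem coeff_seriesOfJet (c : JetIndex s k → A) (d : JetIndex s k) :
    coeff d.1 (seriesOfJet c) = c d := by
  classical
  rw [seriesOfJet, map_sum, Finset.sum_eq_single d]
  · exact coeff_monomial_same _ _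
  · intro e _ he
    exact coeff_monomial_ne (fun h => he (Subtype.ext h.symm)) _
  · simp

theorem coeff_tupleOfJet (c : RightIndex s k → A) (i : Fin s) (d : {d : JetIndex s k // d.1 ≠ 0}) :
    coeff d.1.1 (tupleOfJet c i) = c (i, d) := by
  classical
  rw [tupleOfJet, map_sum, Finset.sum_eq_single d]
  · exact coeff_monomial_same _ _
  · intro e _ he
    exact coeff_monomial_ne (fun h => he (Subtype.ext (Subtype.ext h.symm))) _
  · simp

@[simp]
theorem constantCoeff_tupleOfJet (c : RightIndex s k → A) (i : Fin s) :
    constantCoeff (tupleOfJet c i) = 0 := by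
  classical
  rw [tupleOfJet, map_sum]
  refine Finset.sum_eq_zero fun d _ => ?_
  rw [← coeff_zero_eq_constantCoeff_apply]
  exact coeff_monomial_ne d.2.symm _

theorem map_seriesOfJet (θ : A →+* B) (c : JetIndex s k → A) :
    map θ (seriesOfJet c) = seriesOfJet fun d => θ (c d) := by
  simp [seriesOfJet, map_sum, map_monomial]

theorem map_tupleOfJet (θ : A →+* B) (c : RightIndex s k → A) (i : Fin s) :
    map θ (tupleOfJet c i) = tupleOfJet (fun d => θ (c d)) i := by
  simp [tupleOfJet, map_sum, map_monomial]

/-- The sum of powers `x_1 ^ n_1 + ... + x_s ^ n_s`. -/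
def powerSum (A : Type*) [CommRing A] (n : Fin s → ℕ) : MvPowerSeries (Fin s) A :=
  ∑ i, X i ^ n i

theorem map_powerSum (θ : A →+* B) (n : Fin s → ℕ) : map θ (powerSum A n) = powerSum B n := by
  simp [powerSum, map_sum]

/-- The series `φ f` for a sum of powers `f`, in terms of the coordinates of the jet of `φ`. -/
def rightValue (n : Fin s → ℕ) (c : RightIndex s k → A) : MvPowerSeries (Fin s) A :=
  ∑ i, tupleOfJet c i ^ n i

/-- The series `u * φ f` for a sum of powers `f`, in terms of the coordinates of the jet of
`(u, φ)`. -/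
def contactValue (n : Fin s → ℕ) (c : ContactIndex s k → A) : MvPowerSeries (Fin s) A :=
  seriesOfJet (fun d => c (Sum.inl d)) * rightValue n fun d => c (Sum.inr d)

theorem map_rightValue (θ : A →+* B) (n : Fin s → ℕ) (c : RightIndex s k → A) :
    map θ (rightValue n c) = rightValue n fun d => θ (c d) := by
  simp [rightValue, map_sum, map_tupleOfJet]

theorem map_contactValue (θ : A →+* B) (n : Fin s → ℕ) (c : ContactIndex s k → A) :
    map θ (contactValue n c) = contactValue n fun d => θ (c d) := by
  simp [contactValue, map_rightValue, map_seriesOfJet]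

variable {K : Type*} [Field K]

theorem subst_powerSum [Algebra K A] (n : Fin s → ℕ) (a : Fin s → MvPowerSeries (Fin s) A)
    (ha : ∀ i, constantCoeff (a i) = 0) : subst a (powerSum K n) = ∑ i, a i ^ n i := by
  have h := hasSubst_of_constantCoeff_zero ha
  rw [← substAlgHom_apply (R := K) h, powerSum, map_sum]
  simp [subst_pow h, subst_X h]

theorem rightOrbitMap_powerSum (n : Fin s → ℕ) (d : JetIndex s k) :
    rightOrbitMap k (powerSum K n) d = coeff d.1 (rightValue n MvPolynomial.X) := by
  rw [rightOrbitMap, subst_powerSum _ _ fun i => constantCoeff_tupleOfJet _ i]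
  rfl

theorem contactOrbitMap_powerSum (n : Fin s → ℕ) (d : JetIndex s k) :
    contactOrbitMap k (powerSum K n) d = coeff d.1 (contactValue n MvPolynomial.X) := by
  rw [contactOrbitMap, subst_powerSum _ _ fun i => constantCoeff_tupleOfJet _ i]
  rfl

theorem ringHom_rightOrbitMap (n : Fin s → ℕ) (θ : MvPolynomial (RightIndex s k) K →+* B)
    (d : JetIndex s k) : θ (rightOrbitMap k (powerSum K n) d) =
      coeff d.1 (rightValue n fun i => θ (MvPolynomial.X i)) := by
  rw [rightOrbitMap_powerSum, ← map_rightValue, coeff_map]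

theorem ringHom_contactOrbitMap (n : Fin s → ℕ) (θ : MvPolynomial (ContactIndex s k) K →+* B)
    (d : JetIndex s k) : θ (contactOrbitMap k (powerSum K n) d) =
      coeff d.1 (contactValue n fun i => θ (MvPolynomial.X i)) := by
  rw [contactOrbitMap_powerSum, ← map_contactValue, coeff_map]

variable {K' : Type*} [Field K'] [Algebra K K']

theorem map_rightOrbitMap (n : Fin s → ℕ) (d : JetIndex s k) :
    MvPolynomial.map (algebraMap K K') (rightOrbitMap k (powerSum K n) d) =
      rightOrbitMap k (powerSum K' n) d := by
  rw [ringHom_rightOrbitMap, rightOrbitMap_powerSum]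
  simp

theorem map_contactOrbitMap (n : Fin s → ℕ) (d : JetIndex s k) :
    MvPolynomial.map (algebraMap K K') (contactOrbitMap k (powerSum K n) d) =
      contactOrbitMap k (powerSum K' n) d := by
  rw [ringHom_contactOrbitMap, contactOrbitMap_powerSum]
  simp

theorem eval_contactOrbitMap (n : Fin s → ℕ) (y : ContactIndex s k → K) (d : JetIndex s k) :
    MvPolynomial.eval y (contactOrbitMap k (powerSum K n) d) = coeff d.1 (contactValue n y) := by
  rw [ringHom_contactOrbitMap]
  simp

theorem aeval_contactOrbitMap (n : Fin s → ℕ) (y : ContactIndex s k → K') (d : JetIndex s k) :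
    MvPolynomial.aeval y (contactOrbitMap k (powerSum K n) d) = coeff d.1 (contactValue n y) := by
  refine (ringHom_contactOrbitMap n (MvPolynomial.aeval y : _ →ₐ[K] K').toRingHom d).trans ?_
  simp

theorem eval_rightOrbitMap (n : Fin s → ℕ) (y : RightIndex s k → K) (d : JetIndex s k) :
    MvPolynomial.eval y (rightOrbitMap k (powerSum K n) d) = coeff d.1 (rightValue n y) := by
  rw [ringHom_rightOrbitMap]
  simp

end Jets

section Truncation

variable {s : ℕ} {K : Type*} [Field K]

theorem le_order_seriesOfJet_jet_sub (k : ℕ) (f : PS s K) :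
    ((k + 1 : ℕ) : ℕ∞) ≤ (seriesOfJet (jet k f) - f).order := by
  refine MvPowerSeries.le_order fun d hd => ?_
  have hd' : d.degree ≤ k := by
    have : d.degree < k + 1 := by exact_mod_cast hd
    omega
  rw [map_sub, coeff_seriesOfJet (jet k f) ⟨d, hd'⟩]
  simp [jet]

theorem le_order_tupleOfJet_sub (k : ℕ) (a : Fin s → PS s K)
    (ha : ∀ i, constantCoeff (a i) = 0) (i : Fin s) :
    ((k + 1 : ℕ) : ℕ∞) ≤
      (tupleOfJet (k := k) (fun c => coeff c.2.1.1 (a c.1)) i - a i).order := by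
  refine MvPowerSeries.le_order fun d hd => ?_
  have hd' : d.degree ≤ k := by
    have : d.degree < k + 1 := by exact_mod_cast hd
    omega
  by_cases h0 : d = 0
  · subst h0
    simp [ha]
  · rw [map_sub, coeff_tupleOfJet _ i ⟨⟨d, hd'⟩, h0⟩]
    simp

theorem le_order_tupleOfJet_rightJet_sub (k : ℕ) (φ : RightGroup s K) (i : Fin s) :
    ((k + 1 : ℕ) : ℕ∞) ≤ (tupleOfJet (rightJet k φ) i - φ (X i)).order :=
  le_order_tupleOfJet_sub k (fun i => φ (X i)) (constantCoeff_algEquiv_X φ) i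

theorem le_order_pow_sub_pow {A : Type*} [CommRing A] {m : ℕ∞} {f g : MvPowerSeries (Fin s) A}
    (h : m ≤ (f - g).order) (n : ℕ) : m ≤ (f ^ n - g ^ n).order := by
  obtain ⟨c, hc⟩ := sub_dvd_pow_sub_pow f g n
  rw [hc]
  exact h.trans (le_self_add.trans le_order_mul)

theorem le_order_mul_sub_mul {A : Type*} [CommRing A] {m : ℕ∞} {f g f' g' : MvPowerSeries (Fin s) A}
    (h : m ≤ (f - f').order) (h' : m ≤ (g - g').order) : m ≤ (f * g - f' * g').order := by
  rw [show f * g - f' * g' = (f - f') * g + f' * (g - g') by ring]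
  exact le_order_add (h.trans (le_self_add.trans le_order_mul))
    (h'.trans (le_add_self.trans le_order_mul))

theorem le_order_rightValue_sub (k : ℕ) (n : Fin s → ℕ) (φ : RightGroup s K) :
    ((k + 1 : ℕ) : ℕ∞) ≤ (rightValue n (rightJet k φ) - φ (powerSum K n)).order := by
  rw [rightValue, powerSum, map_sum, ← Finset.sum_sub_distrib]
  refine le_order_sum _ _ fun i _ => ?_
  rw [map_pow]
  exact le_order_pow_sub_pow (le_order_tupleOfJet_rightJet_sub k φ i) _

theorem le_order_contactValue_sub (k : ℕ) (n : Fin s → ℕ) (g : ContactGroup s K) :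
    ((k + 1 : ℕ) : ℕ∞) ≤ (contactValue n (contactJet k g) - g • powerSum K n).order :=
  le_order_mul_sub_mul (le_order_seriesOfJet_jet_sub k _) (le_order_rightValue_sub k n g.right)

theorem jet_smul_powerSum (k : ℕ) (n : Fin s → ℕ) (g : ContactGroup s K) :
    jet k (g • powerSum K n) = fun d => coeff d.1 (contactValue n (contactJet k g)) := by
  ext d
  exact (coeff_eq_of_le_order_sub (le_order_contactValue_sub k n g)
    (Nat.lt_succ_of_le d.2)).symm

theorem jet_rightGroup_powerSum (k : ℕ) (n : Fin s → ℕ) (φ : RightGroup s K) :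
    jet k (φ (powerSum K n)) = fun d => coeff d.1 (rightValue n (rightJet k φ)) := by
  ext d
  exact (coeff_eq_of_le_order_sub (le_order_rightValue_sub k n φ)
    (Nat.lt_succ_of_le d.2)).symm

end Truncation

section Group

variable {s k : ℕ} {K : Type*} [Field K]

/-- The polynomial whose nonvanishing describes the `k`-jets of the contact group: the constant
term of the unit times the determinant of the linear part of the automorphism. (For `k = 0` the
coordinates contain no linear part, and the determinant is `1`.) -/
def contactDenominator (s k : ℕ) (K : Type*) [Field K] : MvPolynomial (ContactIndex s k) K :=
  MvPolynomial.X (Sum.inl ⟨0, by simp⟩) *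
    (Matrix.of fun i j : Fin s => coeff (Finsupp.single j 1)
      (tupleOfJet (k := k) (fun c => (MvPolynomial.X (Sum.inr c) : MvPolynomial _ K)) i +
        if k = 0 then X i else 0)).det

theorem eval_contactDenominator (y : ContactIndex s k → K) :
    MvPolynomial.eval y (contactDenominator s k K) = y (Sum.inl ⟨0, by simp⟩) *
      (Matrix.of fun i j : Fin s => coeff (Finsupp.single j 1)
        (tupleOfJet (fun c => y (Sum.inr c)) i + if k = 0 then X i else 0)).det := by
  rw [contactDenominator, map_mul, MvPolynomial.eval_X, RingHom.map_det]
  congr 2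
  ext i j
  simp only [RingHom.mapMatrix_apply, Matrix.map_apply, Matrix.of_apply]
  rw [← coeff_map, map_add, map_tupleOfJet]
  split_ifs <;> simp

theorem exists_contactJet_eq (y : ContactIndex s k → K)
    (hy : MvPolynomial.eval y (contactDenominator s k K) ≠ 0) :
    ∃ g : ContactGroup s K, contactJet k g = y := by
  rw [eval_contactDenominator] at hy
  obtain ⟨h0, hdet⟩ := ne_zero_and_ne_zero_of_mul hy
  obtain ⟨φ, hφ⟩ := exists_algEquiv_of_linearPart
    (fun i => tupleOfJet (fun c => y (Sum.inr c)) i + if k = 0 then X i else 0)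
    (fun i => by split_ifs <;> simp) hdet
  have hu : IsUnit (seriesOfJet (fun d => y (Sum.inl d))) := by
    rw [isUnit_iff_constantCoeff, ← coeff_zero_eq_constantCoeff_apply, isUnit_iff_ne_zero]
    rwa [coeff_seriesOfJet (fun d => y (Sum.inl d)) ⟨0, by simp⟩]
  refine ⟨⟨hu.unit, φ⟩, ?_⟩
  ext (d | ⟨i, d⟩)
  · simp [contactJet, jet]
  · have hk : k ≠ 0 := by
      rintro rfl
      exact d.2 ((Finsupp.degree_eq_zero_iff _).mp (Nat.le_zero.mp d.1.2))
    simp [contactJet, rightJet, hφ, hk, coeff_tupleOfJet]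

theorem eval_contactDenominator_one :
    MvPolynomial.eval (contactJet k (1 : ContactGroup s K)) (contactDenominator s k K) = 1 := by
  classical
  rw [eval_contactDenominator]
  have h1 : (Matrix.of fun i j : Fin s => coeff (Finsupp.single j 1)
        (tupleOfJet (fun c => contactJet k (1 : ContactGroup s K) (Sum.inr c)) i +
          if k = 0 then X i else 0)) = 1 := by
    ext i j
    rw [Matrix.of_apply, Matrix.one_apply, map_add]
    by_cases hk : k = 0
    · have hlin : coeff (Finsupp.single j 1) (tupleOfJet (k := k) (fun c =>
          contactJet k (1 : ContactGroup s K) (Sum.inr c)) i) = 0 := by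
        rw [tupleOfJet, map_sum]
        refine Finset.sum_eq_zero fun d _ => coeff_monomial_ne ?_ _
        rintro h
        have := d.1.2
        rw [← h, Finsupp.degree_single] at this
        omega
      rw [hlin, if_pos hk, coeff_X, zero_add]
      simp [Finsupp.single_left_inj, eq_comm]
    · have h2 := coeff_tupleOfJet (fun c => contactJet k (1 : ContactGroup s K) (Sum.inr c)) i
        ⟨⟨Finsupp.single j 1, by rw [Finsupp.degree_single]; omega⟩, by simp⟩
      rw [h2, if_neg hk, map_zero, add_zero]
      simp [contactJet, rightJet, coeff_X, Finsupp.single_left_inj, eq_comm]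
  rw [h1, Matrix.det_one, mul_one]
  simp [contactJet, jet]

theorem contactDenominator_ne_zero : contactDenominator s k K ≠ 0 := fun h => by
  have := eval_contactDenominator_one (s := s) (k := k) (K := K)
  rw [h, map_zero] at this
  exact zero_ne_one this

variable {K' : Type*} [Field K'] [Algebra K K']

theorem aeval_contactOrbitMap_mem_jetOrbit (n : Fin s → ℕ) (y : ContactIndex s k → K')
    (hy : MvPolynomial.eval y (contactDenominator s k K') ≠ 0) :
    (fun d => MvPolynomial.aeval y (contactOrbitMap k (powerSum K n) d)) ∈
      jetOrbit (K' := K') (ContactGroup s K') k (powerSum K n) := by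
  obtain ⟨g, rfl⟩ := exists_contactJet_eq y hy
  refine ⟨g • powerSum K' n, ⟨g, ?_⟩, ?_⟩
  · simp [map_powerSum]
  · rw [jet_smul_powerSum]
    ext d
    rw [aeval_contactOrbitMap]

theorem contactJetTangentImage_le_jetTangentSpace [Infinite K'] (n : Fin s → ℕ) :
    contactJetTangentImage k (powerSum K n) ≤
      jetTangentSpace (K' := K') (ContactGroup s K') k (powerSum K n) := by
  refine range_tangentMap_le_zariskiTangentSpace _ _ _ _ (fun d => ?_) (contactDenominator s k K')
    contactDenominator_ne_zero fun y hy => aeval_contactOrbitMap_mem_jetOrbit n y hy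
  rw [eval_contactOrbitMap, ← one_smul (ContactGroup s K) (powerSum K n), jet_smul_powerSum]

end Group

end TangentImage
end

noncomputable section

namespace TangentImage

open MvPowerSeries

/-! ### Tangent maps of the orbit maps -/

section Leibniz

variable {s k : ℕ} {ι : Type*} [Fintype ι] {F B : Type*} [Field F] [CommRing B]

/-- The derivative in the direction `w`, at the point given by `θ`, of the coefficients of a power
series over a polynomial ring. -/
def directional (θ : MvPolynomial ι F →+* B) (w : ι → B)
    (P : MvPowerSeries (Fin s) (MvPolynomial ι F)) : MvPowerSeries (Fin s) B :=
  fun d => ∑ i, θ (MvPolynomial.pderiv i (coeff d P)) * w i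

variable (θ : MvPolynomial ι F →+* B) (w : ι → B)

theorem coeff_directional (P : MvPowerSeries (Fin s) (MvPolynomial ι F)) (d : Fin s →₀ ℕ) :
    coeff d (directional θ w P) = ∑ i, θ (MvPolynomial.pderiv i (coeff d P)) * w i := rfl

theorem directional_sum {J : Type*} (t : Finset J)
    (P : J → MvPowerSeries (Fin s) (MvPolynomial ι F)) :
    directional θ w (∑ j ∈ t, P j) = ∑ j ∈ t, directional θ w (P j) := by
  ext d
  simp only [coeff_directional, map_sum, Finset.sum_mul]
  exact Finset.sum_comm

theorem directional_mul (P Q : MvPowerSeries (Fin s) (MvPolynomial ι F)) :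
    directional θ w (P * Q) = map θ P * directional θ w Q + directional θ w P * map θ Q := by
  classical
  ext d
  rw [map_add, coeff_directional, coeff_mul, coeff_mul, coeff_mul, ← Finset.sum_add_distrib]
  simp only [map_sum, coeff_directional, coeff_map, Finset.sum_mul, Finset.mul_sum]
  rw [Finset.sum_comm]
  refine Finset.sum_congr rfl fun p _ => ?_
  rw [← Finset.sum_add_distrib]
  refine Finset.sum_congr rfl fun i _ => ?_
  rw [MvPolynomial.pderiv_mul, map_add, map_mul, map_mul]
  ring

theorem directional_pow (P : MvPowerSeries (Fin s) (MvPolynomial ι F)) (n : ℕ) :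
    directional θ w (P ^ n) = n * map θ P ^ (n - 1) * directional θ w P := by
  induction n with
  | zero =>
    ext d
    classical
    have : coeff d (1 : MvPowerSeries (Fin s) (MvPolynomial ι F)) =
        MvPolynomial.C (if d = 0 then 1 else 0) := by
      rw [coeff_one]
      split_ifs <;> simp
    rw [pow_zero, coeff_directional, this]
    simp only [MvPolynomial.pderiv_C]
    simp
  | succ n ih =>
    rw [pow_succ, directional_mul, ih]
    rcases n with _ | n
    · simp
    · simp only [map_pow, Nat.add_sub_cancel]
      push_cast
      ring

theorem directional_monomial_X (d : Fin s →₀ ℕ) (i : ι) :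
    directional θ w (monomial d (MvPolynomial.X i)) = monomial d (w i) := by
  classical
  ext e
  rw [coeff_directional, coeff_monomial, coeff_monomial]
  split_ifs
  · simp [MvPolynomial.pderiv_X, Pi.single_apply, apply_ite θ]
  · simp

end Leibniz

section Formulas

variable {s k : ℕ} {F B : Type*} [Field F] [CommRing B]

/-- The derivative at `c` in the direction `w` of `c ↦ contactValue n c`. -/
def contactTangent (n : Fin s → ℕ) (c w : ContactIndex s k → B) : MvPowerSeries (Fin s) B :=
  seriesOfJet (fun d => c (Sum.inl d)) *
      ∑ i, n i * tupleOfJet (fun d => c (Sum.inr d)) i ^ (n i - 1) *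
        tupleOfJet (fun d => w (Sum.inr d)) i +
    seriesOfJet (fun d => w (Sum.inl d)) * rightValue n fun d => c (Sum.inr d)

theorem directional_contactValue (n : Fin s → ℕ) (θ : MvPolynomial (ContactIndex s k) F →+* B)
    (w : ContactIndex s k → B) : directional θ w (contactValue n MvPolynomial.X) =
      contactTangent n (fun i => θ (MvPolynomial.X i)) w := by
  have h1 : ∀ i, directional θ w (tupleOfJet (fun d => MvPolynomial.X (Sum.inr d)) i) =
      tupleOfJet (fun d => w (Sum.inr d)) i := fun i => by
    simp [tupleOfJet, directional_sum, directional_monomial_X]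
  have h2 : directional θ w (seriesOfJet fun d => MvPolynomial.X (Sum.inl d)) =
      seriesOfJet (fun d => w (Sum.inl d)) := by
    simp [seriesOfJet, directional_sum, directional_monomial_X]
  rw [contactValue, contactTangent, directional_mul, h2, map_rightValue, map_seriesOfJet]
  congr 2
  rw [rightValue, directional_sum]
  refine Finset.sum_congr rfl fun i _ => ?_
  rw [directional_pow, h1, map_tupleOfJet]

theorem tangentMap_contactOrbitMap (n : Fin s → ℕ) (c w : ContactIndex s k → F)
    (d : JetIndex s k) : tangentMap c (contactOrbitMap k (powerSum F n)) w d =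
      coeff d.1 (contactTangent n c w) := by
  rw [tangentMap_apply, contactOrbitMap_powerSum]
  have := directional_contactValue n (MvPolynomial.eval c) w
  simp only [MvPolynomial.eval_X] at this
  rw [← this]
  rfl

theorem directional_rightValue (n : Fin s → ℕ) (θ : MvPolynomial (RightIndex s k) F →+* B)
    (w : RightIndex s k → B) : directional θ w (rightValue n MvPolynomial.X) =
      ∑ i, n i * tupleOfJet (fun d => θ (MvPolynomial.X d)) i ^ (n i - 1) * tupleOfJet w i := by
  rw [rightValue, directional_sum]
  refine Finset.sum_congr rfl fun i _ => ?_
  rw [directional_pow, map_tupleOfJet]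
  congr 1
  simp [tupleOfJet, directional_sum, directional_monomial_X]

end Formulas

section TangentImages

variable {s k : ℕ} {K : Type*} [Field K]

theorem mem_maximalIdeal_iff {f : PS s K} :
    f ∈ IsLocalRing.maximalIdeal (PS s K) ↔ constantCoeff f = 0 := by
  rw [IsLocalRing.mem_maximalIdeal, mem_nonunits_iff, isUnit_iff_constantCoeff, isUnit_iff_ne_zero,
    not_not]

theorem pderiv_powerSum (n : Fin s → ℕ) (i : Fin s) :
    pderiv K i (powerSum K n) = (n i : PS s K) * X i ^ (n i - 1) := by
  classical
  rw [powerSum, map_sum, Finset.sum_eq_single i]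
  · simp
  · intro j _ hj
    simp [pderiv_X_of_ne hj]
  · simp

theorem mem_contactTangentImage_powerSum {n : Fin s → ℕ} {g : PS s K} :
    g ∈ contactTangentImage (powerSum K n) ↔ ∃ (a : PS s K) (b : Fin s → PS s K),
      (∀ i, constantCoeff (b i) = 0) ∧
        g = a * powerSum K n + ∑ i, (n i : PS s K) * X i ^ (n i - 1) * b i := by
  rw [contactTangentImage, Submodule.add_eq_sup, Submodule.mem_sup]
  constructor
  · rintro ⟨y, hy, z, hz, rfl⟩
    obtain ⟨a, rfl⟩ := Ideal.mem_span_singleton'.mp hy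
    rw [jacobianIdeal, ← smul_eq_mul, Submodule.mem_ideal_smul_span_iff_exists_sum] at hz
    obtain ⟨b, hb, rfl⟩ := hz
    refine ⟨a, b, fun i => mem_maximalIdeal_iff.mp (hb i), ?_⟩
    rw [Finsupp.sum_fintype _ _ (by simp)]
    congr 1
    refine Finset.sum_congr rfl fun i _ => ?_
    rw [pderiv_powerSum, smul_eq_mul, mul_comm]
  · rintro ⟨a, b, hb, rfl⟩
    refine ⟨_, Ideal.mem_span_singleton'.mpr ⟨a, rfl⟩, _, ?_, rfl⟩
    refine Ideal.sum_mem _ fun i _ => ?_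
    rw [← pderiv_powerSum, mul_comm _ (b i)]
    exact Ideal.mul_mem_mul (mem_maximalIdeal_iff.mpr (hb i)) (Ideal.subset_span ⟨i, rfl⟩)

/-- Modulo the truncation, the derivative of the orbit map at the identity is
`(v, w) ↦ v f + ∑ ∂f/∂x_i w_i`. -/
theorem le_order_contactTangent_one_sub (n : Fin s → ℕ) (w : ContactIndex s k → K) :
    ((k + 1 : ℕ) : ℕ∞) ≤ (contactTangent n (contactJet k (1 : ContactGroup s K)) w -
      (∑ i, (n i : PS s K) * X i ^ (n i - 1) * tupleOfJet (fun d => w (Sum.inr d)) i +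
        seriesOfJet (fun d => w (Sum.inl d)) * powerSum K n)).order := by
  have h1 := le_order_seriesOfJet_jet_sub k (1 : PS s K)
  have h2 := fun i => le_order_tupleOfJet_rightJet_sub k (1 : RightGroup s K) i
  have h3 := le_order_rightValue_sub k n (1 : RightGroup s K)
  have h0 : ∀ f : PS s K, ((k + 1 : ℕ) : ℕ∞) ≤ (f - f).order := fun f => by simp
  rw [contactTangent, add_sub_add_comm]
  refine le_order_add ?_ (le_order_mul_sub_mul (h0 _) h3)
  have h4 : ((k + 1 : ℕ) : ℕ∞) ≤
      (∑ i, (n i : PS s K) * tupleOfJet (rightJet k (1 : RightGroup s K)) i ^ (n i - 1) *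
          tupleOfJet (fun d => w (Sum.inr d)) i -
        ∑ i, (n i : PS s K) * X i ^ (n i - 1) * tupleOfJet (fun d => w (Sum.inr d)) i).order := by
    rw [← Finset.sum_sub_distrib]
    refine le_order_sum _ _ fun i _ => ?_
    exact le_order_mul_sub_mul (le_order_mul_sub_mul (h0 _) (le_order_pow_sub_pow (h2 i) _)) (h0 _)
  have h5 := le_order_mul_sub_mul h1 h4
  rwa [one_mul] at h5

/-- The tangent image on jets consists of the jets of the elements of the tangent image. -/
theorem contactJetTangentImage_powerSum (n : Fin s → ℕ) :
    contactJetTangentImage k (powerSum K n) =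
      ((contactTangentImage (powerSum K n)).restrictScalars K).map (jet k) := by
  ext v
  rw [contactJetTangentImage, LinearMap.mem_range, Submodule.mem_map]
  have key : ∀ w : ContactIndex s k → K,
      tangentMap (contactJet k (1 : ContactGroup s K)) (contactOrbitMap k (powerSum K n)) w =
        jet k (∑ i, (n i : PS s K) * X i ^ (n i - 1) * tupleOfJet (fun d => w (Sum.inr d)) i +
          seriesOfJet (fun d => w (Sum.inl d)) * powerSum K n) := fun w => by
    ext d
    rw [tangentMap_contactOrbitMap]
    exact coeff_eq_of_le_order_sub (le_order_contactTangent_one_sub n w) (Nat.lt_succ_of_le d.2)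
  constructor
  · rintro ⟨w, rfl⟩
    refine ⟨_, ?_, (key w).symm⟩
    rw [Submodule.restrictScalars_mem, mem_contactTangentImage_powerSum]
    exact ⟨_, _, fun i => constantCoeff_tupleOfJet _ i, add_comm _ _⟩
  · rintro ⟨g, hg, rfl⟩
    rw [Submodule.restrictScalars_mem, mem_contactTangentImage_powerSum] at hg
    obtain ⟨a, b, hb, rfl⟩ := hg
    refine ⟨Sum.elim (jet k a) fun c => coeff c.2.1.1 (b c.1), ?_⟩
    rw [key]
    have hjet : ∀ f g : PS s K, ((k + 1 : ℕ) : ℕ∞) ≤ (f - g).order → jet k f = jet k g :=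
      fun f g h => funext fun d => coeff_eq_of_le_order_sub h (Nat.lt_succ_of_le d.2)
    refine hjet _ _ ?_
    rw [add_comm (a * _), add_sub_add_comm]
    have h0 : ∀ f : PS s K, ((k + 1 : ℕ) : ℕ∞) ≤ (f - f).order := fun f => by simp
    refine le_order_add ?_ (le_order_mul_sub_mul (le_order_seriesOfJet_jet_sub k a) (h0 _))
    rw [← Finset.sum_sub_distrib]
    refine le_order_sum _ _ fun i _ => le_order_mul_sub_mul (h0 _) ?_
    exact le_order_tupleOfJet_sub k b hb i

theorem contactJetTangentImage_eq_coordinateSubmodule (n : Fin s → ℕ) (M : Finset (Fin s →₀ ℕ))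
    (hM : contactTangentImage (powerSum K n) =
      Ideal.span ((fun m => monomial m (1 : K)) '' (M : Set (Fin s →₀ ℕ)))) :
    contactJetTangentImage k (powerSum K n) =
      coordinateSubmodule K {d : JetIndex s k | ∀ m ∈ M, ¬ m ≤ d.1} := by
  rw [contactJetTangentImage_powerSum]
  ext v
  rw [Submodule.mem_map, mem_coordinateSubmodule]
  simp only [Submodule.restrictScalars_mem, hM, mem_span_monomial_iff]
  constructor
  · rintro ⟨g, hg, rfl⟩ d hd
    exact hg d.1 hd
  · intro hv
    refine ⟨seriesOfJet v, fun d hd => ?_, by ext d; simp [jet]⟩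
    by_cases hk : d.degree ≤ k
    · rw [coeff_seriesOfJet v ⟨d, hk⟩]
      exact hv _ hd
    · rw [seriesOfJet, map_sum]
      refine Finset.sum_eq_zero fun e _ => coeff_monomial_ne ?_ _
      rintro rfl
      exact hk e.2

end TangentImages

section TangentSpaces

variable {s : ℕ} {K K' : Type*} [Field K] [Field K'] [Algebra K K'] {G : Type*} [Group G]
  [MulAction G (PS s K')]

/-- The direction of a line that meets the orbit in infinitely many points is tangent. -/
theorem jet_mem_jetTangentSpace_of_infinite (k : ℕ) (f g : PS s K)
    (H : {t : K' | map (algebraMap K K') f + C t * map (algebraMap K K') g ∈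
      MulAction.orbit G (map (algebraMap K K') f)}.Infinite) :
    jet k g ∈ jetTangentSpace (K' := K') G k f := by
  refine mem_zariskiTangentSpace_of_infinite _ _ _ (H.mono fun t ht => ⟨_, ht, ?_⟩)
  ext d
  simp [jet]

theorem mem_tangentSpace_of_infinite (f g : PS s K)
    (H : {t : K' | map (algebraMap K K') f + C t * map (algebraMap K K') g ∈
      MulAction.orbit G (map (algebraMap K K') f)}.Infinite) :
    g ∈ tangentSpace (K' := K') G f := by
  rw [tangentSpace, Submodule.mem_iInf]
  exact fun k => jet_mem_jetTangentSpace_of_infinite k f g H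

theorem mem_tangentSpace_iff {f g : PS s K} :
    g ∈ tangentSpace (K' := K') G f ↔ ∀ k, jet k g ∈ jetTangentSpace (K' := K') G k f := by
  simp [tangentSpace, Submodule.mem_iInf]

theorem contactTangentImage_le_tangentSpace [Infinite K'] (n : Fin s → ℕ) :
    (contactTangentImage (powerSum K n)).restrictScalars K ≤
      tangentSpace (K' := K') (ContactGroup s K') (powerSum K n) := by
  intro g hg
  rw [mem_tangentSpace_iff]
  intro k
  refine contactJetTangentImage_le_jetTangentSpace n ?_
  rw [contactJetTangentImage_powerSum]
  exact ⟨g, hg, rfl⟩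

/-- A polynomial that vanishes on the jets in the orbit has a differential that vanishes on the
tangent space. -/
theorem differential_eq_zero_of_mem_jetTangentSpace {k : ℕ} {f : PS s K}
    {v : JetIndex s k → K} (hv : v ∈ jetTangentSpace (K' := K') G k f)
    (F : MvPolynomial (JetIndex s k) K)
    (hF : ∀ c ∈ jetOrbit (K' := K') G k f, MvPolynomial.aeval c F = 0) :
    differential (jet k f) F v = 0 :=
  mem_zariskiTangentSpace_iff.mp hv F (MvPolynomial.mem_vanishingIdeal_iff.mpr hF)

end TangentSpaces

end TangentImage
end

noncomputable section

namespace TangentImage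

open MvPowerSeries

/-! ### Sums of `p`-th powers under the right group -/

section Line

variable {κ : Type*} {F : Type*} [Field F]

/-- A set that meets a line in infinitely many points has positive dimension. -/
theorem one_le_zariskiDim_of_infinite (V : Set (κ → F)) (x v : κ → F) (hv : v ≠ 0)
    (H : {t : F | (fun j => x j + t * v j) ∈ V}.Infinite) : 1 ≤ zariskiDim V := by
  let a : κ → Polynomial F := fun j => Polynomial.C (x j) + Polynomial.X * Polynomial.C (v j)
  have hker : ∀ P ∈ MvPolynomial.vanishingIdeal F V, MvPolynomial.aeval a P = 0 := by
    intro P hP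
    refine Polynomial.eq_zero_of_infinite_isRoot _ (H.mono fun t ht => ?_)
    have h1 := MvPolynomial.mem_vanishingIdeal_iff.mp hP _ ht
    have h2 : (Polynomial.aeval t) (MvPolynomial.aeval a P) =
        MvPolynomial.aeval (fun j => x j + t * v j) P := by
      rw [← AlgHom.comp_apply, MvPolynomial.comp_aeval]
      congr 2
      ext j
      simp [a]
      ring
    change Polynomial.eval t _ = 0
    rw [← Polynomial.coe_aeval_eq_eval, h2, h1]
  let ψ := Ideal.Quotient.liftₐ (MvPolynomial.vanishingIdeal F V) (MvPolynomial.aeval a) hker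
  have hsurj : Function.Surjective ψ := by
    obtain ⟨j, hj⟩ := Function.ne_iff.mp hv
    rw [← AlgHom.range_eq_top, eq_top_iff, ← Polynomial.adjoin_X, Algebra.adjoin_le_iff,
      Set.singleton_subset_iff]
    refine ⟨Ideal.Quotient.mk _
      (MvPolynomial.C (v j)⁻¹ * (MvPolynomial.X j - MvPolynomial.C (x j))), ?_⟩
    change MvPolynomial.aeval a _ = _
    simp only [map_mul, map_sub, MvPolynomial.aeval_X, MvPolynomial.algHom_C, a]
    change Polynomial.C _ * (_ - Polynomial.C _) = _
    rw [add_sub_cancel_left, mul_comm Polynomial.X, ← mul_assoc, ← Polynomial.C_mul,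
      inv_mul_cancel₀ hj, Polynomial.C_1, one_mul]
  have h1 := ringKrullDim_le_of_surjective ψ.toRingHom hsurj
  rwa [Polynomial.ringKrullDim_of_isNoetherianRing, ringKrullDim_eq_zero_of_field, zero_add] at h1

end Line

section Frobenius

variable {s : ℕ} {K : Type*} [Field K] (p : ℕ)

/-- The scaling of the single variable `X i` by `μ`. -/
theorem exists_rightGroup_scale (i : Fin s) (μ : K) (hμ : μ ≠ 0) (n : Fin s → ℕ) :
    ∃ φ : RightGroup s K, φ (powerSum K n) = powerSum K n + C (μ ^ n i - 1) * X i ^ n i := by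
  classical
  obtain ⟨φ, hφ⟩ := exists_algEquiv_of_linearPart
    (fun j => C (if j = i then μ else 1) * X j : Fin s → PS s K) (fun j => by simp) (by
      have : (Matrix.of fun a b => coeff (Finsupp.single b 1)
          (C (if a = i then μ else 1) * X a : PS s K)) =
          Matrix.diagonal fun a => if a = i then μ else 1 := by
        ext a b
        rw [Matrix.of_apply, coeff_C_mul, coeff_X, Matrix.diagonal_apply]
        simp [Finsupp.single_left_inj, eq_comm (a := a)]
      rw [this, Matrix.det_diagonal, Finset.prod_ne_zero_iff]
      intro a _
      split_ifs
      exacts [hμ, one_ne_zero])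
  refine ⟨φ, ?_⟩
  have h1 : ∀ j, φ (X j ^ n j) = X j ^ n j + if j = i then C (μ ^ n i - 1) * X i ^ n i else 0 := by
    intro j
    rw [map_pow, hφ, mul_pow, ← map_pow]
    split_ifs with h
    · subst h
      rw [map_sub, map_one]
      ring
    · simp
  simp only [powerSum, map_sum, h1, Finset.sum_add_distrib, Finset.sum_ite_eq', Finset.mem_univ,
    if_true]

theorem sum_pderiv_rightOrbitMap {k : ℕ} {B : Type*} [CommRing B] [CharP B p]
    (θ : MvPolynomial (RightIndex s k) K →+* B) (w : RightIndex s k → B) (d : JetIndex s k) :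
    ∑ i, θ (MvPolynomial.pderiv i (rightOrbitMap k (powerSum K fun _ => p) d)) * w i = 0 := by
  have h := directional_rightValue (fun _ => p) θ w
  rw [rightOrbitMap_powerSum, ← coeff_directional, h]
  have h0 : (p : MvPowerSeries (Fin s) B) = 0 := by
    rw [← map_natCast (C : B →+* MvPowerSeries (Fin s) B), CharP.cast_eq_zero, map_zero]
  simp [h0]

theorem X_pow_ne_zero (i : Fin s) (n : ℕ) : (X i ^ n : PS s K) ≠ 0 := fun h => by
  have := congrArg (coeff (Finsupp.single i n)) h
  simp [coeff_X_pow] at this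

theorem jet_X_pow_ne_zero {k : ℕ} (i : Fin s) {n : ℕ} (hn : n ≤ k) :
    jet k (X i ^ n : PS s K) ≠ 0 := fun h => by
  have := congrFun h ⟨Finsupp.single i n, by simpa using hn⟩
  simp [jet, coeff_X_pow] at this

variable {K' : Type*} [Field K'] [Algebra K K'] [IsAlgClosed K']

theorem infinite_rightOrbit_line (hp : 0 < p) (i : Fin s) :
    {t : K' | map (algebraMap K K') (powerSum K fun _ => p) +
        C t * map (algebraMap K K') (X i ^ p) ∈
      MulAction.orbit (RightGroup s K')
        (map (algebraMap K K') (powerSum K fun _ : Fin s => p))}.Infinite := by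
  refine (Set.finite_singleton (-1 : K')).infinite_compl.mono fun t ht => ?_
  obtain ⟨μ, hμ⟩ := IsAlgClosed.exists_pow_nat_eq (1 + t) hp
  have hμ0 : μ ≠ 0 := by
    rintro rfl
    rw [zero_pow hp.ne'] at hμ
    exact ht (by rw [Set.mem_singleton_iff]; linear_combination -hμ)
  obtain ⟨φ, hφ⟩ := exists_rightGroup_scale i μ hμ0 fun _ => p
  refine ⟨φ, ?_⟩
  simp only [map_powerSum, map_pow, map_X]
  change φ _ = _
  rw [hφ, hμ, add_sub_cancel_left]

theorem one_le_zariskiDim_jetOrbit_powerSum (hp : 0 < p) (i : Fin s) {k : ℕ} (hk : p ≤ k) :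
    1 ≤ zariskiDim
      (jetOrbit (K' := K') (RightGroup s K') k (powerSum K fun _ : Fin s => p)) := by
  refine one_le_zariskiDim_of_infinite _
    (jet k (map (algebraMap K K') (powerSum K fun _ : Fin s => p)))
    (jet k (map (algebraMap K K') (X i ^ p))) ?_ ?_
  · rw [map_pow, map_X]
    exact jet_X_pow_ne_zero i hk
  · refine (infinite_rightOrbit_line p hp i).mono fun t ht => ⟨_, ht, ?_⟩
    ext d
    simp [jet]

variable [CharP K p]

theorem natCast_eq_zero_of_charP : (p : PS s K) = 0 := by
  rw [← map_natCast (C : K →+* PS s K), CharP.cast_eq_zero, map_zero]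

theorem jacobianIdeal_powerSum_const : jacobianIdeal (powerSum K fun _ : Fin s => p) = ⊥ := by
  rw [jacobianIdeal, Ideal.span_eq_bot]
  rintro _ ⟨i, rfl⟩
  change pderiv K i _ = 0
  rw [pderiv_powerSum, natCast_eq_zero_of_charP, zero_mul]

theorem rightTangentImage_powerSum_const :
    rightTangentImage (powerSum K fun _ : Fin s => p) = ⊥ := by
  rw [rightTangentImage, jacobianIdeal_powerSum_const, Ideal.mul_bot]

theorem rightJetTangentImage_powerSum_const (k : ℕ) :
    rightJetTangentImage k (powerSum K fun _ : Fin s => p) = ⊥ := by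
  rw [rightJetTangentImage, LinearMap.range_eq_bot]
  refine LinearMap.ext fun w => funext fun d => ?_
  change tangentMap _ _ w d = 0
  rw [tangentMap_apply]
  exact sum_pderiv_rightOrbitMap p _ _ _

theorem not_isSeparableMap_rightOrbitMap (hp : 0 < p) (i : Fin s) {k : ℕ} (hk : p ≤ k) :
    ¬ IsSeparableMap K' (rightOrbitMap k (powerSum K fun _ : Fin s => p)) := by
  intro h
  have : CharP K' p := charP_of_injective_algebraMap (algebraMap K K').injective p
  let E := FractionRing (MvPolynomial (RightIndex s k) K')
  have : CharP E p := charP_of_injective_algebraMap (algebraMap K' E).injective p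
  let d : JetIndex s k := ⟨Finsupp.single i p, by simpa using hk⟩
  have hj : AlgebraicIndependent K' fun _ : Unit => MvPolynomial.map (algebraMap K K')
      (rightOrbitMap k (powerSum K fun _ : Fin s => p) d) := by
    refine algebraicIndependent_of_dominant _ (MvPolynomial.X ()) (MvPolynomial.X_ne_zero _)
      fun c hc => ?_
    rw [MvPolynomial.eval_X] at hc
    obtain ⟨μ, hμ⟩ := IsAlgClosed.exists_pow_nat_eq (c ()) hp
    obtain ⟨φ, hφ⟩ := exists_rightGroup_scale i μ (by
      rintro rfl
      exact hc (by rw [← hμ, zero_pow hp.ne'])) fun _ => p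
    refine ⟨rightJet k φ, fun _ => ?_⟩
    have h1 := congrFun (jet_rightGroup_powerSum k (fun _ => p) φ) d
    rw [map_rightOrbitMap, eval_rightOrbitMap, ← h1, hφ, hμ]
    change coeff (Finsupp.single i p) (powerSum K' _ + _ : PS s K') = _
    rw [map_add, coeff_C_mul, powerSum, map_sum, Finset.sum_eq_single i]
    · simp [coeff_X_pow]
    · intro j _ hj
      rw [coeff_X_pow, if_neg]
      rw [Finsupp.single_left_inj hp.ne']
      exact hj.symm
    · simp
  have h2 := h.card_add_finrank_le (J := Unit) (fun _ => d) hj ⊤ fun w _ d' => by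
    rw [map_rightOrbitMap]
    exact sum_pderiv_rightOrbitMap p (algebraMap _ E) w d'
  rw [finrank_top, Module.finrank_fintype_fun_eq_card] at h2
  simp at h2

theorem not_isFinitelyDetermined_powerSum (hp : p.Prime) (i : Fin s) :
    ¬ IsFinitelyDetermined (RightGroup s K) (powerSum K fun _ : Fin s => p) := by
  rintro ⟨k, -, hk⟩
  -- an exponent prime to `p`, so that the added power has a nonzero derivative
  set N := p * (k + 1) + 1 with hN
  obtain ⟨φ, hφ⟩ := hk (powerSum K (fun _ => p) + X i ^ N) (by
    rw [add_sub_cancel_left]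
    refine Ideal.pow_le_pow_right (n := N) ?_
      (Ideal.pow_mem_pow (mem_maximalIdeal_iff.mpr (constantCoeff_X i)) N)
    have := Nat.le_mul_of_pos_left (k + 1) hp.pos
    omega)
  have hφ' : φ (powerSum K fun _ => p) = powerSum K (fun _ => p) + X i ^ N := hφ
  have h0 := congrArg (pderiv K i) hφ'
  rw [map_add, pderiv_powerSum, natCast_eq_zero_of_charP, zero_mul, zero_add, pderiv_pow,
    powerSum, map_sum, map_sum] at h0
  rw [Finset.sum_eq_zero fun j _ => by
    rw [map_pow, pderiv_pow, natCast_eq_zero_of_charP]; simp] at h0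
  have h1 : (N : PS s K) = 1 := by
    rw [hN]
    push_cast
    rw [natCast_eq_zero_of_charP]
    ring
  rw [h1, pderiv_X_self, one_mul, mul_one] at h0
  exact X_pow_ne_zero i _ h0.symm

end Frobenius

end TangentImage
end

noncomputable section

namespace TangentImage

open MvPowerSeries

/-! ### Power series in two variables -/

section Exponents

/-- The exponent of the monomial `x ^ a * y ^ b`. -/
def ex (a b : ℕ) : Fin 2 →₀ ℕ := Finsupp.single 0 a + Finsupp.single 1 b

@[simp]
theorem ex_zero (a b : ℕ) : ex a b 0 = a := by simp [ex]

@[simp]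
theorem ex_one (a b : ℕ) : ex a b 1 = b := by simp [ex]

theorem ex_eta (d : Fin 2 →₀ ℕ) : ex (d 0) (d 1) = d := by
  ext i
  fin_cases i <;> simp

@[simp]
theorem degree_ex (a b : ℕ) : (ex a b).degree = a + b := by
  simp [ex]

theorem degree_eq_add (d : Fin 2 →₀ ℕ) : d.degree = d 0 + d 1 := by
  rw [← ex_eta d]
  simp

theorem ex_inj {a b c d : ℕ} : ex a b = ex c d ↔ a = c ∧ b = d := by
  refine ⟨fun h => ⟨?_, ?_⟩, fun h => by rw [h.1, h.2]⟩
  · simpa using DFunLike.congr_fun h 0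
  · simpa using DFunLike.congr_fun h 1

theorem le_iff_ex {m d : Fin 2 →₀ ℕ} : m ≤ d ↔ m 0 ≤ d 0 ∧ m 1 ≤ d 1 := by
  rw [Finsupp.le_def, Fin.forall_fin_two]

theorem ex_zero_zero : ex 0 0 = 0 := by simp [ex]

theorem ex_add (a b c d : ℕ) : ex a b + ex c d = ex (a + c) (b + d) := by
  ext i
  fin_cases i <;> simp

variable {A : Type*} [CommRing A]

theorem X_pow_mul_X_pow (a b : ℕ) :
    (X 0 ^ a * X 1 ^ b : MvPowerSeries (Fin 2) A) = monomial (ex a b) 1 := by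
  rw [X_pow_eq, X_pow_eq, monomial_mul_monomial, one_mul]
  rfl

theorem coeff_ex_mul (a b : ℕ) (F G : MvPowerSeries (Fin 2) A) :
    coeff (ex a b) (F * G) = ∑ i ∈ Finset.range (a + 1), ∑ j ∈ Finset.range (b + 1),
      coeff (ex i j) F * coeff (ex (a - i) (b - j)) G := by
  rw [coeff_mul, ← Finset.sum_product']
  refine Finset.sum_nbij' (fun p => (p.1 0, p.1 1))
    (fun q => (ex q.1 q.2, ex (a - q.1) (b - q.2))) ?_ ?_ ?_ ?_ ?_
  · rintro ⟨p, q⟩ h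
    rw [Finset.HasAntidiagonal.mem_antidiagonal] at h
    have h0 := DFunLike.congr_fun h 0
    have h1 := DFunLike.congr_fun h 1
    simp only [Finsupp.add_apply, ex_zero, ex_one] at h0 h1
    simp only [Finset.mem_product, Finset.mem_range]
    omega
  · rintro ⟨i, j⟩ h
    simp only [Finset.mem_product, Finset.mem_range] at h
    rw [Finset.HasAntidiagonal.mem_antidiagonal, ex_add, ex_inj]
    omega
  · rintro ⟨p, q⟩ h
    rw [Finset.HasAntidiagonal.mem_antidiagonal] at h
    have h0 := DFunLike.congr_fun h 0
    have h1 := DFunLike.congr_fun h 1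
    simp only [Finsupp.add_apply, ex_zero, ex_one] at h0 h1
    simp only [Prod.mk.injEq, ex_eta, true_and]
    rw [← h0, ← h1, Nat.add_sub_cancel_left, Nat.add_sub_cancel_left, ex_eta]
  · rintro ⟨i, j⟩ _
    simp
  · rintro ⟨p, q⟩ h
    rw [Finset.HasAntidiagonal.mem_antidiagonal] at h
    have h0 := DFunLike.congr_fun h 0
    have h1 := DFunLike.congr_fun h 1
    simp only [Finsupp.add_apply, ex_zero, ex_one] at h0 h1
    rw [← h0, ← h1, Nat.add_sub_cancel_left, Nat.add_sub_cancel_left, ex_eta, ex_eta]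

/-- The coefficients of a `p`-th power in characteristic `p`: the Frobenius acts on the coefficients and
multiplies the exponents by `p`. -/
theorem coeff_ex_pow_char (p : ℕ) [Fact p.Prime] [CharP A p] (a b : ℕ)
    (P : MvPowerSeries (Fin 2) A) : coeff (ex a b) (P ^ p) =
      if p ∣ a ∧ p ∣ b then coeff (ex (a / p) (b / p)) P ^ p else 0 := by
  have hp : p ≠ 0 := (Fact.out : p.Prime).ne_zero
  rw [← map_frobenius_expand p hp, coeff_map]
  split_ifs with h
  · obtain ⟨⟨a, rfl⟩, b, rfl⟩ := h
    have : ex (p * a) (p * b) = p • ex a b := by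
      ext i
      fin_cases i <;> simp
    rw [this, coeff_expand_smul, frobenius_def, Nat.mul_div_cancel_left _ (Nat.pos_of_ne_zero hp),
      Nat.mul_div_cancel_left _ (Nat.pos_of_ne_zero hp)]
  · rw [not_and_or] at h
    obtain h | h := h
    · rw [coeff_expand_of_not_dvd p hp _ (i := 0) (by simpa using h), map_zero]
    · rw [coeff_expand_of_not_dvd p hp _ (i := 1) (by simpa using h), map_zero]

/-- The jet index of `x ^ a * y ^ b`. -/
def jx {k : ℕ} (a b : ℕ) (h : a + b ≤ k) : JetIndex 2 k := ⟨ex a b, by rwa [degree_ex]⟩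

theorem jx_eta {k : ℕ} (d : JetIndex 2 k) :
    jx (d.1 0) (d.1 1) (by rw [← degree_eq_add]; exact d.2) = d :=
  Subtype.ext (ex_eta d.1)

/-- The pairs of exponents of the monomials of degree at most `k`. -/
def jetGrid (k : ℕ) : Finset (ℕ × ℕ) :=
  (Finset.range (k + 1) ×ˢ Finset.range (k + 1)).filter fun x => x.1 + x.2 ≤ k

theorem mem_jetGrid {k : ℕ} {x : ℕ × ℕ} : x ∈ jetGrid k ↔ x.1 + x.2 ≤ k := by
  simp only [jetGrid, Finset.mem_filter, Finset.mem_product, Finset.mem_range]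
  omega

theorem card_jetIndex_subtype (k : ℕ) (P : ℕ × ℕ → Prop) [DecidablePred P] :
    Nat.card {d : JetIndex 2 k // P (d.1 0, d.1 1)} = ((jetGrid k).filter P).card := by
  rw [← Fintype.card_coe, ← Nat.card_eq_fintype_card]
  refine Nat.card_congr (Equiv.ofBijective (fun d => ⟨(d.1.1 0, d.1.1 1), ?_⟩) ⟨?_, ?_⟩)
  · rw [Finset.mem_filter, mem_jetGrid, ← degree_eq_add]
    exact ⟨d.1.2, d.2⟩
  · rintro ⟨⟨d, hd⟩, h⟩ ⟨⟨d', hd'⟩, h'⟩ hh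
    simp only [Subtype.mk.injEq, Prod.mk.injEq] at hh ⊢
    rw [← ex_eta d, ← ex_eta d', hh.1, hh.2]
  · rintro ⟨⟨a, b⟩, hx⟩
    rw [Finset.mem_filter, mem_jetGrid] at hx
    exact ⟨⟨jx a b hx.1, by simpa [jx] using hx.2⟩, by simp [jx]⟩

/-- The exponents, and the component, that belong to a coordinate on the jets of the contact
group. -/
def contactPos {k : ℕ} : ContactIndex 2 k → (ℕ × ℕ) ⊕ (Fin 2 × (ℕ × ℕ)) :=
  Sum.map (fun d => (d.1 0, d.1 1)) fun c => (c.1, (c.2.1.1 0, c.2.1.1 1))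

theorem contactPos_injective {k : ℕ} : Function.Injective (contactPos (k := k)) := by
  have key : ∀ d d' : JetIndex 2 k, d.1 0 = d'.1 0 → d.1 1 = d'.1 1 → d = d' := fun d d' h h' => by
    rw [← jx_eta d, ← jx_eta d']
    simp only [h, h']
  rintro (d | ⟨j, d, hd⟩) (d' | ⟨j', d', hd'⟩) hh
  · simp only [contactPos, Sum.map_inl, Sum.inl.injEq, Prod.mk.injEq] at hh
    rw [key d d' hh.1 hh.2]
  · simp [contactPos] at hh
  · simp [contactPos] at hh
  · simp only [contactPos, Sum.map_inr, Sum.inr.injEq, Prod.mk.injEq] at hh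
    obtain ⟨rfl, h, h'⟩ := hh
    obtain rfl := key d d' h h'
    rfl

/-- The values of `contactPos`. -/
def contactGrid (k : ℕ) : Finset ((ℕ × ℕ) ⊕ (Fin 2 × (ℕ × ℕ))) :=
  (jetGrid k).disjSum (Finset.univ ×ˢ (jetGrid k).erase (0, 0))

theorem card_contactIndex_subtype (k : ℕ) (P : (ℕ × ℕ) ⊕ (Fin 2 × (ℕ × ℕ)) → Prop)
    [DecidablePred P] :
    Nat.card {i : ContactIndex 2 k // P (contactPos i)} = ((contactGrid k).filter P).card := by
  rw [← Fintype.card_coe, ← Nat.card_eq_fintype_card]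
  refine Nat.card_congr (Equiv.ofBijective (fun i => ⟨contactPos i.1, ?_⟩) ⟨?_, ?_⟩)
  · rw [Finset.mem_filter]
    refine ⟨?_, i.2⟩
    obtain ⟨d | ⟨j, d, hd⟩, h⟩ := i
    · simpa [contactPos, contactGrid, mem_jetGrid, ← degree_eq_add] using d.2
    · have h0 : ¬(d.1 0 = 0 ∧ d.1 1 = 0) := fun h => hd (by rw [← ex_eta d.1, h.1, h.2, ex_zero_zero])
      simpa [contactPos, contactGrid, mem_jetGrid, ← degree_eq_add, h0] using d.2
  · rintro ⟨i, h⟩ ⟨i', h'⟩ hh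
    exact Subtype.ext (contactPos_injective (Subtype.ext_iff.mp hh))
  · rintro ⟨⟨a, b⟩ | ⟨j, a, b⟩, hx⟩
    · have h := hx
      simp only [contactGrid, Finset.mem_filter, Finset.inl_mem_disjSum, mem_jetGrid] at h
      exact ⟨⟨Sum.inl (jx a b h.1), by simpa [contactPos, jx] using h.2⟩, by simp [contactPos, jx]⟩
    · have h := hx
      simp only [contactGrid, Finset.mem_filter, Finset.inr_mem_disjSum, mem_jetGrid,
        Finset.mem_product, Finset.mem_univ, true_and, Finset.mem_erase] at h
      have h0 : ex a b ≠ 0 := fun h' => h.1.1 (by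
        rw [← ex_zero_zero, ex_inj] at h'
        rw [h'.1, h'.2])
      exact ⟨⟨Sum.inr (j, ⟨jx a b h.1.2, h0⟩), by simpa [contactPos, jx] using h.2⟩,
        by simp [contactPos, jx]⟩

end Exponents

/-! ### Determinacy of `x ^ 2 + y ^ 3` in characteristic 2 -/

section Determinacy

variable {K : Type*} [Field K]

theorem le_order_of_mem_maximalIdeal_pow {s n : ℕ} {f : PS s K}
    (hf : f ∈ IsLocalRing.maximalIdeal (PS s K) ^ n) : (n : ℕ∞) ≤ f.order := by
  induction n generalizing f with
  | zero => simp
  | succ n ih =>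
    rw [pow_succ] at hf
    induction hf using Submodule.mul_induction_on' with
    | mem_mul_mem a ha b hb =>
      refine le_order_mul_of_le (ih ha) (n := 1) ?_ le_rfl
      rw [Nat.cast_one, one_le_order_iff_constCoeff_eq_zero]
      exact mem_maximalIdeal_iff.mp hb
    | add a _ b _ ha hb => exact le_order_add ha hb

/-- The part of `f` divisible by `x ^ 2`, divided by `x ^ 2`. -/
def divXSq (f : PS 2 K) : PS 2 K := fun d => coeff (d + ex 2 0) f

/-- The part of `f` not divisible by `x ^ 2` but by `y ^ 2`, divided by `y ^ 2`. -/
def divYSq (f : PS 2 K) : PS 2 K := fun d => if d 0 < 2 then coeff (d + ex 0 2) f else 0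

theorem coeff_divXSq (f : PS 2 K) (d : Fin 2 →₀ ℕ) : coeff d (divXSq f) = coeff (d + ex 2 0) f := rfl

theorem coeff_divYSq (f : PS 2 K) (d : Fin 2 →₀ ℕ) :
    coeff d (divYSq f) = if d 0 < 2 then coeff (d + ex 0 2) f else 0 := rfl

theorem divXSq_sub (f g : PS 2 K) : divXSq f - divXSq g = divXSq (f - g) := by
  ext d
  simp [coeff_divXSq]

theorem divYSq_sub (f g : PS 2 K) : divYSq f - divYSq g = divYSq (f - g) := by
  ext d
  simp only [coeff_divYSq, map_sub]
  split_ifs <;> simp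

theorem le_order_divXSq {f : PS 2 K} {n : ℕ} (h : ((n + 2 : ℕ) : ℕ∞) ≤ f.order) :
    (n : ℕ∞) ≤ (divXSq f).order := by
  refine MvPowerSeries.le_order fun d hd => ?_
  rw [coeff_divXSq]
  refine coeff_of_lt_order (lt_of_lt_of_le ?_ h)
  rw [map_add, degree_ex]
  norm_cast at hd ⊢
  omega

theorem le_order_divYSq {f : PS 2 K} {n : ℕ} (h : ((n + 2 : ℕ) : ℕ∞) ≤ f.order) :
    (n : ℕ∞) ≤ (divYSq f).order := by
  refine MvPowerSeries.le_order fun d hd => ?_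
  rw [coeff_divYSq]
  split_ifs
  · refine coeff_of_lt_order (lt_of_lt_of_le ?_ h)
    rw [map_add, degree_ex]
    norm_cast at hd ⊢
    omega
  · rfl

theorem eq_divXSq_add_divYSq {f : PS 2 K} (h : ((3 : ℕ) : ℕ∞) ≤ f.order) :
    f = X 0 ^ 2 * divXSq f + X 1 ^ 2 * divYSq f := by
  classical
  have hx : (X 0 ^ 2 : PS 2 K) = monomial (ex 2 0) 1 := by simpa using X_pow_mul_X_pow (A := K) 2 0
  have hy : (X 1 ^ 2 : PS 2 K) = monomial (ex 0 2) 1 := by simpa using X_pow_mul_X_pow (A := K) 0 2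
  ext d
  rw [map_add, hx, hy, coeff_monomial_one_mul, coeff_monomial_one_mul, coeff_divXSq, coeff_divYSq]
  simp only [le_iff_ex, ex_zero, ex_one, Nat.zero_le, true_and, and_true, Finsupp.tsub_apply,
    Nat.sub_zero]
  by_cases h1 : 2 ≤ d 0
  · rw [if_pos h1, if_neg (not_lt.mpr h1), ite_self, add_zero, tsub_add_cancel_of_le]
    rw [le_iff_ex]
    simpa using h1
  · rw [if_neg h1, if_pos (not_le.mp h1), zero_add]
    split_ifs with h2
    · rw [tsub_add_cancel_of_le]
      rw [le_iff_ex]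
      simpa using h2
    · refine coeff_of_lt_order (lt_of_lt_of_le ?_ h)
      rw [degree_eq_add]
      norm_cast
      omega

/-- Solving `(1 + v) * (x ^ 2 + (y + w) ^ 3) = g` for `g` close to `f = x ^ 2 + y ^ 3` amounts, in
characteristic 2, to a fixed point problem for `(v, w)`: the terms linear in `w` are `y ^ 2 w`, and
every series of order at least 3 is a combination of `x ^ 2` and `y ^ 2`. -/
theorem isDetermined_four_of_charTwo [CharP K 2] :
    IsDetermined (ContactGroup 2 K) 4 (powerSum K ![2, 3]) := by
  intro g hg
  have hh := le_order_of_mem_maximalIdeal_pow hg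
  set h := g - powerSum K ![2, 3] with hdef
  let H : (Fin 2 → PS 2 K) → PS 2 K := fun z => h - (1 + z 0) * (X 1 * z 1 ^ 2 + z 1 ^ 3)
  let T : (Fin 2 → PS 2 K) → (Fin 2 → PS 2 K) := fun z =>
    ![divXSq (H z), divYSq (H z) - X 1 * z 0 - z 0 * z 1]
  have h2 : (2 : PS 2 K) = 0 := by exact_mod_cast natCast_eq_zero_of_charP (s := 2) (K := K) 2
  have hX := one_le_order_X (A := K) (1 : Fin 2)
  have hzero : ∀ a : PS 2 K, ((0 : ℕ) : ℕ∞) ≤ a.order := fun a => by simp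
  have hH : ∀ z, (∀ i, ((2 : ℕ) : ℕ∞) ≤ (z i).order) → ((5 : ℕ) : ℕ∞) ≤ (H z).order := by
    intro z hz
    refine le_order_sub hh (le_order_mul_of_le (hzero _) (n := 5) ?_ le_rfl)
    have hsq : ((4 : ℕ) : ℕ∞) ≤ (z 1 ^ 2).order := by
      rw [sq]
      exact le_order_mul_of_le (hz 1) (hz 1) le_rfl
    refine le_order_add (le_order_mul_of_le hX hsq le_rfl) ?_
    rw [pow_succ]
    exact le_order_mul_of_le hsq (hz 1) (by norm_num)
  obtain ⟨z, hz, hTz⟩ := exists_fixedPoint_of_order_contracting 2 T (fun z hz => by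
    have h5 := hH z hz
    rw [Fin.forall_fin_two]
    refine ⟨le_order_divXSq ((Nat.cast_le.mpr (by norm_num)).trans h5),
      le_order_sub (le_order_sub (le_order_divYSq ((Nat.cast_le.mpr (by norm_num)).trans h5)) ?_) ?_⟩
    · exact le_order_mul_of_le hX (hz 0) (by norm_num)
    · exact le_order_mul_of_le (hz 0) (hz 1) (by norm_num)) (fun n hn z z' hz hz' hzz => by
    have h0 := hzz 0
    have h1 := hzz 1
    have hsq : ((n + 2 : ℕ) : ℕ∞) ≤ (z 1 ^ 2 - z' 1 ^ 2).order := by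
      rw [show z 1 ^ 2 - z' 1 ^ 2 = (z 1 - z' 1) * (z 1 + z' 1) by ring]
      exact le_order_mul_of_le h1 (le_order_add (hz 1) (hz' 1)) le_rfl
    have hHH : ((n + 1 + 2 : ℕ) : ℕ∞) ≤ (H z - H z').order := by
      have h4 : ((2 : ℕ) : ℕ∞) ≤ (X 1 * z 1 ^ 2 + z 1 ^ 3).order := by
        rw [show (X 1 : PS 2 K) * z 1 ^ 2 + z 1 ^ 3 = z 1 * (X 1 * z 1 + z 1 ^ 2) by ring]
        exact le_order_mul_of_le (hz 1) (hzero _) le_rfl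
      have e : H z - H z' = -((z 0 - z' 0) * z 1 * (z 1 * (X 1 + z 1))) -
          (1 + z' 0) * (X 1 * (z 1 ^ 2 - z' 1 ^ 2) +
            (z 1 * (z 1 ^ 2 - z' 1 ^ 2) + (z 1 - z' 1) * (z' 1 * z' 1))) := by
        simp only [H]
        ring
      rw [e]
      refine le_order_sub ?_ (le_order_mul_of_le (hzero _) (n := n + 3) ?_ (by omega))
      · rw [order_neg]
        exact le_order_mul_of_le (le_order_mul_of_le h0 (hz 1) (k := n + 2) le_rfl)
          (le_order_mul_of_le (hz 1) (hzero _) (k := 2) le_rfl) (by omega)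
      · refine le_order_add (le_order_mul_of_le hX hsq (by omega)) (le_order_add ?_ ?_)
        · exact le_order_mul_of_le (hz 1) hsq (by omega)
        · exact le_order_mul_of_le h1 (le_order_mul_of_le (hz' 1) (hz' 1) (k := 4) le_rfl) (by omega)
    rw [Fin.forall_fin_two]
    constructor
    · change _ ≤ (divXSq (H z) - divXSq (H z')).order
      rw [divXSq_sub]
      exact le_order_divXSq hHH
    · change _ ≤ (divYSq (H z) - X 1 * z 0 - z 0 * z 1 -
        (divYSq (H z') - X 1 * z' 0 - z' 0 * z' 1)).order
      rw [show divYSq (H z) - X 1 * z 0 - z 0 * z 1 - (divYSq (H z') - X 1 * z' 0 - z' 0 * z' 1) =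
        (divYSq (H z) - divYSq (H z')) - X 1 * (z 0 - z' 0) -
          ((z 0 - z' 0) * z 1 + (z 1 - z' 1) * z' 0) by ring, divYSq_sub]
      refine le_order_sub (le_order_sub (le_order_divYSq hHH) ?_) (le_order_add ?_ ?_)
      · exact le_order_mul_of_le hX h0 (by omega)
      · exact le_order_mul_of_le h0 (hz 1) (by omega)
      · exact le_order_mul_of_le h1 (hz' 0) (by omega))
  have hz0 : divXSq (H z) = z 0 := congrFun hTz 0
  have hz1 : divYSq (H z) - X 1 * z 0 - z 0 * z 1 = z 1 := congrFun hTz 1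
  have hdec := eq_divXSq_add_divYSq ((Nat.cast_le.mpr (by norm_num)).trans (hH z hz))
  have hconst : ∀ i, constantCoeff (z i) = 0 := fun i => by
    rw [← one_le_order_iff_constCoeff_eq_zero]
    exact le_trans (by norm_num) (hz i)
  have hlin : ∀ i j, coeff (Finsupp.single j 1) (z i) = 0 := fun i j => by
    refine coeff_of_lt_order (lt_of_lt_of_le ?_ (hz i))
    rw [Finsupp.degree_single]
    norm_num
  obtain ⟨φ, hφ⟩ := exists_algEquiv_of_linearPart (![X 0, X 1 + z 1] : Fin 2 → PS 2 K)
    (by rw [Fin.forall_fin_two]; simp [hconst]) (by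
      rw [Matrix.det_fin_two]
      simp [hlin, coeff_X, Finsupp.single_left_inj])
  have hu : IsUnit (1 + z 0) := by
    rw [isUnit_iff_constantCoeff]
    simp [hconst]
  refine ⟨⟨hu.unit, φ⟩, ?_⟩
  change (1 + z 0) * φ (powerSum K ![2, 3]) = g
  have hg' : g = powerSum K ![2, 3] + h := by rw [hdef]; ring
  have hH' : h = H z + (1 + z 0) * (X 1 * z 1 ^ 2 + z 1 ^ 3) := by simp only [H]; ring
  have hy : divYSq (H z) = z 1 + X 1 * z 0 + z 0 * z 1 := by linear_combination hz1
  rw [hz0, hy] at hdec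
  rw [hg', hH', hdec]
  simp only [powerSum, Fin.sum_univ_two, map_add, map_pow, hφ]
  simp only [Matrix.cons_val_zero, Matrix.cons_val_one]
  linear_combination ((1 + z 0) * (X 1 ^ 2 * z 1 + X 1 * z 1 ^ 2)) * h2

end Determinacy

end TangentImage
end

noncomputable section

namespace TangentImage

open MvPowerSeries

/-! ### The series `x ^ p + y ^ (p + 1)` in characteristic `p` -/

section Coordinates

variable {k : ℕ} {R : Type*} [CommRing R]

open Classical in
/-- The coordinates of a point of the jet space of the contact group, as a function of exponents and
components, extended by zero. -/
def posVal (v : ContactIndex 2 k → R) (x : (ℕ × ℕ) ⊕ (Fin 2 × (ℕ × ℕ))) : R :=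
  if h : ∃ i, contactPos i = x then v h.choose else 0

theorem posVal_contactPos (v : ContactIndex 2 k → R) (i : ContactIndex 2 k) :
    posVal v (contactPos i) = v i := by
  have h : ∃ j, contactPos j = contactPos i := ⟨i, rfl⟩
  rw [posVal, dif_pos h, contactPos_injective h.choose_spec]

theorem contactPos_mem_contactGrid (i : ContactIndex 2 k) : contactPos i ∈ contactGrid k := by
  obtain d | ⟨j, d, hd⟩ := i
  · simpa [contactPos, contactGrid, mem_jetGrid, ← degree_eq_add] using d.2
  · have h0 : ¬(d.1 0 = 0 ∧ d.1 1 = 0) := fun h => hd (by rw [← ex_eta d.1, h.1, h.2, ex_zero_zero])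
    simpa [contactPos, contactGrid, mem_jetGrid, ← degree_eq_add, h0] using d.2

theorem exists_contactPos_eq {x : (ℕ × ℕ) ⊕ (Fin 2 × (ℕ × ℕ))} (hx : x ∈ contactGrid k) :
    ∃ i : ContactIndex 2 k, contactPos i = x := by
  obtain ⟨a, b⟩ | ⟨j, a, b⟩ := x
  · simp only [contactGrid, Finset.inl_mem_disjSum, mem_jetGrid] at hx
    exact ⟨Sum.inl (jx a b hx), by simp [contactPos, jx]⟩
  · simp only [contactGrid, Finset.inr_mem_disjSum, mem_jetGrid,
      Finset.mem_product, Finset.mem_univ, true_and, Finset.mem_erase] at hx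
    have h0 : ex a b ≠ 0 := fun h' => hx.1 (by
      rw [← ex_zero_zero, ex_inj] at h'
      rw [h'.1, h'.2])
    exact ⟨Sum.inr (j, ⟨jx a b hx.2, h0⟩), by simp [contactPos, jx]⟩

theorem posVal_comp (W : (ℕ × ℕ) ⊕ (Fin 2 × (ℕ × ℕ)) → R) {x : (ℕ × ℕ) ⊕ (Fin 2 × (ℕ × ℕ))}
    (hx : x ∈ contactGrid k) : posVal (fun i : ContactIndex 2 k => W (contactPos i)) x = W x := by
  obtain ⟨i, rfl⟩ := exists_contactPos_eq hx
  exact posVal_contactPos _ i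

theorem posVal_eq_zero (v : ContactIndex 2 k → R) {x : (ℕ × ℕ) ⊕ (Fin 2 × (ℕ × ℕ))}
    (hx : x ∉ contactGrid k) : posVal v x = 0 := by
  rw [posVal, dif_neg]
  rintro ⟨i, rfl⟩
  exact hx (contactPos_mem_contactGrid i)

theorem coeff_seriesOfJet_inl (v : ContactIndex 2 k → R) (a b : ℕ) :
    coeff (ex a b) (seriesOfJet fun d => v (Sum.inl d)) = posVal v (Sum.inl (a, b)) := by
  by_cases h : a + b ≤ k
  · rw [← posVal_comp (fun x => posVal v x) (by simpa [contactGrid, mem_jetGrid] using h)]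
    have h1 := coeff_seriesOfJet (fun d => v (Sum.inl d)) (jx a b h)
    change coeff (ex a b) _ = _ at h1
    rw [h1, ← posVal_contactPos v, posVal_comp _ (by simpa [contactGrid, mem_jetGrid] using h)]
    simp [contactPos, jx]
  · rw [posVal_eq_zero v (by simpa [contactGrid, mem_jetGrid] using h), seriesOfJet, map_sum]
    refine Finset.sum_eq_zero fun e _ => coeff_monomial_ne ?_ _
    intro he
    have := e.2
    rw [← he, degree_ex] at this
    exact h this

theorem coeff_tupleOfJet_inr (v : ContactIndex 2 k → R) (i : Fin 2) (a b : ℕ) :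
    coeff (ex a b) (tupleOfJet (fun d => v (Sum.inr d)) i) = posVal v (Sum.inr (i, (a, b))) := by
  by_cases h : a + b ≤ k ∧ ex a b ≠ 0
  · have h1 := coeff_tupleOfJet (fun d => v (Sum.inr d)) i ⟨jx a b h.1, h.2⟩
    change coeff (ex a b) _ = _ at h1
    rw [h1, ← posVal_contactPos v]
    simp [contactPos, jx]
  · rw [posVal_eq_zero v, tupleOfJet, map_sum]
    · refine Finset.sum_eq_zero fun e _ => coeff_monomial_ne ?_ _
      intro he
      have h1 := e.1.2
      have h2 := e.2
      rw [← he] at h1 h2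
      rw [degree_ex] at h1
      exact h ⟨h1, h2⟩
    · intro hx
      simp only [contactGrid, Finset.inr_mem_disjSum, mem_jetGrid,
        Finset.mem_product, Finset.mem_univ, true_and, Finset.mem_erase] at hx
      refine h ⟨hx.2, fun h' => hx.1 ?_⟩
      rw [← ex_zero_zero, ex_inj] at h'
      rw [h'.1, h'.2]

end Coordinates

section Ideal

variable {K : Type*} [Field K]

/-- The minimal generators of the tangent image of `x ^ p + y ^ (p + 1)` in characteristic `p`. -/
def frobeniusExponents (p : ℕ) : Finset (Fin 2 →₀ ℕ) := {ex p 0, ex 1 p, ex 0 (p + 1)}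

theorem span_monomial_triple (a b c d e f : ℕ) :
    Ideal.span ((fun m => monomial m (1 : K)) ''
      (({ex a b, ex c d, ex e f} : Finset (Fin 2 →₀ ℕ)) : Set (Fin 2 →₀ ℕ))) =
      Ideal.span {(X 0 ^ a * X 1 ^ b : PS 2 K), X 0 ^ c * X 1 ^ d, X 0 ^ e * X 1 ^ f} := by
  simp only [X_pow_mul_X_pow, Finset.coe_insert, Finset.coe_singleton, Set.image_insert_eq,
    Set.image_singleton]

variable (p : ℕ) [CharP K p]

theorem contactTangentImage_frobenius :
    contactTangentImage (powerSum K ![p, p + 1]) =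
      Ideal.span ((fun m => monomial m (1 : K)) '' (frobeniusExponents p : Set (Fin 2 →₀ ℕ))) := by
  have hp0 : (p : PS 2 K) = 0 := natCast_eq_zero_of_charP p
  have hmem : ∀ g, g ∈ contactTangentImage (powerSum K ![p, p + 1]) ↔ ∃ a b : PS 2 K,
      constantCoeff b = 0 ∧ g = a * (X 0 ^ p + X 1 ^ (p + 1)) + X 1 ^ p * b := by
    intro g
    rw [mem_contactTangentImage_powerSum]
    constructor
    · rintro ⟨a, b, hb, rfl⟩
      refine ⟨a, b 1, hb 1, ?_⟩
      simp [powerSum, hp0]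
    · rintro ⟨a, b, hb, rfl⟩
      refine ⟨a, fun _ => b, fun _ => hb, ?_⟩
      simp [powerSum, hp0]
  rw [frobeniusExponents, span_monomial_triple]
  simp only [pow_zero, pow_one, mul_one, one_mul]
  refine le_antisymm (fun g hg => ?_) ?_
  · obtain ⟨a, b, hb, rfl⟩ := (hmem g).mp hg
    obtain ⟨c, rfl, -⟩ := exists_eq_sum_X_mul (n := 0) (f := b)
      (by rwa [zero_add, Nat.cast_one, one_le_order_iff_constCoeff_eq_zero])
    rw [Fin.sum_univ_two, show a * (X 0 ^ p + X 1 ^ (p + 1)) + X 1 ^ p * (X 0 * c 0 + X 1 * c 1) =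
      a * X 0 ^ p + c 0 * (X 0 * X 1 ^ p) + (a + c 1) * X 1 ^ (p + 1) by ring]
    refine Ideal.add_mem _ (Ideal.add_mem _ ?_ ?_) ?_ <;>
      exact Ideal.mul_mem_left _ _ (Ideal.subset_span (by simp))
  · rw [Ideal.span_le]
    rintro g (rfl | rfl | rfl)
    · exact (hmem _).mpr ⟨1, -X 1, by simp, by ring⟩
    · exact (hmem _).mpr ⟨0, X 0, by simp, by ring⟩
    · exact (hmem _).mpr ⟨0, X 1, by simp, by ring⟩

theorem contactJetTangentImage_frobenius (k : ℕ) :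
    contactJetTangentImage k (powerSum K ![p, p + 1]) =
      coordinateSubmodule K {d : JetIndex 2 k | ∀ m ∈ frobeniusExponents p, ¬ m ≤ d.1} :=
  contactJetTangentImage_eq_coordinateSubmodule _ _ (contactTangentImage_frobenius p)

theorem mem_frobenius_bad (d : Fin 2 →₀ ℕ) : (∀ m ∈ frobeniusExponents p, ¬ m ≤ d) ↔
    d 0 < p ∧ (d 0 < 1 ∨ d 1 < p) ∧ d 1 < p + 1 := by
  simp only [frobeniusExponents, Finset.mem_insert, Finset.mem_singleton, forall_eq_or_imp,
    forall_eq, le_iff_ex, ex_zero, ex_one]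
  omega

theorem finrank_contactJetTangentImage_frobenius (k : ℕ) :
    Module.finrank K (contactJetTangentImage k (powerSum K ![p, p + 1])) =
      ((jetGrid k).filter fun x : ℕ × ℕ =>
        ¬ (x.1 < p ∧ (x.1 < 1 ∨ x.2 < p) ∧ x.2 < p + 1)).card := by
  rw [contactJetTangentImage_frobenius, finrank_coordinateSubmodule, ← card_jetIndex_subtype]
  refine Nat.card_congr (Equiv.subtypeEquivRight fun d => ?_)
  rw [Set.mem_ofPred_eq, mem_frobenius_bad]

theorem X_pow_notMem_contactTangentImage (hp : 0 < p) :
    X 1 ^ p ∉ contactTangentImage (powerSum K ![p, p + 1]) := by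
  rw [contactTangentImage_frobenius, mem_span_monomial_iff]
  intro h
  have := h (Finsupp.single 1 p) ((mem_frobenius_bad p _).mpr (by simp [hp]))
  simp [coeff_X_pow] at this

theorem jet_X_pow_notMem_contactJetTangentImage (hp : 0 < p) {k : ℕ} (hk : p ≤ k) :
    jet k (X 1 ^ p) ∉ contactJetTangentImage k (powerSum K ![p, p + 1]) := by
  rw [contactJetTangentImage_frobenius, mem_coordinateSubmodule]
  intro h
  have := h ⟨Finsupp.single 1 p, by simpa using hk⟩ ((mem_frobenius_bad p _).mpr (by simp [hp]))
  simp [jet, coeff_X_pow] at this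

variable {K' : Type*} [Field K'] [Algebra K K'] [IsAlgClosed K']

/-- The substitution `x ↦ x + μ y` turns `x ^ p + y ^ (p + 1)` into
`x ^ p + μ ^ p y ^ p + y ^ (p + 1)`. -/
theorem infinite_contactOrbit_line [Fact p.Prime] :
    {t : K' | map (algebraMap K K') (powerSum K ![p, p + 1]) +
        C t * map (algebraMap K K') (X 1 ^ p) ∈
      MulAction.orbit (ContactGroup 2 K')
        (map (algebraMap K K') (powerSum K ![p, p + 1]))}.Infinite := by
  have : CharP K' p := charP_of_injective_algebraMap (algebraMap K K').injective p
  have : CharP (PS 2 K') p :=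
    charP_of_injective_ringHom (f := (C : K' →+* PS 2 K')) (MvPowerSeries.C_injective) p
  refine Set.infinite_univ.mono fun t _ => ?_
  obtain ⟨μ, hμ⟩ := IsAlgClosed.exists_pow_nat_eq t (Fact.out : p.Prime).pos
  obtain ⟨φ, hφ⟩ := exists_algEquiv_of_linearPart (![X 0 + C μ * X 1, X 1] : Fin 2 → PS 2 K')
    (by rw [Fin.forall_fin_two]; simp) (by
      rw [Matrix.det_fin_two]
      simp [coeff_X, Finsupp.single_left_inj])
  refine ⟨⟨1, φ⟩, ?_⟩
  simp only [map_powerSum, map_pow, map_X]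
  change ((1 : (PS 2 K')ˣ) : PS 2 K') * φ (powerSum K' _) = _
  simp only [powerSum, Fin.sum_univ_two, map_add, map_pow, hφ, Units.val_one, one_mul]
  simp only [Matrix.cons_val_zero, Matrix.cons_val_one, add_pow_char, mul_pow, ← map_pow, hμ]
  ring

theorem contactJetTangentImage_lt [Fact p.Prime] {k : ℕ} (hk : p ≤ k) :
    contactJetTangentImage k (powerSum K ![p, p + 1]) <
      jetTangentSpace (K' := K') (ContactGroup 2 K') k (powerSum K ![p, p + 1]) := by
  refine lt_of_le_of_ne (contactJetTangentImage_le_jetTangentSpace _) fun h => ?_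
  refine jet_X_pow_notMem_contactJetTangentImage (K := K) p (Fact.out : p.Prime).pos hk ?_
  rw [h]
  exact jet_mem_jetTangentSpace_of_infinite k _ _ (infinite_contactOrbit_line p)

theorem contactTangentImage_lt [Fact p.Prime] :
    (contactTangentImage (powerSum K ![p, p + 1])).restrictScalars K <
      tangentSpace (K' := K') (ContactGroup 2 K') (powerSum K ![p, p + 1]) := by
  refine lt_of_le_of_ne (contactTangentImage_le_tangentSpace _) fun h => ?_
  refine X_pow_notMem_contactTangentImage (K := K) p (Fact.out : p.Prime).pos ?_
  rw [← Submodule.restrictScalars_mem K, h]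
  exact mem_tangentSpace_of_infinite _ _ (infinite_contactOrbit_line p)

end Ideal

end TangentImage
end

noncomputable section

namespace TangentImage

open MvPowerSeries

/-! ### The generic rank of the orbit map of `x ^ p + y ^ (p + 1)` -/

section Rank

/-- The coordinates of degree at most 2 of the unit and of the image of `y`. -/
def lowPos : (ℕ × ℕ) ⊕ (Fin 2 × (ℕ × ℕ)) → Bool
  | Sum.inl x => x.1 + x.2 ≤ 2
  | Sum.inr c => c.1 = 1 ∧ c.2.1 + c.2.2 ≤ 2

variable {K : Type*} [Field K] {k : ℕ} (p : ℕ) [CharP K p]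

theorem contactTangent_frobenius (c w : ContactIndex 2 k → K) :
    contactTangent ![p, p + 1] c w =
      (seriesOfJet fun d => c (Sum.inl d)) * (tupleOfJet (fun d => c (Sum.inr d)) 1 ^ p *
        tupleOfJet (fun d => w (Sum.inr d)) 1) +
      (seriesOfJet fun d => w (Sum.inl d)) * (tupleOfJet (fun d => c (Sum.inr d)) 0 ^ p +
        tupleOfJet (fun d => c (Sum.inr d)) 1 ^ (p + 1)) := by
  have hp0 : (p : PS 2 K) = 0 := natCast_eq_zero_of_charP p
  simp [contactTangent, rightValue, Fin.sum_univ_two, hp0]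

theorem le_order_tupleOfJet_pow (c : RightIndex 2 k → K) (i : Fin 2) (n : ℕ) :
    (n : ℕ∞) ≤ (tupleOfJet c i ^ n).order := by
  induction n with
  | zero => simp
  | succ n ih =>
    rw [pow_succ]
    refine le_order_mul_of_le ih (n := 1) ?_ le_rfl
    rw [Nat.cast_one, one_le_order_iff_constCoeff_eq_zero]
    simp

theorem le_order_of_coeff_ex {n : ℕ} {P : PS 2 K}
    (h : ∀ a b, a + b < n → coeff (ex a b) P = 0) : (n : ℕ∞) ≤ P.order := by
  refine MvPowerSeries.le_order fun d hd => ?_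
  rw [← ex_eta d]
  refine h _ _ ?_
  rw [← degree_eq_add]
  exact_mod_cast hd

/-- The derivative of the orbit map kills the directions that change only high order terms. -/
theorem coeff_contactTangent_eq_zero_of_lowPos (hk : k ≤ p + 2) (c w : ContactIndex 2 k → K)
    (hw : ∀ i, lowPos (contactPos i) = true → w i = 0) (d : JetIndex 2 k) :
    coeff d.1 (contactTangent ![p, p + 1] c w) = 0 := by
  have hw' : ∀ x, lowPos x = true → posVal w x = 0 := by
    intro x hx
    by_cases h : x ∈ contactGrid k
    · obtain ⟨i, rfl⟩ := exists_contactPos_eq h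
      rw [posVal_contactPos, hw i hx]
    · exact posVal_eq_zero w h
  have h1 : ((3 : ℕ) : ℕ∞) ≤ (seriesOfJet fun d => w (Sum.inl d)).order := by
    refine le_order_of_coeff_ex fun a b hab => ?_
    rw [coeff_seriesOfJet_inl]
    exact hw' _ (decide_eq_true (Nat.le_of_lt_succ hab))
  have h2 : ((3 : ℕ) : ℕ∞) ≤ (tupleOfJet (fun d => w (Sum.inr d)) 1).order := by
    refine le_order_of_coeff_ex fun a b hab => ?_
    rw [coeff_tupleOfJet_inr]
    exact hw' _ (decide_eq_true ⟨rfl, Nat.le_of_lt_succ hab⟩)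
  have h0 : ∀ P : PS 2 K, ((0 : ℕ) : ℕ∞) ≤ P.order := fun P => by simp
  rw [contactTangent_frobenius]
  have h3 := le_order_add
    (le_order_mul_of_le (h0 (seriesOfJet fun d => c (Sum.inl d)))
      (le_order_mul_of_le (le_order_tupleOfJet_pow (fun d => c (Sum.inr d)) 1 p) h2 le_rfl)
      (k := p + 3) (by omega))
    (le_order_mul_of_le h1 (le_order_add (le_order_tupleOfJet_pow (fun d => c (Sum.inr d)) 0 p)
      ((Nat.cast_le.mpr (Nat.le_succ p)).trans
        (le_order_tupleOfJet_pow (fun d => c (Sum.inr d)) 1 (p + 1)))) (k := p + 3) (by omega))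
  refine coeff_of_lt_order (lt_of_lt_of_le ?_ h3)
  exact_mod_cast lt_of_le_of_lt (d.2.trans hk) (by omega)

/-- The syzygy between the two terms of the derivative `(v, w) ↦ v (a ^ p + b ^ (p + 1)) + u b ^ p w`
of the orbit map. -/
def syzygyVector (c : ContactIndex 2 k → K) : ContactIndex 2 k → K :=
  Sum.elim
    (jet k ((seriesOfJet fun d => c (Sum.inl d)) * tupleOfJet (fun d => c (Sum.inr d)) 1 ^ p))
    fun e => coeff e.2.1.1 ((fun i : Fin 2 => if i = 1 then
      -(tupleOfJet (fun d => c (Sum.inr d)) 0 ^ p +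
        tupleOfJet (fun d => c (Sum.inr d)) 1 ^ (p + 1)) else 0) e.1)

theorem coeff_contactTangent_syzygyVector (hp : p ≠ 0) (c : ContactIndex 2 k → K)
    (d : JetIndex 2 k) : coeff d.1 (contactTangent ![p, p + 1] c (syzygyVector p c)) = 0 := by
  set U := seriesOfJet fun d => c (Sum.inl d)
  set A := tupleOfJet (fun d => c (Sum.inr d)) 0
  set B := tupleOfJet (fun d => c (Sum.inr d)) 1
  have h1 := le_order_seriesOfJet_jet_sub k (U * B ^ p)
  have h2 := le_order_tupleOfJet_sub k
    (fun i : Fin 2 => if i = 1 then -(A ^ p + B ^ (p + 1)) else 0)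
    (by rw [Fin.forall_fin_two]; simp [A, B, hp]) 1
  rw [if_pos rfl] at h2
  have h0 : ∀ f : PS 2 K, ((k + 1 : ℕ) : ℕ∞) ≤ (f - f).order := fun f => by simp
  have h3 := le_order_add (le_order_mul_sub_mul (h0 U) (le_order_mul_sub_mul (h0 (B ^ p)) h2))
    (le_order_mul_sub_mul h1 (h0 (A ^ p + B ^ (p + 1))))
  rw [contactTangent_frobenius]
  have h4 : U * (B ^ p * -(A ^ p + B ^ (p + 1))) + U * B ^ p * (A ^ p + B ^ (p + 1)) = 0 := by ring
  rw [← add_sub_add_comm, h4, sub_zero] at h3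
  refine coeff_of_lt_order (lt_of_lt_of_le ?_ h3)
  exact_mod_cast Nat.lt_succ_of_le d.2

variable {K' : Type*} [Field K'] [Algebra K K']

/-- The generic point of the jet space of the contact group. -/
def genericPoint (k : ℕ) (K' : Type*) [Field K'] :
    ContactIndex 2 k → FractionRing (MvPolynomial (ContactIndex 2 k) K') :=
  fun i => algebraMap _ _ (MvPolynomial.X i : MvPolynomial (ContactIndex 2 k) K')

theorem sum_pderiv_contactOrbitMap (n : Fin 2 → ℕ)
    (w : ContactIndex 2 k → FractionRing (MvPolynomial (ContactIndex 2 k) K')) (d : JetIndex 2 k) :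
    ∑ i, algebraMap _ (FractionRing (MvPolynomial (ContactIndex 2 k) K'))
      (MvPolynomial.pderiv i (MvPolynomial.map (algebraMap K K')
        (contactOrbitMap k (powerSum K n) d))) * w i =
      coeff d.1 (contactTangent n (genericPoint k K') w) := by
  rw [map_contactOrbitMap, contactOrbitMap_powerSum]
  exact congrArg (coeff d.1) (directional_contactValue n
    (algebraMap _ (FractionRing (MvPolynomial (ContactIndex 2 k) K'))) w)

theorem card_add_card_le_of_isSeparableMap (hk : k ≤ p + 2)
    (h : IsSeparableMap K' (contactOrbitMap k (powerSum K ![p, p + 1])))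
    {J : Type} [Fintype J] (j : J → JetIndex 2 k)
    (hj : AlgebraicIndependent K' fun i => contactOrbitMap k (powerSum K' ![p, p + 1]) (j i)) :
    Fintype.card J + ((contactGrid k).filter fun x => ¬ lowPos x = true).card ≤
      (contactGrid k).card := by
  have : CharP K' p := charP_of_injective_algebraMap (algebraMap K K').injective p
  let E := FractionRing (MvPolynomial (ContactIndex 2 k) K')
  have : CharP E p := charP_of_injective_algebraMap (algebraMap K' E).injective p
  have hj' := hj
  rw [show (fun i => contactOrbitMap k (powerSum K' ![p, p + 1]) (j i)) = fun i =>
    MvPolynomial.map (algebraMap K K') (contactOrbitMap k (powerSum K ![p, p + 1]) (j i)) from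
      funext fun i => (map_contactOrbitMap _ _).symm] at hj'
  have h1 := h.card_add_finrank_le j hj'
    (coordinateSubmodule E {i | lowPos (contactPos i) = true}) (by
      intro w hw d
      rw [sum_pderiv_contactOrbitMap]
      exact coeff_contactTangent_eq_zero_of_lowPos p hk _ _ (mem_coordinateSubmodule.mp hw) d)
  rw [finrank_coordinateSubmodule] at h1
  have h2 := card_contactIndex_subtype k (fun x => ¬ lowPos x = true)
  have h3 := card_contactIndex_subtype k (fun _ => True)
  rw [Finset.filter_true, Nat.card_congr (Equiv.subtypeUnivEquiv fun _ => trivial),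
    Nat.card_eq_fintype_card] at h3
  rw [← h2, ← h3]
  exact h1

/-- In characteristic 2 the syzygy improves the bound on the generic rank by one. -/
theorem card_add_card_lt_of_isSeparableMap [CharP K 2] (hk : k ≤ 4) (hk2 : 2 ≤ k)
    (h : IsSeparableMap K' (contactOrbitMap k (powerSum K ![2, 3])))
    {J : Type} [Fintype J] (j : J → JetIndex 2 k)
    (hj : AlgebraicIndependent K' fun i => contactOrbitMap k (powerSum K' ![2, 3]) (j i)) :
    Fintype.card J + ((contactGrid k).filter fun x => ¬ lowPos x = true).card <
      (contactGrid k).card := by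
  have : CharP K' 2 := charP_of_injective_algebraMap (algebraMap K K').injective 2
  have : Fact (Nat.Prime 2) := ⟨Nat.prime_two⟩
  let E := FractionRing (MvPolynomial (ContactIndex 2 k) K')
  have : CharP E 2 := charP_of_injective_algebraMap (algebraMap K' E).injective 2
  have hj' := hj
  rw [show (fun i => contactOrbitMap k (powerSum K' ![2, 3]) (j i)) = fun i =>
    MvPolynomial.map (algebraMap K K') (contactOrbitMap k (powerSum K ![2, 3]) (j i)) from
      funext fun i => (map_contactOrbitMap _ _).symm] at hj'
  set N := coordinateSubmodule E {i : ContactIndex 2 k | lowPos (contactPos i) = true} with hN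
  set v := syzygyVector 2 (genericPoint k K')
  have hv : v ∉ N := by
    intro hv
    rw [hN, mem_coordinateSubmodule] at hv
    have h1 := hv (Sum.inl (jx 2 0 hk2)) (by simp [contactPos, jx, lowPos])
    have h2 : v (Sum.inl (jx 2 0 hk2)) = posVal (genericPoint k K') (Sum.inl (0, 0)) *
        posVal (genericPoint k K') (Sum.inr (1, (1, 0))) ^ 2 := by
      change coeff (ex 2 0) (_ * _ : PS 2 E) = _
      rw [coeff_ex_mul]
      simp only [coeff_ex_pow_char, coeff_seriesOfJet_inl, coeff_tupleOfJet_inr]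
      have h0 : posVal (genericPoint k K') (Sum.inr (1, (0, 0))) = 0 :=
        posVal_eq_zero _ (by simp [contactGrid])
      simp [Finset.sum_range_succ, h0]
    have h3 : ∀ x ∈ contactGrid k, posVal (genericPoint k K') x ≠ 0 := fun x hx => by
      obtain ⟨i, rfl⟩ := exists_contactPos_eq hx
      rw [posVal_contactPos, genericPoint, Ne, FaithfulSMul.algebraMap_eq_zero_iff]
      exact MvPolynomial.X_ne_zero i
    rw [h2] at h1
    refine mul_ne_zero (h3 _ ?_) (pow_ne_zero 2 (h3 _ ?_)) h1
    · simp [contactGrid, mem_jetGrid]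
    · simp only [contactGrid, Finset.inr_mem_disjSum, mem_jetGrid, Finset.mem_product,
        Finset.mem_univ, true_and, Finset.mem_erase]
      exact ⟨by simp, by omega⟩
  have h1 := h.card_add_finrank_le j hj' (N ⊔ Submodule.span E {v}) (by
    intro w hw d
    obtain ⟨w', hw', w'', hw'', rfl⟩ := Submodule.mem_sup.mp hw
    obtain ⟨r, rfl⟩ := Submodule.mem_span_singleton.mp hw''
    have e1 := sum_pderiv_contactOrbitMap (K := K) ![2, 3] w' d
    have e2 := sum_pderiv_contactOrbitMap (K := K) ![2, 3] v d
    rw [coeff_contactTangent_eq_zero_of_lowPos 2 hk _ _ (mem_coordinateSubmodule.mp hw') d] at e1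
    rw [coeff_contactTangent_syzygyVector 2 two_ne_zero] at e2
    simp only [Pi.add_apply, Pi.smul_apply, smul_eq_mul, mul_add, Finset.sum_add_distrib, e1,
      mul_left_comm _ r, ← Finset.mul_sum, e2, mul_zero, add_zero])
  have hlt : Module.finrank E N < Module.finrank E ↥(N ⊔ Submodule.span E {v}) :=
    Submodule.finrank_lt_finrank_of_lt (lt_of_le_of_ne le_sup_left fun he => hv (by
      rw [he]
      exact Submodule.mem_sup_right (Submodule.mem_span_singleton_self v)))
  rw [hN, finrank_coordinateSubmodule] at hlt
  have h2 := card_contactIndex_subtype k (fun x => ¬ lowPos x = true)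
  have h3 := card_contactIndex_subtype k (fun _ => True)
  rw [Finset.filter_true, Nat.card_congr (Equiv.subtypeUnivEquiv fun _ => trivial),
    Nat.card_eq_fintype_card] at h3
  rw [← h2, ← h3]
  exact lt_of_lt_of_le (Nat.add_lt_add_left hlt _) h1

end Rank

end TangentImage
end

noncomputable section

namespace TangentImage

open MvPowerSeries

section Prescribed

variable {R : Type*} [CommRing R]

/-- The point of the jet space of the contact group with prescribed coefficients. -/
def contactPoint (k : ℕ) (u a b : ℕ → ℕ → R) : ContactIndex 2 k → R := fun i =>
  Sum.elim (fun x : ℕ × ℕ => u x.1 x.2)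
    (fun e : Fin 2 × (ℕ × ℕ) => if e.1 = 0 then a e.2.1 e.2.2 else b e.2.1 e.2.2) (contactPos i)

variable {k : ℕ} (u a b : ℕ → ℕ → R)

theorem posVal_contactPoint_inl {i j : ℕ} (h : i + j ≤ k) :
    posVal (contactPoint k u a b) (Sum.inl (i, j)) = u i j :=
  posVal_comp (Sum.elim (fun x : ℕ × ℕ => u x.1 x.2)
    (fun e : Fin 2 × (ℕ × ℕ) => if e.1 = 0 then a e.2.1 e.2.2 else b e.2.1 e.2.2))
    (by simpa [contactGrid, mem_jetGrid] using h)

theorem posVal_inr_zero (v : ContactIndex 2 k → R) (e : Fin 2) :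
    posVal v (Sum.inr (e, (0, 0))) = 0 :=
  posVal_eq_zero _ (by simp [contactGrid])

theorem posVal_contactPoint_inr {i j : ℕ} (h : i + j ≤ k) (ha : a 0 0 = 0) (hb : b 0 0 = 0)
    (e : Fin 2) : posVal (contactPoint k u a b) (Sum.inr (e, (i, j))) =
      if e = 0 then a i j else b i j := by
  by_cases h0 : (i, j) = (0, 0)
  · simp only [Prod.mk.injEq] at h0
    rw [h0.1, h0.2, posVal_inr_zero, ha, hb, ite_self]
  · exact posVal_comp (Sum.elim (fun x : ℕ × ℕ => u x.1 x.2)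
      (fun e : Fin 2 × (ℕ × ℕ) => if e.1 = 0 then a e.2.1 e.2.2 else b e.2.1 e.2.2))
      (by simpa [contactGrid, mem_jetGrid, h0] using h)

end Prescribed

/-! ### `x ^ 2 + y ^ 3` in characteristic 2 -/

section CharTwo

section Values

variable {R : Type*} [CommRing R]

/-- The coefficients of degree at most 4 of `u * (a ^ 2 + b ^ 3)` in characteristic 2, for series
`a` and `b` without constant term. -/
def charTwoValue (u a b : ℕ → ℕ → R) : ℕ → ℕ → R
  | 2, 0 => u 0 0 * a 1 0 ^ 2
  | 0, 2 => u 0 0 * a 0 1 ^ 2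
  | 3, 0 => u 1 0 * a 1 0 ^ 2 + u 0 0 * b 1 0 ^ 3
  | 2, 1 => u 0 1 * a 1 0 ^ 2 + u 0 0 * b 1 0 ^ 2 * b 0 1
  | 1, 2 => u 1 0 * a 0 1 ^ 2 + u 0 0 * b 0 1 ^ 2 * b 1 0
  | 0, 3 => u 0 1 * a 0 1 ^ 2 + u 0 0 * b 0 1 ^ 3
  | 4, 0 => u 2 0 * a 1 0 ^ 2 + u 0 0 * a 2 0 ^ 2 + u 1 0 * b 1 0 ^ 3 +
      u 0 0 * b 1 0 ^ 2 * b 2 0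
  | 3, 1 => u 1 1 * a 1 0 ^ 2 + u 1 0 * b 1 0 ^ 2 * b 0 1 + u 0 1 * b 1 0 ^ 3 +
      u 0 0 * b 1 0 ^ 2 * b 1 1
  | 2, 2 => u 0 2 * a 1 0 ^ 2 + u 2 0 * a 0 1 ^ 2 + u 0 0 * a 1 1 ^ 2 +
      u 1 0 * b 0 1 ^ 2 * b 1 0 + u 0 1 * b 1 0 ^ 2 * b 0 1 +
      u 0 0 * (b 1 0 ^ 2 * b 0 2 + b 0 1 ^ 2 * b 2 0)
  | 1, 3 => u 1 1 * a 0 1 ^ 2 + u 1 0 * b 0 1 ^ 3 + u 0 1 * b 0 1 ^ 2 * b 1 0 +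
      u 0 0 * b 0 1 ^ 2 * b 1 1
  | 0, 4 => u 0 2 * a 0 1 ^ 2 + u 0 0 * a 0 2 ^ 2 + u 0 1 * b 0 1 ^ 3 +
      u 0 0 * b 0 1 ^ 2 * b 0 2
  | _, _ => 0

/-- The coefficients of degree at most 4 of `a ^ 2 + b ^ 3` in characteristic 2. -/
def charTwoInner (a b : ℕ → ℕ → R) : ℕ → ℕ → R
  | 2, 0 => a 1 0 ^ 2
  | 0, 2 => a 0 1 ^ 2
  | 3, 0 => b 1 0 ^ 3
  | 2, 1 => b 1 0 ^ 2 * b 0 1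
  | 1, 2 => b 0 1 ^ 2 * b 1 0
  | 0, 3 => b 0 1 ^ 3
  | 4, 0 => a 2 0 ^ 2 + b 1 0 ^ 2 * b 2 0
  | 3, 1 => b 1 0 ^ 2 * b 1 1
  | 2, 2 => a 1 1 ^ 2 + b 1 0 ^ 2 * b 0 2 + b 0 1 ^ 2 * b 2 0
  | 1, 3 => b 0 1 ^ 2 * b 1 1
  | 0, 4 => a 0 2 ^ 2 + b 0 1 ^ 2 * b 0 2
  | _, _ => 0

theorem coeff_charTwoInner [CharP R 2] (A B : MvPowerSeries (Fin 2) R) (a b : ℕ → ℕ → R)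
    (hA : ∀ i j, i + j ≤ 4 → coeff (ex i j) A = a i j)
    (hB : ∀ i j, i + j ≤ 4 → coeff (ex i j) B = b i j) (ha : a 0 0 = 0) (hb : b 0 0 = 0)
    (i j : ℕ) (hij : i + j ≤ 4) :
    coeff (ex i j) (A ^ 2 + B ^ 3) = charTwoInner a b i j := by
  have : Fact (Nat.Prime 2) := ⟨Nat.prime_two⟩
  rw [pow_succ' B 2]
  have hi : i ≤ 4 := by omega
  have hj : j ≤ 4 := by omega
  interval_cases i <;> interval_cases j <;> first
    | omega
    | simp [coeff_ex_mul, coeff_ex_pow_char, Finset.sum_range_succ, hA, hB, ha, hb,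
        charTwoInner] <;> ring

theorem coeff_charTwo [CharP R 2] (U A B : MvPowerSeries (Fin 2) R) (u a b : ℕ → ℕ → R)
    (hU : ∀ i j, i + j ≤ 4 → coeff (ex i j) U = u i j)
    (hA : ∀ i j, i + j ≤ 4 → coeff (ex i j) A = a i j)
    (hB : ∀ i j, i + j ≤ 4 → coeff (ex i j) B = b i j) (ha : a 0 0 = 0) (hb : b 0 0 = 0)
    (i j : ℕ) (hij : i + j ≤ 4) :
    coeff (ex i j) (U * (A ^ 2 + B ^ 3)) = charTwoValue u a b i j := by
  have hM := coeff_charTwoInner A B a b hA hB ha hb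
  generalize A ^ 2 + B ^ 3 = M at hM ⊢
  have hi : i ≤ 4 := by omega
  have hj : j ≤ 4 := by omega
  interval_cases i <;> interval_cases j <;> first
    | omega
    | simp [coeff_ex_mul, Finset.sum_range_succ, hU, hM, charTwoInner, charTwoValue] <;> ring

theorem coeff_contactValue_charTwo [CharP R 2] (v : ContactIndex 2 4 → R) (i j : ℕ)
    (hij : i + j ≤ 4) : coeff (ex i j) (contactValue ![2, 3] v) =
      charTwoValue (fun i j => posVal v (Sum.inl (i, j))) (fun i j => posVal v (Sum.inr (0, (i, j))))
        (fun i j => posVal v (Sum.inr (1, (i, j)))) i j := by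
  rw [contactValue, rightValue, Fin.sum_univ_two]
  exact coeff_charTwo _ _ _ _ _ _ (fun i j _ => coeff_seriesOfJet_inl v i j)
    (fun i j _ => coeff_tupleOfJet_inr v 0 i j) (fun i j _ => coeff_tupleOfJet_inr v 1 i j)
    (posVal_inr_zero v 0) (posVal_inr_zero v 1) i j hij

theorem coeff_contactValue_contactPoint_charTwo [CharP R 2] (u a b : ℕ → ℕ → R) (ha : a 0 0 = 0)
    (hb : b 0 0 = 0) (i j : ℕ) (hij : i + j ≤ 4) :
    coeff (ex i j) (contactValue ![2, 3] (contactPoint 4 u a b)) = charTwoValue u a b i j := by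
  rw [contactValue, rightValue, Fin.sum_univ_two]
  refine coeff_charTwo _ _ _ _ _ _ (fun i j h => ?_) (fun i j h => ?_) (fun i j h => ?_) ha hb i j hij
  · rw [coeff_seriesOfJet_inl, posVal_contactPoint_inl _ _ _ h]
  · rw [coeff_tupleOfJet_inr, posVal_contactPoint_inr _ _ _ h ha hb, if_pos rfl]
  · rw [coeff_tupleOfJet_inr, posVal_contactPoint_inr _ _ _ h ha hb, if_neg one_ne_zero]

end Values

section Dominance

variable {F : Type*} [Field F] [IsAlgClosed F] [CharP F 2]

/-- Generic values of the coefficients of degree 2, 3 and 4 are attained. With `u` of constant term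
1, the linear part of `a` is found from the coefficients of degree 2; the linear parts `γ`, `δ` of
`b` satisfy `P = γ w ^ 2` and `Q = δ w ^ 2`, where `w` is the determinant of the linear parts. -/
theorem exists_charTwoValue_eq (c : ℕ → ℕ → F) (h00 : c 0 0 = 0) (h10 : c 1 0 = 0)
    (h01 : c 0 1 = 0) (h11 : c 1 1 = 0) (h20 : c 2 0 ≠ 0)
    (hw : c 0 2 * (c 0 2 * c 3 0 + c 2 0 * c 1 2) ^ 2 +
      c 2 0 * (c 0 2 * c 2 1 + c 2 0 * c 0 3) ^ 2 ≠ 0) :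
    ∃ u a b : ℕ → ℕ → F, a 0 0 = 0 ∧ b 0 0 = 0 ∧
      ∀ i j, i + j ≤ 4 → charTwoValue u a b i j = c i j := by
  have h2 : (2 : F) = 0 := by exact_mod_cast CharP.cast_eq_zero F 2
  obtain ⟨α, hα⟩ := IsAlgClosed.exists_pow_nat_eq (c 2 0) (n := 2) (by norm_num)
  obtain ⟨β, hβ⟩ := IsAlgClosed.exists_pow_nat_eq (c 0 2) (n := 2) (by norm_num)
  set P := c 0 2 * c 3 0 + c 2 0 * c 1 2 with hP
  set Q := c 0 2 * c 2 1 + c 2 0 * c 0 3 with hQ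
  obtain ⟨w, hw3⟩ := IsAlgClosed.exists_pow_nat_eq (β * P + α * Q) (n := 3) (by norm_num)
  have hα0 : α ≠ 0 := by rintro rfl; exact h20 (by rw [← hα]; ring)
  have hw0 : w ≠ 0 := by
    rintro rfl
    have h1 : β * P + α * Q = 0 := by rw [← hw3]; ring
    refine hw ?_
    rw [← hα, ← hβ]
    linear_combination (β * P + α * Q) * h1 - (β * P * α * Q) * h2
  obtain ⟨γ, hγ⟩ : ∃ γ, γ * w ^ 2 = P := ⟨P / w ^ 2, div_mul_cancel₀ _ (pow_ne_zero 2 hw0)⟩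
  obtain ⟨δ, hδ⟩ : ∃ δ, δ * w ^ 2 = Q := ⟨Q / w ^ 2, div_mul_cancel₀ _ (pow_ne_zero 2 hw0)⟩
  have hdet : β * γ + α * δ = w :=
    mul_right_cancel₀ (pow_ne_zero 2 hw0) (by linear_combination β * hγ + α * hδ - hw3)
  obtain ⟨s, hs⟩ : ∃ s, s * α ^ 2 = c 3 0 - γ ^ 3 :=
    ⟨_, div_mul_cancel₀ _ (pow_ne_zero 2 hα0)⟩
  obtain ⟨t, ht⟩ : ∃ t, t * α ^ 2 = c 2 1 - γ ^ 2 * δ :=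
    ⟨_, div_mul_cancel₀ _ (pow_ne_zero 2 hα0)⟩
  have hP' : β ^ 2 * c 3 0 + α ^ 2 * c 1 2 = γ * w ^ 2 := by rw [hγ, hP, hα, hβ]
  have hQ' : β ^ 2 * c 2 1 + α ^ 2 * c 0 3 = δ * w ^ 2 := by rw [hδ, hQ, hα, hβ]
  have e12 : s * β ^ 2 + δ ^ 2 * γ = c 1 2 := by
    refine mul_left_cancel₀ (pow_ne_zero 2 hα0) ?_
    linear_combination β ^ 2 * hs + hP' - γ * (β * γ + α * δ + w) * hdet +
      (α * β * γ ^ 2 * δ + α ^ 2 * δ ^ 2 * γ - α ^ 2 * c 1 2) * h2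
  have e03 : t * β ^ 2 + δ ^ 3 = c 0 3 := by
    refine mul_left_cancel₀ (pow_ne_zero 2 hα0) ?_
    linear_combination β ^ 2 * ht + hQ' - δ * (β * γ + α * δ + w) * hdet +
      (α * β * γ * δ ^ 2 + α ^ 2 * δ ^ 3 - α ^ 2 * c 0 3) * h2
  obtain ⟨a20, h40⟩ := IsAlgClosed.exists_pow_nat_eq (c 4 0 - s * γ ^ 3) (n := 2) (by norm_num)
  obtain ⟨a11, h22⟩ := IsAlgClosed.exists_pow_nat_eq (c 2 2 - s * δ ^ 2 * γ - t * γ ^ 2 * δ) (n := 2)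
    (by norm_num)
  obtain ⟨a02, h04⟩ := IsAlgClosed.exists_pow_nat_eq (c 0 4 - t * δ ^ 3) (n := 2) (by norm_num)
  have hD : α ^ 2 * δ ^ 2 - β ^ 2 * γ ^ 2 = w ^ 2 := by
    linear_combination (β * γ + α * δ + w) * hdet - (α * β * γ * δ + β ^ 2 * γ ^ 2) * h2
  set E := c 3 1 - s * γ ^ 2 * δ - t * γ ^ 3 with hE
  set E' := c 1 3 - s * δ ^ 3 - t * δ ^ 2 * γ with hE'
  obtain ⟨m, hm⟩ : ∃ m, m * w ^ 2 = E * δ ^ 2 - E' * γ ^ 2 :=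
    ⟨_, div_mul_cancel₀ _ (pow_ne_zero 2 hw0)⟩
  obtain ⟨n, hn⟩ : ∃ n, n * w ^ 2 = α ^ 2 * E' - β ^ 2 * E :=
    ⟨_, div_mul_cancel₀ _ (pow_ne_zero 2 hw0)⟩
  have e31 : m * α ^ 2 + n * γ ^ 2 = E := by
    refine mul_left_cancel₀ (pow_ne_zero 2 hw0) ?_
    linear_combination α ^ 2 * hm + γ ^ 2 * hn + E * hD
  have e13 : m * β ^ 2 + n * δ ^ 2 = E' := by
    refine mul_left_cancel₀ (pow_ne_zero 2 hw0) ?_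
    linear_combination β ^ 2 * hm + δ ^ 2 * hn + E' * hD
  refine ⟨fun i j => match i, j with
      | 0, 0 => 1 | 1, 0 => s | 0, 1 => t | 1, 1 => m | _, _ => 0,
    fun i j => match i, j with
      | 1, 0 => α | 0, 1 => β | 2, 0 => a20 | 1, 1 => a11 | 0, 2 => a02 | _, _ => 0,
    fun i j => match i, j with
      | 1, 0 => γ | 0, 1 => δ | 1, 1 => n | _, _ => 0, rfl, rfl, fun i j hij => ?_⟩
  have hi : i ≤ 4 := by omega
  have hj : j ≤ 4 := by omega
  interval_cases i <;> interval_cases j <;> first | omega | skip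
  all_goals simp only [charTwoValue]
  · exact h00.symm
  · exact h01.symm
  · rw [one_mul, hβ]
  · linear_combination e03
  · linear_combination h04
  · exact h10.symm
  · exact h11.symm
  · linear_combination e12
  · linear_combination e13 + hE'
  · rw [one_mul, hα]
  · linear_combination ht
  · linear_combination h22
  · linear_combination hs
  · linear_combination e31 + hE
  · linear_combination h40

/-- The exponents of the coefficients that vanish on the orbit of `x ^ 2 + y ^ 3` in
characteristic 2. -/
def charTwoBad : Finset (ℕ × ℕ) := {(0, 0), (1, 0), (0, 1), (1, 1)}

/-- The jet indices of the coefficients that do not vanish on the orbit. -/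
abbrev CharTwoGood : Type := {d : JetIndex 2 4 // (d.1 0, d.1 1) ∉ charTwoBad}

variable (F) in
theorem algebraicIndependent_charTwo : AlgebraicIndependent F
    fun d : CharTwoGood => contactOrbitMap 4 (powerSum F ![2, 3]) d.1 := by
  let g : ∀ a b, a + b ≤ 4 → (a, b) ∉ charTwoBad → CharTwoGood := fun a b h h' =>
    ⟨jx a b h, by simpa [jx] using h'⟩
  let y : ∀ a b, a + b ≤ 4 → (a, b) ∉ charTwoBad → MvPolynomial CharTwoGood F := fun a b h h' =>
    MvPolynomial.X (g a b h h')
  let x20 := y 2 0 (by decide) (by decide)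
  let x02 := y 0 2 (by decide) (by decide)
  let x30 := y 3 0 (by decide) (by decide)
  let x21 := y 2 1 (by decide) (by decide)
  let x12 := y 1 2 (by decide) (by decide)
  let x03 := y 0 3 (by decide) (by decide)
  refine algebraicIndependent_of_dominant _
    (x20 * (x02 * (x02 * x30 + x20 * x12) ^ 2 + x20 * (x02 * x21 + x20 * x03) ^ 2)) ?_
    fun c hc => ?_
  · -- the polynomial does not vanish at the coefficients of `x ^ 2 + y ^ 3`
    intro h
    have h1 := congrArg (MvPolynomial.eval fun d : CharTwoGood =>
      if (d.1.1 0, d.1.1 1) = (2, 0) ∨ (d.1.1 0, d.1.1 1) = (0, 3) then (1 : F) else 0) h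
    simp [x20, x02, x30, x21, x12, x03, y, g, jx] at h1
  · let c' : ℕ → ℕ → F := fun i j =>
      if h : i + j ≤ 4 ∧ (i, j) ∉ charTwoBad then c (g i j h.1 h.2) else 0
    have hc' : ∀ i j (h : i + j ≤ 4) (h' : (i, j) ∉ charTwoBad), c' i j = c (g i j h h') :=
      fun i j h h' => dif_pos ⟨h, h'⟩
    have hb : ∀ i j, (i, j) ∈ charTwoBad → c' i j = 0 := fun i j h => dif_neg fun h' => h'.2 h
    simp only [map_mul, map_add, map_pow, MvPolynomial.eval_X, x20, x02, x30, x21, x12, x03, y,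
      ← hc'] at hc
    obtain ⟨u, a, b, ha, hb, H⟩ := exists_charTwoValue_eq c' (hb _ _ (by decide))
      (hb _ _ (by decide)) (hb _ _ (by decide)) (hb _ _ (by decide))
      (left_ne_zero_of_mul hc) (right_ne_zero_of_mul hc)
    refine ⟨contactPoint 4 u a b, fun d => ?_⟩
    have hd : d.1.1 0 + d.1.1 1 ≤ 4 := by rw [← degree_eq_add]; exact d.1.2
    rw [eval_contactOrbitMap, ← ex_eta d.1.1,
      coeff_contactValue_contactPoint_charTwo u a b ha hb _ _ hd, H _ _ hd, hc' _ _ hd d.2]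
    congr 1
    exact Subtype.ext (jx_eta d.1)

end Dominance

end CharTwo

end TangentImage
end

noncomputable section

namespace TangentImage

open MvPowerSeries

/-! ### Dimensions for `x ^ 2 + y ^ 3` in characteristic 2 -/

section Dimensions

variable {K F : Type*} [Field K] [Field F] [Algebra K F]

theorem coeff_contactValue_of_mem_jetOrbit {s k : ℕ} {n : Fin s → ℕ} {c : JetIndex s k → F}
    (hc : c ∈ jetOrbit (K := K) (K' := F) (ContactGroup s F) k (powerSum K n)) :
    ∃ y : ContactIndex s k → F, c = fun d => coeff d.1 (contactValue n y) := by
  obtain ⟨_, ⟨g, rfl⟩, rfl⟩ := hc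
  refine ⟨contactJet k g, ?_⟩
  simp only [map_powerSum]
  exact jet_smul_powerSum k n g

variable [IsAlgClosed F]

theorem zariskiDim_contactJetGroup (k : ℕ) :
    zariskiDim (contactJetGroup 2 F k) = (contactGrid k).card := by
  have h := card_contactIndex_subtype k (fun _ => True)
  rw [Finset.filter_true, Nat.card_congr (Equiv.subtypeUnivEquiv fun _ => trivial)] at h
  rw [← h]
  refine zariskiDim_eq_card MvPolynomial.X _ (contactDenominator 2 k F) contactDenominator_ne_zero
    (fun y hy => ?_) (fun v _ => ⟨v, by simp⟩) id (MvPolynomial.algebraicIndependent_X _ _)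
    fun i hi => absurd ⟨i, rfl⟩ hi
  simp only [MvPolynomial.eval_X]
  exact exists_contactJet_eq y hy

theorem zariskiDim_jetOrbit {k : ℕ} (n : Fin 2 → ℕ) {J : Type*} [Finite J] (j : J → JetIndex 2 k)
    (hj : AlgebraicIndependent F fun i => contactOrbitMap k (powerSum F n) (j i))
    (h0 : ∀ d, d ∉ Set.range j → contactOrbitMap k (powerSum F n) d = 0) :
    zariskiDim (jetOrbit (K := K) (K' := F) (ContactGroup 2 F) k (powerSum K n)) = Nat.card J := by
  refine zariskiDim_eq_card (contactOrbitMap k (powerSum F n)) _ (contactDenominator 2 k F)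
    contactDenominator_ne_zero (fun y hy => ?_) ?_ j hj h0
  · have h := aeval_contactOrbitMap_mem_jetOrbit (K := K) n y hy
    simp only [aeval_contactOrbitMap] at h
    simpa only [eval_contactOrbitMap] using h
  · rintro _ ⟨_, ⟨g, rfl⟩, rfl⟩
    refine ⟨contactJet k g, ?_⟩
    simp only [eval_contactOrbitMap, map_powerSum]
    exact jet_smul_powerSum k n g

end Dimensions

section CharTwo

section Orbit

variable {K F : Type*} [Field K] [Field F] [Algebra K F] [IsAlgClosed F]

theorem natCard_charTwoGood : Nat.card CharTwoGood = 11 :=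
  (card_jetIndex_subtype 4 fun x => x ∉ charTwoBad).trans (by decide)

theorem zariskiDim_jetOrbit_charTwo [CharP F 2] :
    zariskiDim (jetOrbit (K := K) (K' := F) (ContactGroup 2 F) 4 (powerSum K ![2, 3])) = 11 := by
  rw [zariskiDim_jetOrbit ![2, 3] _ (algebraicIndependent_charTwo F), natCard_charTwoGood]
  · rfl
  · intro d hd
    have hbad : (d.1 0, d.1 1) ∈ charTwoBad := by
      by_contra h
      exact hd ⟨⟨d, h⟩, rfl⟩
    have : CharP (MvPolynomial (ContactIndex 2 4) F) 2 :=
      charP_of_injective_algebraMap (algebraMap F _).injective 2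
    rw [contactOrbitMap_powerSum, ← ex_eta d.1,
      coeff_contactValue_charTwo _ _ _ (by rw [← degree_eq_add]; exact d.2)]
    generalize d.1 0 = i at hbad ⊢
    generalize d.1 1 = j at hbad ⊢
    simp only [charTwoBad, Finset.mem_insert, Finset.mem_singleton, Prod.mk.injEq] at hbad
    obtain ⟨rfl, rfl⟩ | ⟨rfl, rfl⟩ | ⟨rfl, rfl⟩ | ⟨rfl, rfl⟩ := hbad <;> rfl

theorem not_isSeparableMap_charTwo [CharP K 2] :
    ¬ IsSeparableMap F (contactOrbitMap 4 (powerSum K ![2, 3])) := by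
  intro h
  have : CharP F 2 := charP_of_injective_algebraMap (algebraMap K F).injective 2
  have h1 := card_add_card_lt_of_isSeparableMap le_rfl (by norm_num) h _
    (algebraicIndependent_charTwo F)
  rw [← Nat.card_eq_fintype_card, natCard_charTwoGood] at h1
  revert h1
  decide

end Orbit

/-- The positions of the coordinates that are determined by the others on the stabilizer. -/
def stabilizerBad : Finset ((ℕ × ℕ) ⊕ (Fin 2 × (ℕ × ℕ))) :=
  {Sum.inl (0, 0), Sum.inl (1, 0), Sum.inl (0, 1), Sum.inl (2, 0), Sum.inl (1, 1), Sum.inl (0, 2),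
    Sum.inr (0, (1, 0)), Sum.inr (0, (0, 1)), Sum.inr (1, (1, 0)), Sum.inr (1, (0, 1)),
    Sum.inr (1, (1, 1)), Sum.inr (1, (0, 2))}

/-- The positions of the free coordinates on the stabilizer. -/
def stabilizerFree : Finset ((ℕ × ℕ) ⊕ (Fin 2 × (ℕ × ℕ))) :=
  (contactGrid 4).filter fun x => x ∉ stabilizerBad

section Point

variable {R S : Type*} [CommRing R] [CommRing S]

/-- The point of the stabilizer with parameters `t` (with inverse `t'`) and free coordinates `z`. -/
def stabilizerPoint (t t' : R) (z : (ℕ × ℕ) ⊕ (Fin 2 × (ℕ × ℕ)) → R) :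
    (ℕ × ℕ) ⊕ (Fin 2 × (ℕ × ℕ)) → R := fun x =>
  if x = Sum.inl (0, 0) then t' ^ 6
  else if x = Sum.inl (2, 0) then t' ^ 12 * z (Sum.inr (0, (2, 0))) ^ 2
  else if x = Sum.inl (0, 2) then
    t' ^ 12 * (z (Sum.inr (0, (1, 1))) ^ 2 + t ^ 4 * z (Sum.inr (1, (2, 0))))
  else if x = Sum.inr (0, (1, 0)) then t ^ 3
  else if x = Sum.inr (1, (0, 1)) then t ^ 2
  else if x = Sum.inr (1, (0, 2)) then t' ^ 4 * z (Sum.inr (0, (0, 2))) ^ 2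
  else if x ∈ stabilizerBad then 0
  else z x

theorem stabilizerPoint_of_notMem (t t' : R) (z : (ℕ × ℕ) ⊕ (Fin 2 × (ℕ × ℕ)) → R)
    {x : (ℕ × ℕ) ⊕ (Fin 2 × (ℕ × ℕ))} (hx : x ∉ stabilizerBad) :
    stabilizerPoint t t' z x = z x := by
  have h := hx
  simp only [stabilizerBad, Finset.mem_insert, Finset.mem_singleton, not_or] at h
  simp only [stabilizerPoint, h, hx, if_false]

theorem map_stabilizerPoint (θ : R →+* S) (t t' : R) (z : (ℕ × ℕ) ⊕ (Fin 2 × (ℕ × ℕ)) → R)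
    (x : (ℕ × ℕ) ⊕ (Fin 2 × (ℕ × ℕ))) :
    θ (stabilizerPoint t t' z x) = stabilizerPoint (θ t) (θ t') (fun x => θ (z x)) x := by
  simp only [stabilizerPoint]
  split_ifs <;> simp

end Point

section Equations

variable {F : Type*} [Field F] [CharP F 2]

/-- The equations of the stabilizer, solved. They imply that the unit and the linear part of the
automorphism are invertible, and that the linear part is diagonal, with entries `t ^ 3`, `t ^ 2`. -/
theorem exists_stabilizerPoint_eq (u a b : ℕ → ℕ → F)
    (H20 : charTwoValue u a b 2 0 = 1) (H02 : charTwoValue u a b 0 2 = 0)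
    (H30 : charTwoValue u a b 3 0 = 0) (H21 : charTwoValue u a b 2 1 = 0)
    (H12 : charTwoValue u a b 1 2 = 0) (H03 : charTwoValue u a b 0 3 = 1)
    (H40 : charTwoValue u a b 4 0 = 0) (H31 : charTwoValue u a b 3 1 = 0)
    (H22 : charTwoValue u a b 2 2 = 0) (H13 : charTwoValue u a b 1 3 = 0)
    (H04 : charTwoValue u a b 0 4 = 0) :
    ∃ t t' : F, t * t' = 1 ∧ u 0 0 = t' ^ 6 ∧ u 1 0 = 0 ∧ u 0 1 = 0 ∧
      u 2 0 = t' ^ 12 * a 2 0 ^ 2 ∧ u 1 1 = 0 ∧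
      u 0 2 = t' ^ 12 * (a 1 1 ^ 2 + t ^ 4 * b 2 0) ∧ a 1 0 = t ^ 3 ∧ a 0 1 = 0 ∧ b 1 0 = 0 ∧
      b 0 1 = t ^ 2 ∧ b 1 1 = 0 ∧ b 0 2 = t' ^ 4 * a 0 2 ^ 2 := by
  have h2 : (2 : F) = 0 := by exact_mod_cast CharP.cast_eq_zero F 2
  simp only [charTwoValue] at *
  have hu : u 0 0 ≠ 0 := left_ne_zero_of_mul (a := u 0 0) (b := a 1 0 ^ 2) (by rw [H20]; simp)
  have hα : a 1 0 ≠ 0 := fun h => by simp [h] at H20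
  have hα2 := pow_ne_zero 2 hα
  have hβ : a 0 1 = 0 := by simpa [hu] using H02
  rw [hβ] at H03 H12 H13 H04 H22
  have hδ : b 0 1 ≠ 0 := fun h => by simp [h] at H03
  have hγ : b 1 0 = 0 := by simpa [hu, hδ] using H12
  rw [hγ] at H30 H21 H40 H31 H22 H13
  have hu10 : u 1 0 = 0 := by simpa [hα] using H30
  have hu01 : u 0 1 = 0 := by simpa [hα] using H21
  have hu11 : u 1 1 = 0 := by simpa [hα, hu10, hu01] using H31
  have hb11 : b 1 1 = 0 := by simpa [hu, hδ, hu10, hu01] using H13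
  simp only [hu10, hu01] at H40 H22 H04 H03
  obtain ⟨t, ht⟩ : ∃ t, t * b 0 1 = a 1 0 := ⟨_, div_mul_cancel₀ _ hδ⟩
  have ht0 : t ≠ 0 := by rintro rfl; exact hα (by rw [← ht, zero_mul])
  have hδt : b 0 1 = t ^ 2 := by
    refine mul_left_cancel₀ (pow_ne_zero 2 hδ) (mul_left_cancel₀ hu ?_)
    rw [← ht] at H20
    linear_combination H03 - H20
  have hαt : a 1 0 = t ^ 3 := by rw [← ht, hδt]; ring
  obtain ⟨t', htt⟩ : ∃ t', t * t' = 1 := ⟨_, mul_inv_cancel₀ ht0⟩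
  have hp : ∀ n : ℕ, t ^ n * t' ^ n = 1 := fun n => by rw [← mul_pow, htt, one_pow]
  have hut : u 0 0 = t' ^ 6 := by
    rw [hαt] at H20
    linear_combination t' ^ 6 * H20 - u 0 0 * hp 6
  rw [hαt, hut] at H40 H22
  rw [hδt] at H22 H04
  refine ⟨t, t', htt, hut, hu10, hu01, ?_, hu11, ?_, hαt, hβ, hγ, hδt, hb11, ?_⟩
  · linear_combination t' ^ 6 * H40 - u 2 0 * hp 6 - t' ^ 12 * a 2 0 ^ 2 * h2
  · linear_combination t' ^ 6 * H22 - u 0 2 * hp 6 -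
      t' ^ 12 * (a 1 1 ^ 2 + t ^ 4 * b 2 0) * h2
  · have h3 : a 0 2 ^ 2 + t ^ 4 * b 0 2 = 0 := by
      refine mul_left_cancel₀ hu ?_
      linear_combination H04
    linear_combination t' ^ 4 * h3 - b 0 2 * hp 4 - t' ^ 4 * a 0 2 ^ 2 * h2

/-- The converse of `exists_stabilizerPoint_eq`: the parametrized points solve the equations. -/
theorem charTwoValue_stabilizer (u a b : ℕ → ℕ → F) (t t' : F) (htt : t * t' = 1)
    (hu00 : u 0 0 = t' ^ 6) (hu10 : u 1 0 = 0) (hu01 : u 0 1 = 0)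
    (hu20 : u 2 0 = t' ^ 12 * a 2 0 ^ 2) (hu11 : u 1 1 = 0)
    (hu02 : u 0 2 = t' ^ 12 * (a 1 1 ^ 2 + t ^ 4 * b 2 0)) (ha10 : a 1 0 = t ^ 3)
    (ha01 : a 0 1 = 0) (hb10 : b 1 0 = 0) (hb01 : b 0 1 = t ^ 2) (hb11 : b 1 1 = 0)
    (hb02 : b 0 2 = t' ^ 4 * a 0 2 ^ 2) (i j : ℕ) (hij : i + j ≤ 4) :
    charTwoValue u a b i j = if (i, j) = (2, 0) ∨ (i, j) = (0, 3) then 1 else 0 := by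
  have h2 : (2 : F) = 0 := by exact_mod_cast CharP.cast_eq_zero F 2
  have hp : ∀ n : ℕ, t ^ n * t' ^ n = 1 := fun n => by rw [← mul_pow, htt, one_pow]
  have hi : i ≤ 4 := by omega
  have hj : j ≤ 4 := by omega
  interval_cases i <;> interval_cases j <;> first
    | omega
    | simp [charTwoValue, hu00, hu10, hu01, hu20, hu11, hu02, ha10, ha01, hb10, hb01, hb11, hb02]
  · linear_combination hp 6
  · linear_combination t' ^ 6 * a 0 2 ^ 2 * hp 4 + t' ^ 6 * a 0 2 ^ 2 * h2
  · linear_combination hp 6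
  · linear_combination t' ^ 6 * (a 1 1 ^ 2 + t ^ 4 * b 2 0) * hp 6 +
      t' ^ 6 * (a 1 1 ^ 2 + t ^ 4 * b 2 0) * h2
  · linear_combination t' ^ 6 * a 2 0 ^ 2 * hp 6 + t' ^ 6 * a 2 0 ^ 2 * h2

end Equations

end CharTwo

end TangentImage
end

noncomputable section

namespace TangentImage

open MvPowerSeries

/-! ### The stabilizer of `x ^ 2 + y ^ 3` in characteristic 2 -/

section CharTwoStabilizer

section Equations

variable {K F : Type*} [Field K] [Field F] [Algebra K F]

theorem coeff_powerSum_two (m n i j : ℕ) :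
    coeff (ex i j) (powerSum F ![m, n]) =
      (if (i, j) = (m, 0) then 1 else 0) + if (i, j) = (0, n) then 1 else 0 := by
  have h0 : (Finsupp.single 0 m : Fin 2 →₀ ℕ) = ex m 0 := by simp [ex]
  have h1 : (Finsupp.single 1 n : Fin 2 →₀ ℕ) = ex 0 n := by simp [ex]
  simp [powerSum, Fin.sum_univ_two, coeff_X_pow, h0, h1, ex_inj]

theorem eval_contactDenominator_two {k : ℕ} (hk : k ≠ 0) (v : ContactIndex 2 k → F) :
    MvPolynomial.eval v (contactDenominator 2 k F) = posVal v (Sum.inl (0, 0)) *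
      (posVal v (Sum.inr (0, (1, 0))) * posVal v (Sum.inr (1, (0, 1))) -
        posVal v (Sum.inr (0, (0, 1))) * posVal v (Sum.inr (1, (1, 0)))) := by
  have h0 : (Finsupp.single 0 1 : Fin 2 →₀ ℕ) = ex 1 0 := by simp [ex]
  have h1 : (Finsupp.single 1 1 : Fin 2 →₀ ℕ) = ex 0 1 := by simp [ex]
  rw [eval_contactDenominator, Matrix.det_fin_two, ← posVal_contactPos v]
  simp only [Matrix.of_apply, hk, if_false, add_zero, h0, h1, coeff_tupleOfJet_inr]
  congr 2

variable [CharP F 2]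

theorem charTwoValue_of_mem_contactJetStabilizer {v : ContactIndex 2 4 → F}
    (hv : v ∈ contactJetStabilizer (K := K) F 4 (powerSum K ![2, 3])) (i j : ℕ) (hij : i + j ≤ 4) :
    charTwoValue (fun i j => posVal v (Sum.inl (i, j))) (fun i j => posVal v (Sum.inr (0, (i, j))))
      (fun i j => posVal v (Sum.inr (1, (i, j)))) i j =
        if (i, j) = (2, 0) ∨ (i, j) = (0, 3) then 1 else 0 := by
  obtain ⟨g, hg, rfl⟩ := hv
  simp only [map_powerSum] at hg
  have h1 := congrFun hg (jx i j hij)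
  rw [jet_smul_powerSum] at h1
  rw [← coeff_contactValue_charTwo _ _ _ hij]
  refine h1.trans ?_
  change coeff (ex i j) (powerSum F ![2, 3]) = _
  rw [coeff_powerSum_two]
  by_cases h2 : (i, j) = (2, 0)
  · simp_all
  · simp [h2]

theorem mem_contactJetStabilizer_of_charTwoValue {v : ContactIndex 2 4 → F}
    (h0 : posVal v (Sum.inl (0, 0)) * (posVal v (Sum.inr (0, (1, 0))) *
      posVal v (Sum.inr (1, (0, 1))) -
        posVal v (Sum.inr (0, (0, 1))) * posVal v (Sum.inr (1, (1, 0)))) ≠ 0)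
    (hv : ∀ i j, i + j ≤ 4 → charTwoValue (fun i j => posVal v (Sum.inl (i, j)))
      (fun i j => posVal v (Sum.inr (0, (i, j)))) (fun i j => posVal v (Sum.inr (1, (i, j)))) i j =
        if (i, j) = (2, 0) ∨ (i, j) = (0, 3) then 1 else 0) :
    v ∈ contactJetStabilizer (K := K) F 4 (powerSum K ![2, 3]) := by
  rw [← eval_contactDenominator_two four_ne_zero] at h0
  obtain ⟨g, rfl⟩ := exists_contactJet_eq v h0
  refine ⟨g, ?_, rfl⟩
  change jet 4 (g • map _ _) = jet 4 (map _ _)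
  rw [map_powerSum, jet_smul_powerSum]
  ext d
  have hd : d.1 0 + d.1 1 ≤ 4 := by rw [← degree_eq_add]; exact d.2
  change _ = coeff d.1 (powerSum F ![2, 3])
  rw [← ex_eta d.1, coeff_contactValue_charTwo _ _ _ hd, hv _ _ hd,
    coeff_powerSum_two]
  by_cases h2 : (d.1 0, d.1 1) = (2, 0)
  · simp_all
  · simp [h2]

end Equations

section Parametrization

variable (F : Type*) [Field F]

/-- The generic free coordinates on the stabilizer. -/
def stabilizerGeneric (x : (ℕ × ℕ) ⊕ (Fin 2 × (ℕ × ℕ))) :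
    MvPolynomial stabilizerFree (LaurentPolynomial F) :=
  if h : x ∈ stabilizerFree then MvPolynomial.X ⟨x, h⟩ else 0

/-- The parametrization of the stabilizer by a point of the punctured line and free coordinates. -/
def stabilizerParametrization (i : ContactIndex 2 4) :
    MvPolynomial stabilizerFree (LaurentPolynomial F) :=
  stabilizerPoint (MvPolynomial.C (LaurentPolynomial.T 1))
    (MvPolynomial.C (LaurentPolynomial.T (-1))) (stabilizerGeneric F) (contactPos i)

theorem adjoin_range_stabilizerParametrization :
    Algebra.adjoin F (Set.range (stabilizerParametrization F)) = ⊤ := by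
  set S := Algebra.adjoin F (Set.range (stabilizerParametrization F))
  have hmem : ∀ x ∈ contactGrid 4, stabilizerPoint (MvPolynomial.C (LaurentPolynomial.T 1))
      (MvPolynomial.C (LaurentPolynomial.T (-1))) (stabilizerGeneric F) x ∈ S := fun x hx => by
    obtain ⟨i, rfl⟩ := exists_contactPos_eq hx
    exact Algebra.subset_adjoin ⟨i, rfl⟩
  have hu := hmem (Sum.inl (0, 0)) (by decide)
  have ha := hmem (Sum.inr (0, (1, 0))) (by decide)
  have hb := hmem (Sum.inr (1, (0, 1))) (by decide)
  simp only [stabilizerPoint, reduceCtorEq, if_true, if_false, ← map_pow, LaurentPolynomial.T_pow,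
    Sum.inr.injEq, Prod.mk.injEq, one_ne_zero, false_and] at hu ha hb
  refine eq_top_of_laurent_generators S ?_ ?_ fun x => ?_
  · -- `6 = 2 * 3` and `1 = 3 + 2 + 2 - 6`
    have h := mul_mem hu (mul_mem ha (mul_mem hb hb))
    simp only [← map_mul, ← LaurentPolynomial.T_add] at h
    norm_num at h
    exact h
  · have h := mul_mem hu (mul_mem ha hb)
    simp only [← map_mul, ← LaurentPolynomial.T_add] at h
    norm_num at h
    exact h
  · have hx := Finset.mem_filter.mp x.2
    have h := hmem x.1 hx.1
    rwa [stabilizerPoint_of_notMem _ _ _ hx.2, stabilizerGeneric, dif_pos x.2] at h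

variable {F}

theorem evalLaurent_stabilizerParametrization (t : Fˣ) (z : stabilizerFree → F)
    (i : ContactIndex 2 4) : evalLaurent t z (stabilizerParametrization F i) =
      stabilizerPoint (t : F) (t⁻¹ : Fˣ)
        (fun x => if h : x ∈ stabilizerFree then z ⟨x, h⟩ else 0) (contactPos i) := by
  rw [stabilizerParametrization, map_stabilizerPoint]
  have h1 : ∀ n : ℤ, evalLaurent t z (MvPolynomial.C (LaurentPolynomial.T n)) = ((t ^ n : Fˣ) : F) :=
    fun n => by simp [evalLaurent]
  rw [h1, h1, zpow_one, zpow_neg_one]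
  congr 1
  ext x
  rw [stabilizerGeneric]
  split_ifs
  · simp [evalLaurent]
  · simp

variable {K : Type*} [Field K] [Algebra K F] [CharP F 2]

theorem mem_contactJetStabilizer_iff (v : ContactIndex 2 4 → F) :
    v ∈ contactJetStabilizer (K := K) F 4 (powerSum K ![2, 3]) ↔
      ∃ t z, v = fun i => evalLaurent t z (stabilizerParametrization F i) := by
  simp only [evalLaurent_stabilizerParametrization]
  constructor
  · intro hv
    have H := charTwoValue_of_mem_contactJetStabilizer hv
    obtain ⟨t, t', htt, hu00, hu10, hu01, hu20, hu11, hu02, ha10, ha01, hb10, hb01, hb11, hb02⟩ :=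
      exists_stabilizerPoint_eq _ _ _ (H 2 0 (by norm_num)) (H 0 2 (by norm_num))
        (H 3 0 (by norm_num)) (H 2 1 (by norm_num)) (H 1 2 (by norm_num)) (H 0 3 (by norm_num))
        (H 4 0 (by norm_num)) (H 3 1 (by norm_num)) (H 2 2 (by norm_num)) (H 1 3 (by norm_num))
        (H 0 4 (by norm_num))
    refine ⟨⟨t, t', htt, by rw [mul_comm, htt]⟩, fun x => posVal v x.1, funext fun i => ?_⟩
    rw [← posVal_contactPos v i]
    have hgrid := contactPos_mem_contactGrid i
    generalize contactPos i = x at hgrid ⊢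
    have hz : ∀ y, y ∈ contactGrid 4 → y ∉ stabilizerBad → (if h : y ∈ stabilizerFree then
        (fun x : stabilizerFree => posVal v x.1) ⟨y, h⟩ else 0) = posVal v y := fun y hy hy' =>
      dif_pos (Finset.mem_filter.mpr ⟨hy, hy'⟩)
    have hz1 := hz (Sum.inr (0, (2, 0))) (by decide) (by decide)
    have hz2 := hz (Sum.inr (0, (1, 1))) (by decide) (by decide)
    have hz3 := hz (Sum.inr (1, (2, 0))) (by decide) (by decide)
    have hz4 := hz (Sum.inr (0, (0, 2))) (by decide) (by decide)
    by_cases hx : x ∈ stabilizerBad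
    · simp only [stabilizerBad, Finset.mem_insert, Finset.mem_singleton] at hx
      rcases hx with rfl | rfl | rfl | rfl | rfl | rfl | rfl | rfl | rfl | rfl | rfl | rfl
      · exact hu00
      · exact hu10
      · exact hu01
      · exact hu20.trans (by rw [← hz1]; rfl)
      · exact hu11
      · exact hu02.trans (by rw [← hz2, ← hz3]; rfl)
      · exact ha10
      · exact ha01
      · exact hb10
      · exact hb01
      · exact hb11
      · exact hb02.trans (by rw [← hz4]; rfl)
    · rw [stabilizerPoint_of_notMem _ _ _ hx, hz x hgrid hx]
  · rintro ⟨t, z, rfl⟩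
    set z' : (ℕ × ℕ) ⊕ (Fin 2 × (ℕ × ℕ)) → F :=
      fun x => if h : x ∈ stabilizerFree then z ⟨x, h⟩ else 0
    have H : ∀ x ∈ contactGrid 4, posVal (fun i : ContactIndex 2 4 =>
        stabilizerPoint (t : F) (t⁻¹ : Fˣ) z' (contactPos i)) x =
          stabilizerPoint (t : F) (t⁻¹ : Fˣ) z' x := fun x hx =>
      posVal_comp (stabilizerPoint (t : F) (t⁻¹ : Fˣ) z') hx
    refine mem_contactJetStabilizer_of_charTwoValue ?_
      (charTwoValue_stabilizer _ _ _ (t : F) (t⁻¹ : Fˣ) (by simp) ?_ ?_ ?_ ?_ ?_ ?_ ?_ ?_ ?_ ?_ ?_ ?_)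
    · rw [H _ (by decide), H _ (by decide), H _ (by decide), H _ (by decide), H _ (by decide)]
      simp [stabilizerPoint, stabilizerBad]
    all_goals
      first
        | rw [H _ (by decide), H _ (by decide), H _ (by decide)]
        | rw [H _ (by decide), H _ (by decide)]
        | rw [H _ (by decide)]
      simp [stabilizerPoint, stabilizerBad]

theorem zariskiDim_contactJetStabilizer [IsAlgClosed F] :
    zariskiDim (contactJetStabilizer (K := K) F 4 (powerSum K ![2, 3])) = 32 := by
  rw [zariskiDim_eq_of_laurent _ _ mem_contactJetStabilizer_iff
    (adjoin_range_stabilizerParametrization F)]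
  have h : Nat.card stabilizerFree = 31 := by
    rw [Nat.card_eq_fintype_card, Fintype.card_coe]
    decide
  rw [h]
  rfl

end Parametrization

end CharTwoStabilizer

end TangentImage
end

noncomputable section

namespace TangentImage

open MvPowerSeries

/-! ### `x ^ 3 + y ^ 4` in characteristic 3 -/

section CharThree

section Values

variable {R : Type*} [CommRing R]

/-- The coefficients of degree at most 5 of `a ^ 3 + b ^ 4` in characteristic 3, for series `a` and
`b` without constant term. -/
def charThreeInner (a b : ℕ → ℕ → R) : ℕ → ℕ → R
  | 3, 0 => a 1 0 ^ 3
  | 0, 3 => a 0 1 ^ 3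
  | 4, 0 => b 1 0 ^ 4
  | 3, 1 => b 1 0 ^ 3 * b 0 1
  | 1, 3 => b 0 1 ^ 3 * b 1 0
  | 0, 4 => b 0 1 ^ 4
  | 5, 0 => b 1 0 ^ 3 * b 2 0
  | 4, 1 => b 1 0 ^ 3 * b 1 1
  | 3, 2 => b 1 0 ^ 3 * b 0 2
  | 2, 3 => b 0 1 ^ 3 * b 2 0
  | 1, 4 => b 0 1 ^ 3 * b 1 1
  | 0, 5 => b 0 1 ^ 3 * b 0 2
  | _, _ => 0

/-- The coefficients of degree at most 5 of `u * (a ^ 3 + b ^ 4)` in characteristic 3. -/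
def charThreeValue (u a b : ℕ → ℕ → R) : ℕ → ℕ → R
  | 3, 0 => u 0 0 * a 1 0 ^ 3
  | 0, 3 => u 0 0 * a 0 1 ^ 3
  | 4, 0 => u 1 0 * a 1 0 ^ 3 + u 0 0 * b 1 0 ^ 4
  | 3, 1 => u 0 1 * a 1 0 ^ 3 + u 0 0 * b 1 0 ^ 3 * b 0 1
  | 1, 3 => u 1 0 * a 0 1 ^ 3 + u 0 0 * b 0 1 ^ 3 * b 1 0
  | 0, 4 => u 0 1 * a 0 1 ^ 3 + u 0 0 * b 0 1 ^ 4
  | 5, 0 => u 2 0 * a 1 0 ^ 3 + u 1 0 * b 1 0 ^ 4 + u 0 0 * b 1 0 ^ 3 * b 2 0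
  | 4, 1 => u 1 1 * a 1 0 ^ 3 + u 1 0 * b 1 0 ^ 3 * b 0 1 + u 0 1 * b 1 0 ^ 4 +
      u 0 0 * b 1 0 ^ 3 * b 1 1
  | 3, 2 => u 0 2 * a 1 0 ^ 3 + u 0 1 * b 1 0 ^ 3 * b 0 1 + u 0 0 * b 1 0 ^ 3 * b 0 2
  | 2, 3 => u 2 0 * a 0 1 ^ 3 + u 1 0 * b 0 1 ^ 3 * b 1 0 + u 0 0 * b 0 1 ^ 3 * b 2 0
  | 1, 4 => u 1 1 * a 0 1 ^ 3 + u 1 0 * b 0 1 ^ 4 + u 0 1 * b 0 1 ^ 3 * b 1 0 +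
      u 0 0 * b 0 1 ^ 3 * b 1 1
  | 0, 5 => u 0 2 * a 0 1 ^ 3 + u 0 1 * b 0 1 ^ 4 + u 0 0 * b 0 1 ^ 3 * b 0 2
  | _, _ => 0

theorem coeff_charThreeInner [CharP R 3] (A B : MvPowerSeries (Fin 2) R) (a b : ℕ → ℕ → R)
    (hA : ∀ i j, i + j ≤ 5 → coeff (ex i j) A = a i j)
    (hB : ∀ i j, i + j ≤ 5 → coeff (ex i j) B = b i j) (ha : a 0 0 = 0) (hb : b 0 0 = 0)
    (i j : ℕ) (hij : i + j ≤ 5) :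
    coeff (ex i j) (A ^ 3 + B ^ 4) = charThreeInner a b i j := by
  have : Fact (Nat.Prime 3) := ⟨Nat.prime_three⟩
  rw [pow_succ' B 3]
  have hi : i ≤ 5 := by omega
  have hj : j ≤ 5 := by omega
  interval_cases i <;> interval_cases j <;> first
    | omega
    | simp [coeff_ex_mul, coeff_ex_pow_char, Finset.sum_range_succ, hA, hB, ha, hb,
        charThreeInner] <;> ring

theorem coeff_charThree [CharP R 3] (U A B : MvPowerSeries (Fin 2) R) (u a b : ℕ → ℕ → R)
    (hU : ∀ i j, i + j ≤ 5 → coeff (ex i j) U = u i j)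
    (hA : ∀ i j, i + j ≤ 5 → coeff (ex i j) A = a i j)
    (hB : ∀ i j, i + j ≤ 5 → coeff (ex i j) B = b i j) (ha : a 0 0 = 0) (hb : b 0 0 = 0)
    (i j : ℕ) (hij : i + j ≤ 5) :
    coeff (ex i j) (U * (A ^ 3 + B ^ 4)) = charThreeValue u a b i j := by
  have hM := coeff_charThreeInner A B a b hA hB ha hb
  generalize A ^ 3 + B ^ 4 = M at hM ⊢
  have hi : i ≤ 5 := by omega
  have hj : j ≤ 5 := by omega
  interval_cases i <;> interval_cases j <;> first
    | omega
    | simp [coeff_ex_mul, Finset.sum_range_succ, hU, hM, charThreeInner, charThreeValue] <;> ring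

theorem coeff_contactValue_charThree [CharP R 3] (v : ContactIndex 2 5 → R) (i j : ℕ)
    (hij : i + j ≤ 5) : coeff (ex i j) (contactValue ![3, 4] v) =
      charThreeValue (fun i j => posVal v (Sum.inl (i, j)))
        (fun i j => posVal v (Sum.inr (0, (i, j)))) (fun i j => posVal v (Sum.inr (1, (i, j)))) i j := by
  rw [contactValue, rightValue, Fin.sum_univ_two]
  exact coeff_charThree _ _ _ _ _ _ (fun i j _ => coeff_seriesOfJet_inl v i j)
    (fun i j _ => coeff_tupleOfJet_inr v 0 i j) (fun i j _ => coeff_tupleOfJet_inr v 1 i j)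
    (posVal_inr_zero v 0) (posVal_inr_zero v 1) i j hij

theorem coeff_contactValue_contactPoint_charThree [CharP R 3] (u a b : ℕ → ℕ → R) (ha : a 0 0 = 0)
    (hb : b 0 0 = 0) (i j : ℕ) (hij : i + j ≤ 5) :
    coeff (ex i j) (contactValue ![3, 4] (contactPoint 5 u a b)) = charThreeValue u a b i j := by
  rw [contactValue, rightValue, Fin.sum_univ_two]
  refine coeff_charThree _ _ _ _ _ _ (fun i j h => ?_) (fun i j h => ?_) (fun i j h => ?_) ha hb i j
    hij
  · rw [coeff_seriesOfJet_inl, posVal_contactPoint_inl _ _ _ h]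
  · rw [coeff_tupleOfJet_inr, posVal_contactPoint_inr _ _ _ h ha hb, if_pos rfl]
  · rw [coeff_tupleOfJet_inr, posVal_contactPoint_inr _ _ _ h ha hb, if_neg one_ne_zero]

/-- The exponents of the coefficients that vanish on the orbit of `x ^ 3 + y ^ 4` in
characteristic 3. -/
def charThreeBad : Finset (ℕ × ℕ) :=
  {(0, 0), (1, 0), (0, 1), (2, 0), (1, 1), (0, 2), (2, 1), (1, 2), (2, 2)}

theorem charThreeValue_of_mem_charThreeBad (u a b : ℕ → ℕ → R) {i j : ℕ}
    (h : (i, j) ∈ charThreeBad) : charThreeValue u a b i j = 0 := by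
  simp only [charThreeBad, Finset.mem_insert, Finset.mem_singleton, Prod.mk.injEq] at h
  rcases h with ⟨rfl, rfl⟩ | ⟨rfl, rfl⟩ | ⟨rfl, rfl⟩ | ⟨rfl, rfl⟩ | ⟨rfl, rfl⟩ | ⟨rfl, rfl⟩ |
    ⟨rfl, rfl⟩ | ⟨rfl, rfl⟩ | ⟨rfl, rfl⟩ <;> rfl

end Values

section Dominance

variable {F : Type*} [Field F]

theorem exists_solution_two {a b c d : F} (h : a * d - b * c ≠ 0) (e e' : F) :
    ∃ m n, m * a + n * c = e ∧ m * b + n * d = e' := by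
  obtain ⟨r, hr⟩ : ∃ r, r * (a * d - b * c) = 1 := ⟨_, inv_mul_cancel₀ h⟩
  exact ⟨r * (e * d - e' * c), r * (a * e' - b * e), by linear_combination e * hr,
    by linear_combination e' * hr⟩

variable [IsAlgClosed F] [CharP F 3]

/-- Generic values of the coefficients of degree 3, 4 and 5 are attained. With `u` of constant term
1, the linear part of `a` is found from the coefficients of degree 3; the linear parts `γ`, `δ` of
`b` satisfy `P = γ w ^ 3` and `Q = δ w ^ 3`, where `w` is the determinant of the linear parts, up to
sign; the coefficients of degree 5 give linear equations of determinant `- w ^ 3`. -/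
theorem exists_charThreeValue_eq (c : ℕ → ℕ → F) (hbad : ∀ i j, (i, j) ∈ charThreeBad → c i j = 0)
    (h30 : c 3 0 ≠ 0) (hw : c 0 3 * (c 0 3 * c 4 0 - c 3 0 * c 1 3) ^ 3 -
      c 3 0 * (c 0 3 * c 3 1 - c 3 0 * c 0 4) ^ 3 ≠ 0) :
    ∃ u a b : ℕ → ℕ → F, a 0 0 = 0 ∧ b 0 0 = 0 ∧
      ∀ i j, i + j ≤ 5 → charThreeValue u a b i j = c i j := by
  have h3 : (3 : F) = 0 := by exact_mod_cast CharP.cast_eq_zero F 3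
  obtain ⟨α, hα⟩ := IsAlgClosed.exists_pow_nat_eq (c 3 0) (n := 3) (by norm_num)
  obtain ⟨β, hβ⟩ := IsAlgClosed.exists_pow_nat_eq (c 0 3) (n := 3) (by norm_num)
  set P := c 0 3 * c 4 0 - c 3 0 * c 1 3 with hP
  set Q := c 0 3 * c 3 1 - c 3 0 * c 0 4 with hQ
  obtain ⟨w, hw4⟩ := IsAlgClosed.exists_pow_nat_eq (β * P - α * Q) (n := 4) (by norm_num)
  have hα0 : α ≠ 0 := by rintro rfl; exact h30 (by rw [← hα]; ring)
  have hw0 : w ≠ 0 := by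
    rintro rfl
    have h1 : β * P - α * Q = 0 := by rw [← hw4]; ring
    refine hw ?_
    rw [← hα, ← hβ]
    linear_combination (β * P - α * Q) ^ 2 * h1 +
      (β ^ 2 * P ^ 2 * α * Q - β * P * α ^ 2 * Q ^ 2) * h3
  obtain ⟨γ, hγ⟩ : ∃ γ, γ * w ^ 3 = P := ⟨P / w ^ 3, div_mul_cancel₀ _ (pow_ne_zero 3 hw0)⟩
  obtain ⟨δ, hδ⟩ : ∃ δ, δ * w ^ 3 = Q := ⟨Q / w ^ 3, div_mul_cancel₀ _ (pow_ne_zero 3 hw0)⟩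
  have hdet : β * γ - α * δ = w :=
    mul_right_cancel₀ (pow_ne_zero 3 hw0) (by linear_combination β * hγ - α * hδ - hw4)
  have hw3 : β ^ 3 * γ ^ 3 - α ^ 3 * δ ^ 3 = w ^ 3 := by
    rw [← hdet]
    linear_combination (β ^ 2 * γ ^ 2 * α * δ - β * γ * α ^ 2 * δ ^ 2) * h3
  obtain ⟨s, hs⟩ : ∃ s, s * α ^ 3 = c 4 0 - γ ^ 4 :=
    ⟨_, div_mul_cancel₀ _ (pow_ne_zero 3 hα0)⟩
  obtain ⟨t, ht⟩ : ∃ t, t * α ^ 3 = c 3 1 - γ ^ 3 * δ :=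
    ⟨_, div_mul_cancel₀ _ (pow_ne_zero 3 hα0)⟩
  have hP' : β ^ 3 * c 4 0 - α ^ 3 * c 1 3 = γ * w ^ 3 := by rw [hγ, hP, hα, hβ]
  have hQ' : β ^ 3 * c 3 1 - α ^ 3 * c 0 4 = δ * w ^ 3 := by rw [hδ, hQ, hα, hβ]
  have e13 : s * β ^ 3 + δ ^ 3 * γ = c 1 3 := by
    refine mul_left_cancel₀ (pow_ne_zero 3 hα0) ?_
    linear_combination β ^ 3 * hs + hP' - γ * hw3
  have e04 : t * β ^ 3 + δ ^ 4 = c 0 4 := by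
    refine mul_left_cancel₀ (pow_ne_zero 3 hα0) ?_
    linear_combination β ^ 3 * ht + hQ' - δ * hw3
  have hD : α ^ 3 * δ ^ 3 - β ^ 3 * γ ^ 3 ≠ 0 := by
    have : α ^ 3 * δ ^ 3 - β ^ 3 * γ ^ 3 = -w ^ 3 := by linear_combination -hw3
    rw [this, neg_ne_zero]
    exact pow_ne_zero 3 hw0
  obtain ⟨u20, b20, h50, h23⟩ := exists_solution_two hD (c 5 0 - s * γ ^ 4) (c 2 3 - s * δ ^ 3 * γ)
  obtain ⟨u11, b11, h41, h14⟩ := exists_solution_two hD (c 4 1 - s * γ ^ 3 * δ - t * γ ^ 4)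
    (c 1 4 - s * δ ^ 4 - t * δ ^ 3 * γ)
  obtain ⟨u02, b02, h32, h05⟩ := exists_solution_two hD (c 3 2 - t * γ ^ 3 * δ) (c 0 5 - t * δ ^ 4)
  refine ⟨fun i j => match i, j with
      | 0, 0 => 1 | 1, 0 => s | 0, 1 => t | 2, 0 => u20 | 1, 1 => u11 | 0, 2 => u02 | _, _ => 0,
    fun i j => match i, j with
      | 1, 0 => α | 0, 1 => β | _, _ => 0,
    fun i j => match i, j with
      | 1, 0 => γ | 0, 1 => δ | 2, 0 => b20 | 1, 1 => b11 | 0, 2 => b02 | _, _ => 0,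
    rfl, rfl, fun i j hij => ?_⟩
  by_cases hb : (i, j) ∈ charThreeBad
  · rw [charThreeValue_of_mem_charThreeBad _ _ _ hb, hbad i j hb]
  have hi : i ≤ 5 := by omega
  have hj : j ≤ 5 := by omega
  interval_cases i <;> interval_cases j <;> first
    | omega
    | exact absurd (by decide) hb
    | skip
  all_goals simp only [charThreeValue]
  · rw [one_mul, hβ]
  · linear_combination e04
  · linear_combination h05
  · linear_combination e13
  · linear_combination h14
  · linear_combination h23
  · rw [one_mul, hα]
  · linear_combination ht
  · linear_combination h32
  · linear_combination hs
  · linear_combination h41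
  · linear_combination h50

/-- The jet indices of the coefficients that do not vanish on the orbit. -/
abbrev CharThreeGood : Type := {d : JetIndex 2 5 // (d.1 0, d.1 1) ∉ charThreeBad}

theorem natCard_charThreeGood : Nat.card CharThreeGood = 12 :=
  (card_jetIndex_subtype 5 fun x => x ∉ charThreeBad).trans (by decide)

variable (F) in
theorem algebraicIndependent_charThree : AlgebraicIndependent F
    fun d : CharThreeGood => contactOrbitMap 5 (powerSum F ![3, 4]) d.1 := by
  let g : ∀ a b, a + b ≤ 5 → (a, b) ∉ charThreeBad → CharThreeGood := fun a b h h' =>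
    ⟨jx a b h, by simpa [jx] using h'⟩
  let y : ∀ a b, a + b ≤ 5 → (a, b) ∉ charThreeBad → MvPolynomial CharThreeGood F :=
    fun a b h h' => MvPolynomial.X (g a b h h')
  let x30 := y 3 0 (by decide) (by decide)
  let x03 := y 0 3 (by decide) (by decide)
  let x40 := y 4 0 (by decide) (by decide)
  let x31 := y 3 1 (by decide) (by decide)
  let x13 := y 1 3 (by decide) (by decide)
  let x04 := y 0 4 (by decide) (by decide)
  refine algebraicIndependent_of_dominant _
    (x30 * (x03 * (x03 * x40 - x30 * x13) ^ 3 - x30 * (x03 * x31 - x30 * x04) ^ 3)) ?_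
    fun c hc => ?_
  · -- the polynomial does not vanish at the coefficients of `x ^ 3 + y ^ 4`
    intro h
    have h1 := congrArg (MvPolynomial.eval fun d : CharThreeGood =>
      if (d.1.1 0, d.1.1 1) = (3, 0) ∨ (d.1.1 0, d.1.1 1) = (0, 4) then (1 : F) else 0) h
    simp [x30, x03, x40, x31, x13, x04, y, g, jx] at h1
  · let c' : ℕ → ℕ → F := fun i j =>
      if h : i + j ≤ 5 ∧ (i, j) ∉ charThreeBad then c (g i j h.1 h.2) else 0
    have hc' : ∀ i j (h : i + j ≤ 5) (h' : (i, j) ∉ charThreeBad), c' i j = c (g i j h h') :=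
      fun i j h h' => dif_pos ⟨h, h'⟩
    have hb : ∀ i j, (i, j) ∈ charThreeBad → c' i j = 0 := fun i j h => dif_neg fun h' => h'.2 h
    simp only [map_mul, map_sub, map_pow, MvPolynomial.eval_X, x30, x03, x40, x31, x13, x04, y,
      ← hc'] at hc
    obtain ⟨u, a, b, ha, hb, H⟩ := exists_charThreeValue_eq c' hb
      (left_ne_zero_of_mul hc) (right_ne_zero_of_mul hc)
    refine ⟨contactPoint 5 u a b, fun d => ?_⟩
    have hd : d.1.1 0 + d.1.1 1 ≤ 5 := by rw [← degree_eq_add]; exact d.1.2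
    rw [eval_contactOrbitMap, ← ex_eta d.1.1,
      coeff_contactValue_contactPoint_charThree u a b ha hb _ _ hd, H _ _ hd, hc' _ _ hd d.2]
    congr 1
    exact Subtype.ext (jx_eta d.1)

end Dominance

section Consequences

variable {K F : Type*} [Field K] [Field F] [Algebra K F] [IsAlgClosed F] [CharP K 3]

theorem not_isSeparableMap_charThree :
    ¬ IsSeparableMap F (contactOrbitMap 5 (powerSum K ![3, 4])) := by
  intro h
  have : CharP F 3 := charP_of_injective_algebraMap (algebraMap K F).injective 3
  have h1 := card_add_card_le_of_isSeparableMap 3 le_rfl h _ (algebraicIndependent_charThree F)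
  rw [← Nat.card_eq_fintype_card, natCard_charThreeGood] at h1
  revert h1
  decide

theorem jetTangentSpace_charThree :
    jetTangentSpace (K' := F) (ContactGroup 2 F) 5 (powerSum K ![3, 4]) =
      coordinateSubmodule K {d | (d.1 0, d.1 1) ∈ charThreeBad} := by
  have : Fact (Nat.Prime 3) := ⟨Nat.prime_three⟩
  have : CharP F 3 := charP_of_injective_algebraMap (algebraMap K F).injective 3
  refine le_antisymm (fun v hv => ?_) fun v hv => ?_
  · rw [mem_coordinateSubmodule]
    intro d hd
    have h := differential_eq_zero_of_mem_jetTangentSpace hv (MvPolynomial.X d) fun c hc => by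
      obtain ⟨y, rfl⟩ := coeff_contactValue_of_mem_jetOrbit hc
      rw [MvPolynomial.aeval_X, ← ex_eta d.1,
        coeff_contactValue_charThree _ _ _ (by rw [← degree_eq_add]; exact d.2),
        charThreeValue_of_mem_charThreeBad _ _ _ hd]
    rwa [← eval_constDerivation, constDerivation_X, MvPolynomial.eval_C] at h
  · rw [mem_coordinateSubmodule] at hv
    set d3 : JetIndex 2 5 := ⟨Finsupp.single 1 3, by simp⟩ with hd3
    have hy : jet 5 (X 1 ^ 3 : PS 2 K) d3 = 1 := by simp [jet, hd3, coeff_X_pow]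
    have hy' : ∀ d : JetIndex 2 5, d ≠ d3 → jet 5 (X 1 ^ 3 : PS 2 K) d = 0 := fun d hd => by
      change coeff d.1 (X 1 ^ 3 : PS 2 K) = 0
      rw [coeff_X_pow, if_neg fun h => hd (Subtype.ext h)]
    rw [← sub_add_cancel v (v d3 • jet 5 (X 1 ^ 3 : PS 2 K))]
    refine Submodule.add_mem _ (contactJetTangentImage_le_jetTangentSpace _ ?_)
      (Submodule.smul_mem _ _ (jet_mem_jetTangentSpace_of_infinite 5 _ _
        (infinite_contactOrbit_line 3)))
    have h1 := contactJetTangentImage_frobenius (K := K) 3 5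
    rw [show contactJetTangentImage 5 (powerSum K ![3, 4]) = _ from h1, mem_coordinateSubmodule]
    intro d hd
    rw [Set.mem_ofPred_eq, mem_frobenius_bad] at hd
    rw [Pi.sub_apply, Pi.smul_apply, smul_eq_mul]
    by_cases h : d = d3
    · rw [h, hy, mul_one, sub_self]
    · rw [hy' d h, mul_zero, sub_zero]
      refine hv d ?_
      have h3 : ¬(d.1 0 = 0 ∧ d.1 1 = 3) := fun h' => h (Subtype.ext (by
        rw [← ex_eta d.1, h'.1, h'.2]
        simp [ex, hd3]))
      rw [Set.mem_ofPred_eq]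
      generalize d.1 0 = i at hd h3 ⊢
      generalize d.1 1 = j at hd h3 ⊢
      simp only [charThreeBad, Finset.mem_insert, Finset.mem_singleton, Prod.mk.injEq]
      omega

theorem finrank_jetTangentSpace_charThree :
    Module.finrank K (jetTangentSpace (K' := F) (ContactGroup 2 F) 5 (powerSum K ![3, 4])) =
      12 := by
  rw [jetTangentSpace_charThree, finrank_coordinateSubmodule]
  exact natCard_charThreeGood

end Consequences

end CharThree

end TangentImage
end

noncomputable section

namespace TangentImage

open MvPowerSeries

/-! ### `x ^ 2 + y ^ 3` in characteristic 3 -/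

section CharThreeCusp

variable {K : Type*} [Field K] [CharP K 3]

/-- The minimal generators of the tangent image of `x ^ 2 + y ^ 3` in characteristic 3. -/
def cuspExponents : Finset (Fin 2 →₀ ℕ) := {ex 2 0, ex 1 1, ex 0 3}

theorem mem_cusp_bad (d : Fin 2 →₀ ℕ) : (∀ m ∈ cuspExponents, ¬ m ≤ d) ↔
    d 0 < 2 ∧ (d 0 < 1 ∨ d 1 < 1) ∧ d 1 < 3 := by
  simp only [cuspExponents, Finset.mem_insert, Finset.mem_singleton, forall_eq_or_imp,
    forall_eq, le_iff_ex, ex_zero, ex_one]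
  omega

theorem contactTangentImage_cusp :
    contactTangentImage (powerSum K ![2, 3]) =
      Ideal.span ((fun m => monomial m (1 : K)) '' (cuspExponents : Set (Fin 2 →₀ ℕ))) := by
  have h3 : (3 : PS 2 K) = 0 := by exact_mod_cast natCast_eq_zero_of_charP (s := 2) (K := K) 3
  have hmem : ∀ g, g ∈ contactTangentImage (powerSum K ![2, 3]) ↔ ∃ a b : PS 2 K,
      constantCoeff b = 0 ∧ g = a * (X 0 ^ 2 + X 1 ^ 3) + 2 * X 0 * b := by
    intro g
    rw [mem_contactTangentImage_powerSum]
    constructor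
    · rintro ⟨a, b, hb, rfl⟩
      refine ⟨a, b 0, hb 0, ?_⟩
      simp [powerSum, h3]
    · rintro ⟨a, b, hb, rfl⟩
      refine ⟨a, fun _ => b, fun _ => hb, ?_⟩
      simp [powerSum, h3]
  rw [cuspExponents, span_monomial_triple]
  simp only [pow_zero, pow_one, mul_one, one_mul]
  refine le_antisymm (fun g hg => ?_) ?_
  · obtain ⟨a, b, hb, rfl⟩ := (hmem g).mp hg
    obtain ⟨c, rfl, -⟩ := exists_eq_sum_X_mul (n := 0) (f := b)
      (by rwa [zero_add, Nat.cast_one, one_le_order_iff_constCoeff_eq_zero])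
    rw [Fin.sum_univ_two, show a * (X 0 ^ 2 + X 1 ^ 3) + 2 * X 0 * (X 0 * c 0 + X 1 * c 1) =
      (a + 2 * c 0) * X 0 ^ 2 + 2 * c 1 * (X 0 * X 1) + a * X 1 ^ 3 by ring]
    refine Ideal.add_mem _ (Ideal.add_mem _ ?_ ?_) ?_ <;>
      exact Ideal.mul_mem_left _ _ (Ideal.subset_span (by simp))
  · rw [Ideal.span_le]
    rintro g (rfl | rfl | rfl)
    · exact (hmem _).mpr ⟨0, 2 * X 0, by simp, by linear_combination -X 0 ^ 2 * h3⟩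
    · exact (hmem _).mpr ⟨0, 2 * X 1, by simp, by linear_combination -X 0 * X 1 * h3⟩
    · exact (hmem _).mpr ⟨1, X 0, by simp, by linear_combination -X 0 ^ 2 * h3⟩

theorem contactJetTangentImage_cusp (k : ℕ) :
    contactJetTangentImage k (powerSum K ![2, 3]) =
      coordinateSubmodule K {d : JetIndex 2 k | ∀ m ∈ cuspExponents, ¬ m ≤ d.1} :=
  contactJetTangentImage_eq_coordinateSubmodule _ _ contactTangentImage_cusp

section Values

variable {R : Type*} [CommRing R] [CharP R 3] {k : ℕ}

/-- In characteristic 3, the cube of a series without constant term does not contribute to the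
coefficients of degree at most 2. -/
theorem coeff_contactValue_cusp (v : ContactIndex 2 k → R) :
    coeff (ex 0 0) (contactValue ![2, 3] v) = 0 ∧ coeff (ex 1 0) (contactValue ![2, 3] v) = 0 ∧
    coeff (ex 0 1) (contactValue ![2, 3] v) = 0 ∧
    coeff (ex 1 1) (contactValue ![2, 3] v) ^ 2 =
      4 * coeff (ex 2 0) (contactValue ![2, 3] v) * coeff (ex 0 2) (contactValue ![2, 3] v) := by
  have : Fact (Nat.Prime 3) := ⟨Nat.prime_three⟩
  rw [contactValue, rightValue, Fin.sum_univ_two]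
  simp only [Matrix.cons_val_zero, Matrix.cons_val_one]
  set U := seriesOfJet fun d => v (Sum.inl d)
  have hA : coeff (ex 0 0) (tupleOfJet (fun d => v (Sum.inr d)) 0) = 0 := by
    rw [ex_zero_zero, coeff_zero_eq_constantCoeff_apply, constantCoeff_tupleOfJet]
  have hB : coeff (ex 0 0) (tupleOfJet (fun d => v (Sum.inr d)) 1) = 0 := by
    rw [ex_zero_zero, coeff_zero_eq_constantCoeff_apply, constantCoeff_tupleOfJet]
  generalize tupleOfJet (fun d => v (Sum.inr d)) 0 = A at hA ⊢
  generalize tupleOfJet (fun d => v (Sum.inr d)) 1 = B at hB ⊢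
  have hM : ∀ i j, i + j ≤ 2 → coeff (ex i j) (A ^ 2 + B ^ 3) = coeff (ex i j) (A * A) := by
    intro i j hij
    have hi : i ≤ 2 := by omega
    have hj : j ≤ 2 := by omega
    rw [map_add, sq, coeff_ex_pow_char]
    interval_cases i <;> interval_cases j <;> first
      | omega
      | simp [hB]
  generalize A ^ 2 + B ^ 3 = M at hM ⊢
  refine ⟨?_, ?_, ?_, ?_⟩ <;> simp [coeff_ex_mul, Finset.sum_range_succ, hM, hA]
  ring

end Values

section Tangent

variable {F : Type*} [Field F] [Algebra K F]

theorem jetTangentSpace_cusp_le (k : ℕ) :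
    jetTangentSpace (K' := F) (ContactGroup 2 F) k (powerSum K ![2, 3]) ≤
      contactJetTangentImage k (powerSum K ![2, 3]) := by
  have : CharP F 3 := charP_of_injective_algebraMap (algebraMap K F).injective 3
  have h3 : (3 : K) = 0 := by exact_mod_cast CharP.cast_eq_zero K 3
  intro v hv
  rw [contactJetTangentImage_cusp, mem_coordinateSubmodule]
  intro d hd
  rw [Set.mem_ofPred_eq, mem_cusp_bad] at hd
  have key : ∀ G : MvPolynomial (JetIndex 2 k) K, (∀ y : ContactIndex 2 k → F,
      MvPolynomial.aeval (fun d => coeff d.1 (contactValue ![2, 3] y)) G = 0) →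
      MvPolynomial.eval (jet k (powerSum K ![2, 3])) (constDerivation v G) = 0 := fun G hG => by
    rw [eval_constDerivation]
    refine differential_eq_zero_of_mem_jetTangentSpace hv G fun c hc => ?_
    obtain ⟨y, rfl⟩ := coeff_contactValue_of_mem_jetOrbit hc
    exact hG y
  by_cases h02 : d.1 0 = 0 ∧ d.1 1 = 2
  · -- the differential of `c11 ^ 2 - 4 * c20 * c02` at the jet of `x ^ 2 + y ^ 3`
    have hk : 2 ≤ k := by
      have := d.2
      rw [degree_eq_add] at this
      omega
    have hd02 : d = jx 0 2 hk := Subtype.ext (by rw [← ex_eta d.1, h02.1, h02.2]; rfl)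
    have h := key (MvPolynomial.X (jx 1 1 hk) ^ 2 - 4 * MvPolynomial.X (jx 2 0 hk) *
      MvPolynomial.X (jx 0 2 hk)) fun y => by
        simp only [map_sub, map_mul, map_pow, MvPolynomial.aeval_X, map_ofNat]
        exact sub_eq_zero.mpr (coeff_contactValue_cusp y).2.2.2
    have e11 : jet k (powerSum K ![2, 3]) (jx 1 1 hk) = 0 := by
      change coeff (ex 1 1) (powerSum K ![2, 3]) = 0
      simp [coeff_powerSum_two]
    have e20 : jet k (powerSum K ![2, 3]) (jx 2 0 hk) = 1 := by
      change coeff (ex 2 0) (powerSum K ![2, 3]) = 1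
      simp [coeff_powerSum_two]
    have e02 : jet k (powerSum K ![2, 3]) (jx 0 2 hk) = 0 := by
      change coeff (ex 0 2) (powerSum K ![2, 3]) = 0
      simp [coeff_powerSum_two]
    have h4 : constDerivation v (4 : MvPolynomial (JetIndex 2 k) K) = 0 := by
      rw [← map_ofNat (MvPolynomial.C : K →+* _), constDerivation_apply]
      simp
    simp only [map_sub, Derivation.leibniz, Derivation.leibniz_pow, constDerivation_X, h4,
      smul_eq_mul, map_add, map_mul, MvPolynomial.eval_X, MvPolynomial.eval_C, map_ofNat,
      nsmul_eq_mul, map_natCast, map_pow, e11, e20, e02, map_zero] at h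
    rw [hd02]
    linear_combination -h - v (jx 0 2 hk) * h3
  · have h := key (MvPolynomial.X d) fun y => by
      rw [MvPolynomial.aeval_X, ← ex_eta d.1]
      have h1 := coeff_contactValue_cusp y
      generalize d.1 0 = i at hd h02 ⊢
      generalize d.1 1 = j at hd h02 ⊢
      obtain ⟨rfl, rfl⟩ | ⟨rfl, rfl⟩ | ⟨rfl, rfl⟩ :
          (i = 0 ∧ j = 0) ∨ (i = 1 ∧ j = 0) ∨ (i = 0 ∧ j = 1) := by omega
      exacts [h1.1, h1.2.1, h1.2.2.1]
    rwa [constDerivation_X, MvPolynomial.eval_C] at h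

theorem contactJetTangentImage_eq_jetTangentSpace_cusp [Infinite F] (k : ℕ) :
    contactJetTangentImage k (powerSum K ![2, 3]) =
      jetTangentSpace (K' := F) (ContactGroup 2 F) k (powerSum K ![2, 3]) :=
  le_antisymm (contactJetTangentImage_le_jetTangentSpace _) (jetTangentSpace_cusp_le k)

theorem contactTangentImage_eq_tangentSpace_cusp [Infinite F] :
    (contactTangentImage (powerSum K ![2, 3])).restrictScalars K =
      tangentSpace (K' := F) (ContactGroup 2 F) (powerSum K ![2, 3]) := by
  refine le_antisymm (contactTangentImage_le_tangentSpace _) fun g hg => ?_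
  rw [Submodule.restrictScalars_mem, contactTangentImage_cusp, mem_span_monomial_iff]
  intro d hd
  -- the monomials outside the tangent image have degree at most 2
  have h2 := jetTangentSpace_cusp_le 2 (mem_tangentSpace_iff.mp hg 2)
  rw [contactJetTangentImage_cusp, mem_coordinateSubmodule] at h2
  have hd' := (mem_cusp_bad d).mp hd
  exact h2 ⟨d, by rw [degree_eq_add]; omega⟩ hd

theorem isSeparableMap_cusp (k : ℕ) :
    IsSeparableMap F (contactOrbitMap k (powerSum K ![2, 3])) := by
  classical
  have : CharP F 3 := charP_of_injective_algebraMap (algebraMap K F).injective 3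
  let E := FractionRing (MvPolynomial (ContactIndex 2 k) F)
  refine isSeparableMap_of_surjective (K' := F) _ (contactJet k (1 : ContactGroup 2 K))
    (J := {d : JetIndex 2 k // ¬ ∀ m ∈ cuspExponents, ¬ m ≤ d.1}) Subtype.val (fun c => ?_)
    fun d => ?_
  · have h : (fun d : JetIndex 2 k => if h : ¬ ∀ m ∈ cuspExponents, ¬ m ≤ d.1 then c ⟨d, h⟩ else 0) ∈
        contactJetTangentImage k (powerSum K ![2, 3]) := by
      rw [contactJetTangentImage_cusp, mem_coordinateSubmodule]
      exact fun d hd => dif_neg (not_not.mpr hd)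
    obtain ⟨w, hw⟩ := h
    refine ⟨w, fun d => ?_⟩
    rw [hw]
    exact dif_pos d.2
  · by_cases hd : ∀ m ∈ cuspExponents, ¬ m ≤ d.1
    · rw [mem_cusp_bad] at hd
      have : CharP (MvPolynomial (ContactIndex 2 k) F) 3 :=
        charP_of_injective_algebraMap (algebraMap F _).injective 3
      have hval := coeff_contactValue_cusp
        (MvPolynomial.X : ContactIndex 2 k → MvPolynomial (ContactIndex 2 k) F)
      simp only [map_contactOrbitMap]
      by_cases h02 : d.1 0 = 0 ∧ d.1 1 = 2
      · -- `c02 = c11 ^ 2 / (4 * c20)`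
        have hk : 2 ≤ k := by
          have := d.2
          rw [degree_eq_add] at this
          omega
        have hd02 : d = jx 0 2 hk := Subtype.ext (by rw [← ex_eta d.1, h02.1, h02.2]; rfl)
        have hrel : contactOrbitMap k (powerSum F ![2, 3]) (jx 1 1 hk) ^ 2 =
            4 * contactOrbitMap k (powerSum F ![2, 3]) (jx 2 0 hk) *
              contactOrbitMap k (powerSum F ![2, 3]) (jx 0 2 hk) := by
          simp only [contactOrbitMap_powerSum]
          exact hval.2.2.2
        have h20 : contactOrbitMap k (powerSum F ![2, 3]) (jx 2 0 hk) ≠ 0 := by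
          intro h
          have h1 := congrArg (MvPolynomial.eval (contactJet k (1 : ContactGroup 2 F))) h
          rw [eval_contactOrbitMap, map_zero] at h1
          have h2 := congrFun (jet_smul_powerSum k ![2, 3] (1 : ContactGroup 2 F)) (jx 2 0 hk)
          rw [one_smul] at h2
          have h4 : coeff (ex 2 0) (powerSum F ![2, 3]) = 0 := h2.trans h1
          simp [coeff_powerSum_two] at h4
        have h4 : (4 : E) ≠ 0 := by
          have h3 : CharP E 3 := charP_of_injective_algebraMap (algebraMap F E).injective 3
          have h3' : (3 : E) = 0 := by exact_mod_cast CharP.cast_eq_zero E 3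
          rw [show (4 : E) = 3 + 1 by norm_num, h3', zero_add]
          exact one_ne_zero
        have hrelE := congrArg (algebraMap (MvPolynomial (ContactIndex 2 k) F) E) hrel
        simp only [map_pow, map_mul, map_ofNat] at hrelE
        have h20E : algebraMap (MvPolynomial (ContactIndex 2 k) F) E
            (contactOrbitMap k (powerSum F ![2, 3]) (jx 2 0 hk)) ≠ 0 := by
          rwa [Ne, FaithfulSMul.algebraMap_eq_zero_iff]
        have hsolve : algebraMap (MvPolynomial (ContactIndex 2 k) F) E
            (contactOrbitMap k (powerSum F ![2, 3]) (jx 0 2 hk)) =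
          algebraMap _ E (contactOrbitMap k (powerSum F ![2, 3]) (jx 1 1 hk)) ^ 2 /
            (4 * algebraMap _ E (contactOrbitMap k (powerSum F ![2, 3]) (jx 2 0 hk))) := by
          rw [eq_div_iff (mul_ne_zero h4 h20E), hrelE]
          ring
        rw [hd02, hsolve]
        refine div_mem (pow_mem ?_ 2) (mul_mem (ofNat_mem _ 4) ?_)
        · refine IntermediateField.subset_adjoin _ _ ⟨⟨jx 1 1 hk, ?_⟩, rfl⟩
          rw [mem_cusp_bad]
          simp [jx]
        · refine IntermediateField.subset_adjoin _ _ ⟨⟨jx 2 0 hk, ?_⟩, rfl⟩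
          rw [mem_cusp_bad]
          simp [jx]
      · have h0 : contactOrbitMap k (powerSum F ![2, 3]) d = 0 := by
          rw [contactOrbitMap_powerSum, ← ex_eta d.1]
          generalize d.1 0 = i at hd h02 ⊢
          generalize d.1 1 = j at hd h02 ⊢
          obtain ⟨rfl, rfl⟩ | ⟨rfl, rfl⟩ | ⟨rfl, rfl⟩ :
              (i = 0 ∧ j = 0) ∨ (i = 1 ∧ j = 0) ∨ (i = 0 ∧ j = 1) := by omega
          exacts [hval.1, hval.2.1, hval.2.2.1]
        rw [h0, map_zero]
        exact zero_mem _
    · exact IntermediateField.subset_adjoin _ _ ⟨⟨d, hd⟩, rfl⟩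

end Tangent

end CharThreeCusp

end TangentImage
end

open TangentImage in
theorem mainTheorem8 {K : Type*} [Field K] (K' : Type*) [Field K'] [Algebra K K'] [IsAlgClosed K'] :
    -- `f = x_1 ^ p + ... + x_s ^ p` under the right group in characteristic `p`
    (∀ (p : ℕ) (_ : 0 < p) (_ : CharP K p) (s : ℕ) (_ : 0 < s) (f : PS s K),
      f = ∑ i, (MvPowerSeries.X i : PS s K) ^ p →
      jacobianIdeal f = ⊥ ∧
      rightTangentImage f = ⊥ ∧
      (∀ k : ℕ, p ≤ k →
        rightJetTangentImage k f = ⊥ ∧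
        1 ≤ zariskiDim (jetOrbit (K' := K') (RightGroup s K') k f) ∧
        1 ≤ Module.finrank K (jetTangentSpace (K' := K') (RightGroup s K') k f) ∧
        rightJetTangentImage k f < jetTangentSpace (K' := K') (RightGroup s K') k f ∧
        ¬ IsSeparableMap K' (rightOrbitMap k f)) ∧
      (rightTangentImage f).restrictScalars K < tangentSpace (K' := K') (RightGroup s K') f ∧
      ¬ IsFinitelyDetermined (RightGroup s K) f) ∧
    -- `f = x ^ 2 + y ^ 3` under the contact group in characteristic 2
    (CharP K 2 → ∀ (x y f : PS 2 K), x = MvPowerSeries.X 0 → y = MvPowerSeries.X 1 →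
      f = x ^ 2 + y ^ 3 →
      IsDetermined (ContactGroup 2 K) 4 f ∧
      contactTangentImage f = Ideal.span {x ^ 2, x * y ^ 2, y ^ 3} ∧
      Module.finrank K (contactJetTangentImage 4 f) = 10 ∧
      zariskiDim (contactJetGroup 2 K' 4) = 43 ∧
      zariskiDim (contactJetStabilizer K' 4 f) = 32 ∧
      zariskiDim (jetOrbit (K' := K') (ContactGroup 2 K') 4 f) = 11 ∧
      contactJetTangentImage 4 f < jetTangentSpace (K' := K') (ContactGroup 2 K') 4 f ∧
      ¬ IsSeparableMap K' (contactOrbitMap 4 f) ∧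
      (contactTangentImage f).restrictScalars K <
        tangentSpace (K' := K') (ContactGroup 2 K') f) ∧
    -- `f = x ^ 3 + y ^ 4` under the contact group in characteristic 3
    (CharP K 3 → ∀ (x y f : PS 2 K), x = MvPowerSeries.X 0 → y = MvPowerSeries.X 1 →
      f = x ^ 3 + y ^ 4 →
      Module.finrank K (contactJetTangentImage 5 f) = 11 ∧
      Module.finrank K (jetTangentSpace (K' := K') (ContactGroup 2 K') 5 f) = 12 ∧
      contactJetTangentImage 5 f < jetTangentSpace (K' := K') (ContactGroup 2 K') 5 f ∧
      ¬ IsSeparableMap K' (contactOrbitMap 5 f) ∧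
      (contactTangentImage f).restrictScalars K <
        tangentSpace (K' := K') (ContactGroup 2 K') f) ∧
    -- `f = x ^ 2 + y ^ 3` under the contact group in characteristic 3
    (CharP K 3 → ∀ (x y f : PS 2 K), x = MvPowerSeries.X 0 → y = MvPowerSeries.X 1 →
      f = x ^ 2 + y ^ 3 →
      (contactTangentImage f).restrictScalars K = tangentSpace (K' := K') (ContactGroup 2 K') f ∧
      ∀ k : ℕ,
        contactJetTangentImage k f = jetTangentSpace (K' := K') (ContactGroup 2 K') k f ∧
        IsSeparableMap K' (contactOrbitMap k f)) := by
  refine ⟨?_, ?_, ?_, ?_⟩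
  · rintro p hp hchar s hs f rfl
    have hprime : p.Prime := (CharP.char_is_prime_or_zero K p).resolve_right hp.ne'
    have i : Fin s := ⟨0, hs⟩
    change jacobianIdeal (powerSum K fun _ => p) = ⊥ ∧ _
    refine ⟨jacobianIdeal_powerSum_const p, rightTangentImage_powerSum_const p, fun k hk => ?_, ?_,
      not_isFinitelyDetermined_powerSum p hprime i⟩
    · have hmem : jet k (MvPowerSeries.X i ^ p : PS s K) ∈
          jetTangentSpace (K' := K') (RightGroup s K') k (powerSum K fun _ => p) :=
        jet_mem_jetTangentSpace_of_infinite k _ _ (infinite_rightOrbit_line p hp i)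
      have hne := jet_X_pow_ne_zero (K := K) i hk
      refine ⟨rightJetTangentImage_powerSum_const p k, one_le_zariskiDim_jetOrbit_powerSum p hp i hk,
        ?_, ?_, not_isSeparableMap_rightOrbitMap p hp i hk⟩
      · rw [Nat.one_le_iff_ne_zero, Ne, Submodule.finrank_eq_zero]
        exact fun h => hne ((Submodule.mem_bot K).mp (h ▸ hmem))
      · change rightJetTangentImage k (powerSum K fun _ => p) < _
        rw [rightJetTangentImage_powerSum_const, bot_lt_iff_ne_bot]
        exact fun h => hne ((Submodule.mem_bot K).mp (h ▸ hmem))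
    · have hmem : (MvPowerSeries.X i ^ p : PS s K) ∈
          tangentSpace (K' := K') (RightGroup s K') (powerSum K fun _ => p) :=
        mem_tangentSpace_of_infinite _ _ (infinite_rightOrbit_line p hp i)
      change (rightTangentImage (powerSum K fun _ => p)).restrictScalars K < _
      rw [rightTangentImage_powerSum_const, Submodule.restrictScalars_bot, bot_lt_iff_ne_bot]
      exact fun h => X_pow_ne_zero i p ((Submodule.mem_bot K).mp (h ▸ hmem))
  · rintro hchar x y f rfl rfl rfl
    have : Fact (Nat.Prime 2) := ⟨Nat.prime_two⟩
    have : CharP K' 2 := charP_of_injective_algebraMap (algebraMap K K').injective 2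
    rw [show (MvPowerSeries.X 0 ^ 2 + MvPowerSeries.X 1 ^ 3 : PS 2 K) = powerSum K ![2, 3] by
      simp [powerSum, Fin.sum_univ_two]]
    refine ⟨isDetermined_four_of_charTwo, ?_,
      (finrank_contactJetTangentImage_frobenius 2 4).trans (by decide),
      (zariskiDim_contactJetGroup 4).trans ?_, zariskiDim_contactJetStabilizer,
      zariskiDim_jetOrbit_charTwo, contactJetTangentImage_lt 2 (by norm_num),
      not_isSeparableMap_charTwo, contactTangentImage_lt 2⟩
    · refine (contactTangentImage_frobenius 2).trans ?_
      rw [frobeniusExponents, span_monomial_triple]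
      simp
    · rw [show (contactGrid 4).card = 43 by decide]
      rfl
  · rintro hchar x y f rfl rfl rfl
    have : Fact (Nat.Prime 3) := ⟨Nat.prime_three⟩
    rw [show (MvPowerSeries.X 0 ^ 3 + MvPowerSeries.X 1 ^ 4 : PS 2 K) = powerSum K ![3, 4] by
      simp [powerSum, Fin.sum_univ_two]]
    exact ⟨(finrank_contactJetTangentImage_frobenius 3 5).trans (by decide),
      finrank_jetTangentSpace_charThree, contactJetTangentImage_lt 3 (by norm_num),
      not_isSeparableMap_charThree, contactTangentImage_lt 3⟩
  · rintro hchar x y f rfl rfl rfl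
    rw [show (MvPowerSeries.X 0 ^ 2 + MvPowerSeries.X 1 ^ 3 : PS 2 K) = powerSum K ![2, 3] by
      simp [powerSum, Fin.sum_univ_two]]
    exact ⟨contactTangentImage_eq_tangentSpace_cusp, fun k =>
      ⟨contactJetTangentImage_eq_jetTangentSpace_cusp k, isSeparableMap_cusp k⟩⟩
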